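/- Let $d,k\in\mathbb N$ with $2k>d$, let $\hbar,\beta,m,\nu,\epsilon>0$, and let $V\in H^{k+2}(\mathbb R^d;\mathbb R)$. **Setting.** Let $X_k:=L^2(\mathbb R^{2d},(1+|v|^{2k})\,dx\,dv;\mathbb R)$, $n[w](x):=\int w(x,v)\,dv$ and $(X_k)^0:=\{w\in X_k: n[w]=0\}$. Let $\mathcal F$ be the Fourier transform from $v$ to $\eta$, with kernel $(2\pi)^{-d/2}e^{-iv\cdot\eta}$. Put $$\delta V(x,\eta)=\tfrac1\hbar\Big[V\big(x+\tfrac{\hbar\eta}{2m}\big)-V\big(x-\tfrac{\hbar\eta}{2m}\big)\Big],\qquad F(v)=\Big(\tfrac{\beta m}{2\pi}\Big)^{d/2}e^{-\beta m|v|^2/2},$$ $$\mathcal A w=\Theta[V]w=\frac{i}{(2\pi)^d}\int\!\!\int\delta V(x,\eta)\,w(x,v')\,e^{i(v-v')\cdot\eta}\,dv'\,d\eta,\qquad \mathcal C w=-(\nu w-\Omega w),$$ $$\Omega w=\nu F(v)\Big\{1+\hbar^2\tfrac{\beta^2}{24}\Big[-\tfrac1m\Delta V+\beta\sum_{r,s}v_rv_s\,\partial_r\partial_sV\Big]\Big\}\,n[w],$$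 $$M(x,v)=\nu\,\mathcal F^{-1}\Big\{\frac{\mathcal F F(\eta)}{\nu-i\,\delta V(x,\eta)}\Big(1-\frac{\beta\hbar^2}{24m^2}\sum_{r,s}\eta_r\eta_s\,\partial_r\partial_sV(x)\Big)\Big\}(v),$$ $$\mathcal P w=M\,n[w],\qquad \mathcal Q=\mathcal I-\mathcal P,\qquad Sw=-v\cdot\nabla_xw,\qquad D(S)=\{w\in X_k: Sw\in X_k\}.$$ For $w\in X_k$ we understand $\mathcal PSw$ as $M\,n[Sw]$ whenever the distribution $n[Sw]$ on $\mathbb R^d_x$, given by $\chi\mapsto\int\big(\int w\,v\cdot\nabla\chi\,dx\big)dv$ for $\chi\in C_c^\infty(\mathbb R^d)$ (with absolutely convergent outer integral), is a function in $L^2_x$. For $w\in D(S)$ this is $\mathcal P$ applied to $Sw$. The inverse $(\mathcal Q(\mathcal A+\mathcal C)\mathcal Q)^{-1}$ is taken in $(X_k)^0$. **Statement.** Let $n(t)\in H^1(\mathbb R^d;\mathbb R)$ for every $t>0$, and put $\bar\varphi(x,v,t)=n(x,t)M(x,v)$. Then, for every $t>0$, the following are equivalent. (i) $\bar\varphi$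 is differentiable at $t$ as a curve in $X_k$, $\mathcal P\bar\varphi(t)\in D(S)$, the other terms below are defined in the sense just described, and at time $t$ $$\frac{\partial\bar\varphi}{\partial t}=\mathcal{PSP}\bar\varphi-\epsilon\,\mathcal{PSQ}\,\big(\mathcal Q(\mathcal A+\mathcal C)\mathcal Q\big)^{-1}\mathcal{QSP}\bar\varphi\quad\text{in }X_k .$$ (ii) $n$ is differentiable at $t$ as a curve in $L^2(\mathbb R^d)$ and, at time $t$, in the sense of distributions on $\mathbb R^d_x$, $$\frac{\partial n}{\partial t}-\frac1{\nu m}\nabla\cdot(n\nabla V)-\frac{\epsilon}{\nu\beta m}\nabla\cdot\nabla n-\frac{\epsilon}{\nu^3m^2}\Big[\nabla\cdot\big(n(\nabla\otimes\nabla)V\,\nabla V\big)+\nabla\cdot\nabla\cdot\big(n\nabla V\otimes\nabla V\big)\Big]-\frac{\epsilon\beta\hbar^2}{12\nu m^2}\nabla\cdot\nabla\cdot\big(n\nabla\otimes\nabla V\big)=0 .$$ -/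

import Mathlib

open MeasureTheory Filter Topology
open scoped ContDiff

noncomputable section

namespace HighField

/-- Position (or velocity) space `ℝ^d` with its Euclidean structure. -/
abbrev Space (d : ℕ) : Type := EuclideanSpace ℝ (Fin d)

/-- Phase space; a point is `p = (x, v)`. -/
abbrev Phase (d : ℕ) : Type := Space d × Space d

/-- The physical constants: reduced Planck constant, inverse temperature, mass, collision
frequency. -/
structure Constants where
  hbar : ℝ
  beta : ℝ
  mass : ℝ
  nu : ℝ

/-- All four constants are positive. -/
def Constants.Pos (c : Constants) : Prop :=
  0 < c.hbar ∧ 0 < c.beta ∧ 0 < c.mass ∧ 0 < c.nu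

variable {d : ℕ}

/-! ### Test functions, weak derivatives, Sobolev spaces -/

/-- Smooth compactly supported real functions. -/
def IsTest {X : Type*} [NormedAddCommGroup X] [NormedSpace ℝ X] (χ : X → ℝ) : Prop :=
  ContDiff ℝ ∞ χ ∧ HasCompactSupport χ

/-- The classical partial derivative `∂_i χ` (used for test functions). -/
def partialD (i : Fin d) (χ : Space d → ℝ) (x : Space d) : ℝ :=
  fderiv ℝ χ x (EuclideanSpace.single i 1)

/-- `g` is the weak derivative `∂_i f`. -/
def IsWeakDeriv (i : Fin d) (f g : Space d → ℝ) : Prop :=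
  LocallyIntegrable f volume ∧ LocallyIntegrable g volume ∧
    ∀ χ : Space d → ℝ, IsTest χ → ∫ x, f x * partialD i χ x = -∫ x, g x * χ x

open Classical in
/-- A representative of the weak derivative `∂_i f` (and `0` if there is none). -/
def weakDeriv (i : Fin d) (f : Space d → ℝ) : Space d → ℝ :=
  if h : ∃ g, IsWeakDeriv i f g then h.choose else 0

/-- `f ∈ H^s(ℝ^d; ℝ)`: `f` is square integrable and, as a tempered distribution, it lies in the
`L²`-based Sobolev space of order `s`. -/
def MemH (s : ℕ) (f : Space d → ℝ) : Prop :=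
  ∃ hf : MemLp (fun x => (f x : ℂ)) 2 (volume : Measure (Space d)),
    TemperedDistribution.MemSobolev (s : ℝ) 2 (Lp.toTemperedDistribution (MemLp.toLp _ hf))

/-- `∂_i V`. -/
def grad (V : Space d → ℝ) (i : Fin d) : Space d → ℝ := weakDeriv i V

/-- `∂²V / ∂x_i ∂x_j`. -/
def hess (V : Space d → ℝ) (i j : Fin d) : Space d → ℝ := weakDeriv i (weakDeriv j V)

/-- `ΔV`. -/
def lapl (V : Space d → ℝ) (x : Space d) : ℝ := ∑ i, hess V i i x

/-! ### The weighted space `X_k` -/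

/-- The measure `(1 + |v|^{2k}) dx dv`. -/
def weight (d k : ℕ) : Measure (Phase d) :=
  (volume : Measure (Phase d)).withDensity (fun p => ENNReal.ofReal (1 + ‖p.2‖ ^ (2 * k)))

/-- `w ∈ X_k = L²(ℝ^{2d}, (1 + |v|^{2k}) dx dv; ℝ)`. -/
def MemX (k : ℕ) (w : Phase d → ℝ) : Prop := MemLp w 2 (weight d k)

/-- The density `n[w](x) = ∫ w(x,v) dv`. -/
def density (w : Phase d → ℝ) (x : Space d) : ℝ := ∫ v, w (x, v)

/-- `w ∈ (X_k)^0`: `w ∈ X_k` and `∫ w(x,v) dv = 0`. -/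
def MemX0 (k : ℕ) (w : Phase d → ℝ) : Prop := MemX k w ∧ density w =ᵐ[volume] 0

/-- The curve `u : ℝ → L²(μ)` is defined near `t` and has the (strong) derivative `u'` at `t`. -/
def HasL2DerivAt {X : Type*} [MeasurableSpace X] (μ : Measure X) (u : ℝ → X → ℝ) (u' : X → ℝ)
    (t : ℝ) : Prop :=
  (∀ᶠ s in 𝓝 t, MemLp (u s) 2 μ) ∧ MemLp u' 2 μ ∧
    Tendsto (fun s => eLpNorm (fun y => (s - t)⁻¹ * (u s y - u t y) - u' y) 2 μ) (𝓝[≠] t) (𝓝 0)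

/-! ### The operators -/

/-- `δV(x,η) = ħ⁻¹ [V(x + ħη/(2m)) - V(x - ħη/(2m))]`. -/
def deltaV (c : Constants) (V : Space d → ℝ) (x η : Space d) : ℝ :=
  1 / c.hbar * (V (x + (c.hbar / (2 * c.mass)) • η) - V (x - (c.hbar / (2 * c.mass)) • η))

/-- The formula for `Θ[V]w`, complex valued a priori. -/
def thetaC (c : Constants) (V : Space d → ℝ) (w : Phase d → ℝ) (p : Phase d) : ℂ :=
  Complex.I / (2 * (Real.pi : ℂ)) ^ d *
    ∫ η : Space d, ∫ v' : Space d, (deltaV c V p.1 η : ℂ) * (w (p.1, v') : ℂ) *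
      Complex.exp (Complex.I * ((inner ℝ (p.2 - v') η : ℝ) : ℂ))

/-- `A w = Θ[V] w`; the imaginary part of `thetaC` vanishes, see `thetaC_im`. -/
def opA (c : Constants) (V : Space d → ℝ) (w : Phase d → ℝ) (p : Phase d) : ℝ :=
  (thetaC c V w p).re

/-- The normalized Maxwellian `F(v) = (βm/2π)^{d/2} exp(-βm|v|²/2)`. -/
def maxwellian (c : Constants) (v : Space d) : ℝ :=
  (c.beta * c.mass / (2 * Real.pi)) ^ ((d : ℝ) / 2) * Real.exp (-(c.beta * c.mass * ‖v‖ ^ 2 / 2))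

/-- `Ωw = ν F(v) {1 + ħ² (β²/24) [-ΔV/m + β ∑ v_r v_s ∂_r∂_s V]} n[w]`. -/
def opOmega (c : Constants) (V : Space d → ℝ) (w : Phase d → ℝ) (p : Phase d) : ℝ :=
  c.nu * maxwellian c p.2 *
    (1 + c.hbar ^ 2 * (c.beta ^ 2 / 24) *
      (-(1 / c.mass) * lapl V p.1 + c.beta * ∑ r, ∑ s, p.2 r * p.2 s * hess V r s p.1)) *
    density w p.1

/-- `C w = -(ν w - Ω w)`. -/
def opC (c : Constants) (V : Space d → ℝ) (w : Phase d → ℝ) (p : Phase d) : ℝ :=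
  -(c.nu * w p - opOmega c V w p)

/-- `A + C`. -/
def opAC (c : Constants) (V : Space d → ℝ) (w : Phase d → ℝ) (p : Phase d) : ℝ :=
  opA c V w p + opC c V w p

/-- Fourier transform in velocity, `(2π)^{-d/2} ∫ f(v) e^{-i v·η} dv`. -/
def fourierV (f : Space d → ℂ) (η : Space d) : ℂ :=
  ((2 * Real.pi) ^ (-(d : ℝ) / 2) : ℝ) *
    ∫ v : Space d, f v * Complex.exp (-(Complex.I * ((inner ℝ v η : ℝ) : ℂ)))

/-- Inverse Fourier transform in velocity, `(2π)^{-d/2} ∫ g(η) e^{i v·η} dη`. -/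
def fourierVInv (g : Space d → ℂ) (v : Space d) : ℂ :=
  ((2 * Real.pi) ^ (-(d : ℝ) / 2) : ℝ) *
    ∫ η : Space d, g η * Complex.exp (Complex.I * ((inner ℝ v η : ℝ) : ℂ))

/-- The formula for `M`, complex valued a priori:
`ν 𝓕⁻¹{ 𝓕F(η) / (ν - i δV(x,η)) · (1 - βħ²/(24m²) ∑ η_r η_s ∂_r∂_s V(x)) }(v)`. -/
def profileC (c : Constants) (V : Space d → ℝ) (p : Phase d) : ℂ :=
  c.nu * fourierVInv (fun η =>
    fourierV (fun v => (maxwellian c v : ℂ)) η /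
        ((c.nu : ℂ) - Complex.I * (deltaV c V p.1 η : ℂ)) *
      ((1 - c.beta * c.hbar ^ 2 / (24 * c.mass ^ 2) *
        ∑ r, ∑ s, η r * η s * hess V r s p.1 : ℝ) : ℂ)) p.2

/-- The local profile `M(x,v)`; the imaginary part of `profileC` vanishes, see `profileC_im`. -/
def profile (c : Constants) (V : Space d → ℝ) (p : Phase d) : ℝ := (profileC c V p).re

/-- `P w = M ∫ w dv`. -/
def opP (c : Constants) (V : Space d → ℝ) (w : Phase d → ℝ) (p : Phase d) : ℝ :=
  profile c V p * density w p.1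

/-- `Q = I - P`. -/
def opQ (c : Constants) (V : Space d → ℝ) (w : Phase d → ℝ) (p : Phase d) : ℝ :=
  w p - opP c V w p

/-- `w ∈ D(S)` and `S w = f`: both lie in `X_k` and `f = -v·∇_x w` as distributions on phase
space. -/
def IsS (k : ℕ) (w f : Phase d → ℝ) : Prop :=
  MemX k w ∧ MemX k f ∧ ∀ Φ : Phase d → ℝ, IsTest Φ →
    ∫ p, f p * Φ p = ∫ p, w p * ∑ i, p.2 i * fderiv ℝ Φ p (EuclideanSpace.single i 1, 0)

/-- `a = n[S w] = ∫ S w dv = -∇_x·∫ v w dv` as distributions in `x`: for every test function `χ`,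
`∫ a χ dx = ∫ (∫ w v·∇χ dx) dv`, where the outer integral converges absolutely. -/
def IsStreamDensity (w : Phase d → ℝ) (a : Space d → ℝ) : Prop :=
  ∀ χ : Space d → ℝ, IsTest χ →
    Integrable (fun v : Space d => ∫ x, w (x, v) * ∑ i, v i * partialD i χ x) ∧
    ∫ x, a x * χ x = ∫ v : Space d, ∫ x, w (x, v) * ∑ i, v i * partialD i χ x

/-- `P S w = g` for `w ∈ X_k`: `g = M n[S w]`, where the density `n[S w]` of the distribution
`S w` is required to belong to `L²_x`. If `w ∈ D(S)`, this `g` is `P` applied to `S w ∈ X_k`. -/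
def IsPS (c : Constants) (V : Space d → ℝ) (k : ℕ) (w g : Phase d → ℝ) : Prop :=
  MemX k w ∧ ∃ a : Space d → ℝ, MemLp a 2 (volume : Measure (Space d)) ∧ IsStreamDensity w a ∧
    g = fun p => profile c V p * a p.1

/-- `Q (A + C) Q w`. -/
def opQACQ (c : Constants) (V : Space d → ℝ) (w : Phase d → ℝ) : Phase d → ℝ :=
  opQ c V (opAC c V (opQ c V w))

/-- `ψ = (Q (A + C) Q)⁻¹ r` in `(X_k)^0`: both lie in `(X_k)^0`, and `ψ` is the only element of
`(X_k)^0` (up to null sets) that `Q (A + C) Q` maps to `r`. -/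
def IsQACQInv (c : Constants) (V : Space d → ℝ) (k : ℕ) (r ψ : Phase d → ℝ) : Prop :=
  MemX0 k r ∧ MemX0 k ψ ∧ opQACQ c V ψ =ᵐ[volume] r ∧
    ∀ ψ' : Phase d → ℝ, MemX0 k ψ' → opQACQ c V ψ' =ᵐ[volume] r → ψ' =ᵐ[volume] ψ

/-! ### The two equations -/

/-- The function `n M` on phase space. -/
def bulk (c : Constants) (V : Space d → ℝ) (n : Space d → ℝ) (p : Phase d) : ℝ :=
  n p.1 * profile c V p

/-- At time `t`, `φ = n M` satisfies in `X_k` the equation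
`∂_t φ = P S P φ - ε P S Q (Q (A + C) Q)⁻¹ Q S P φ`.
Here `f` is `S P φ`, `ψ` is `(Q (A + C) Q)⁻¹ Q S P φ` and `g` is `P S Q ψ`. -/
def SolvesBulkAt (c : Constants) (V : Space d → ℝ) (k : ℕ) (ε : ℝ) (n : ℝ → Space d → ℝ)
    (t : ℝ) : Prop :=
  ∃ φ' f ψ g : Phase d → ℝ,
    HasL2DerivAt (weight d k) (fun s => bulk c V (n s)) φ' t ∧
    IsS k (opP c V (bulk c V (n t))) f ∧
    IsQACQInv c V k (opQ c V f) ψ ∧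
    IsPS c V k (opQ c V ψ) g ∧
    φ' =ᵐ[volume] fun p => opP c V f p - ε * g p

/-- The distribution `∇·G`, tested against `χ`. -/
def distDiv (G : Fin d → Space d → ℝ) (χ : Space d → ℝ) : ℝ :=
  -∫ x, ∑ i, G i x * partialD i χ x

/-- The distribution `∇·∇·T = ∑ ∂_i ∂_j T_ij`, tested against `χ`. -/
def distDivDiv (T : Fin d → Fin d → Space d → ℝ) (χ : Space d → ℝ) : ℝ :=
  ∫ x, ∑ i, ∑ j, T i j x * partialD i (partialD j χ) x

/-- The distribution `∇·∇u`, tested against `χ`. -/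
def distLapl (u : Space d → ℝ) (χ : Space d → ℝ) : ℝ :=
  ∫ x, u x * ∑ i, partialD i (partialD i χ) x

/-- At time `t`, `n` satisfies the high-field quantum drift-diffusion equation: `n` has a time
derivative `n'` in `L²_x`, and the equation holds in the sense of distributions in `x`. -/
def SolvesQDDAt (c : Constants) (V : Space d → ℝ) (ε : ℝ) (n : ℝ → Space d → ℝ) (t : ℝ) : Prop :=
  ∃ n' : Space d → ℝ, HasL2DerivAt (volume : Measure (Space d)) n n' t ∧
    ∀ χ : Space d → ℝ, IsTest χ →
      (∫ x, n' x * χ x)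
        - 1 / (c.nu * c.mass) * distDiv (fun i x => n t x * grad V i x) χ
        - ε / (c.nu * c.beta * c.mass) * distLapl (n t) χ
        - ε / (c.nu ^ 3 * c.mass ^ 2) *
          (distDiv (fun i x => n t x * ∑ j, hess V i j x * grad V j x) χ
            + distDivDiv (fun i j x => n t x * (grad V i x * grad V j x)) χ)
        - ε * c.beta * c.hbar ^ 2 / (12 * c.nu * c.mass ^ 2) *
          distDivDiv (fun i j x => n t x * hess V i j x) χ = 0

/-! ### Realness of the formulas for `Θ[V]w` and `M` -/

theorem deltaV_neg (c : Constants) (V : Space d → ℝ) (x η : Space d) :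
    deltaV c V x (-η) = -deltaV c V x η := by
  simp only [deltaV, smul_neg, sub_neg_eq_add, ← sub_eq_add_neg]
  ring

theorem fourierV_conj_neg (f : Space d → ℝ) (η : Space d) :
    (starRingEnd ℂ) (fourierV (fun v => (f v : ℂ)) (-η)) = fourierV (fun v => (f v : ℂ)) η := by
  simp only [fourierV, map_mul, ← integral_conj, Complex.conj_ofReal, ← Complex.exp_conj,
    inner_neg_right, Complex.ofReal_neg, Complex.conj_I, neg_mul, mul_neg, neg_neg]

theorem conj_integral_eq_self {g : Space d → ℂ} (hg : ∀ η, (starRingEnd ℂ) (g (-η)) = g η) :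
    (starRingEnd ℂ) (∫ η, g η) = ∫ η, g η := by
  rw [← integral_conj, ← integral_neg_eq_self (μ := (volume : Measure (Space d)))]
  simp only [hg]

theorem conj_integral_eq_neg {g : Space d → ℂ} (hg : ∀ η, (starRingEnd ℂ) (g (-η)) = -g η) :
    (starRingEnd ℂ) (∫ η, g η) = -∫ η, g η := by
  rw [← integral_conj, ← integral_neg_eq_self (μ := (volume : Measure (Space d)))]
  simp only [hg, integral_neg]

theorem thetaC_im (c : Constants) (V : Space d → ℝ) (w : Phase d → ℝ) (p : Phase d) :
    (thetaC c V w p).im = 0 := by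
  rw [← Complex.conj_eq_iff_im, thetaC, map_mul, conj_integral_eq_neg]
  · simp only [map_div₀, map_pow, map_mul, Complex.conj_I, Complex.conj_ofReal, map_ofNat]
    ring
  · intro η
    rw [← integral_conj, ← integral_neg]
    refine integral_congr_ae (Eventually.of_forall fun v' => ?_)
    simp only [map_neg, map_mul, Complex.conj_ofReal, ← Complex.exp_conj, Complex.conj_I, deltaV_neg,
      inner_neg_right, Complex.ofReal_neg, neg_mul, mul_neg, neg_neg]

theorem profileC_im (c : Constants) (V : Space d → ℝ) (p : Phase d) :
    (profileC c V p).im = 0 := by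
  rw [← Complex.conj_eq_iff_im, profileC, fourierVInv, map_mul, map_mul, conj_integral_eq_self]
  · simp only [Complex.conj_ofReal]
  · intro η
    simp only [map_neg, map_mul, map_div₀, map_sub, Complex.conj_ofReal, fourierV_conj_neg,
      ← Complex.exp_conj, Complex.conj_I, deltaV_neg, inner_neg_right, Complex.ofReal_neg,
      neg_mul, mul_neg, neg_neg, PiLp.neg_apply]

end HighField

end

open HighField

open scoped ContDiff FourierTransform SchwartzMap LineDeriv ENNReal

noncomputable section

namespace HighField

variable {d : ℕ}

/-! Write `V` as a superposition of plane waves with a Hermitian spectral density `W` such that `(1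
+ |ξ|)^(k+2) W` is in L². Then `Θ[V]` becomes the velocity integral operator `opK`, sending `w` to
`∫ ker(x,ξ) w(x, v + aξ) dξ`, and its kernel is odd in `ξ`. Hence `Θ` is skew symmetric on L² and `ν
- Θ` is coercive. Conjugation with the weight `(R + |v|)^j` changes `Θ` by an operator whose norm
tends to 0 as `R → ∞`, so `ν - Θ` is also solvable in the velocity-weighted spaces up to order `k +
2` (`exists_resolvent`). Lax-Milgram in the graph of `∂_{x_j}` gives position derivatives of
solutions (`exists_weakX_resolvent`).

In the Fourier variable of `v`, `Θ` is multiplication by `iδV`. The formula for `M` therefore says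
that `nM` solves `(ν - Θ)(nM) = ν n (F + βħ²/(24m²) ∑ ∂_r∂_sV ∂_r∂_sF)` (`mul_profile_ae_eq`). Up to
second order the velocity moments of `Θ` are those of the classical force term: `n[Θw] = 0`, `n[v_i
Θw] = -∂_iV n[w]/m`, and `n[v_i v_j Θw] = -(∂_iV n[v_j w] + ∂_jV n[v_i w])/m`. So low moments of a
solution follow from those of the source. In particular `n[nM] = n`, and `n[S(nM)] = ∇·(n∇V)/(νm)`
is the drift term.

On functions of zero density `Q(A+C)Q` is `Θ - ν`, so the corrector `ψ = (Q(A+C)Q)⁻¹QS(nM)` solves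
`(ν - Θ)ψ = ∑ v_j ∂_j(nM) + n[S(nM)] M`. It is only known to lie in `X_k`, which does not make `vψ`
integrable. It is therefore written as `ψ = ∑ ∂_j u_j + z` with `(ν - Θ)u_j = v_j nM`, where `z`
compensates the commutators `Θ[∂_jV]u_j` (`IsFlow`). Both `u_j` and `z` carry one more velocity
weight, and the derivatives `∂_j` are moved onto the test function. Their moments show that `-n[Sψ]`
is the sum of all the terms of order `ε` (`IsFlow.stream_eq_dist`).

Finally `q ↦ qM` is bounded from L² to `X_k`, and the density is a bounded left inverse. So the
equation in `X_k` is equivalent to its density, `∂_t n = n[S(nM)] - ε n[Sψ]`. In the converse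
direction the required square integrability of `n[Sψ]` is read off the equation, because `∂_t n` and
`n[S(nM)]` are in L². -/

/-- Smooth compactly supported complex functions. -/
def IsTestC (φ : Space d → ℂ) : Prop := ContDiff ℝ ∞ φ ∧ HasCompactSupport φ

/-- `g` is the inverse Fourier transform of `G`, tested against smooth compactly supported
functions. -/
def IsInvFT (g G : Space d → ℂ) : Prop :=
  ∀ φ : Space d → ℂ, IsTestC φ → ∫ x, g x * φ x = ∫ x, G x * 𝓕⁻ φ x

/-! ### Fourier inversion tested against compactly supported functions. -/

theorem IsTestC.exists_schwartz {φ : Space d → ℂ} (h : IsTestC φ) :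
    ∃ Φ : 𝓢(Space d, ℂ), (Φ : Space d → ℂ) = φ :=
  ⟨h.2.toSchwartzMap h.1, rfl⟩

theorem IsTestC.integrable_fourierInv {φ : Space d → ℂ} (h : IsTestC φ) :
    Integrable (𝓕⁻ φ) := by
  obtain ⟨Φ, rfl⟩ := h.exists_schwartz
  rw [← SchwartzMap.fourierInv_coe]
  exact (𝓕⁻ Φ).integrable

theorem IsTestC.memLp_fourierInv {φ : Space d → ℂ} (h : IsTestC φ) :
    MemLp (𝓕⁻ φ) 2 := by
  obtain ⟨Φ, rfl⟩ := h.exists_schwartz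
  rw [← SchwartzMap.fourierInv_coe]
  exact (𝓕⁻ Φ).memLp 2

theorem IsTestC.fourier_fourierInv {φ : Space d → ℂ} (h : IsTestC φ) :
    𝓕 (𝓕⁻ φ) = φ := by
  obtain ⟨Φ, rfl⟩ := h.exists_schwartz
  rw [← SchwartzMap.fourierInv_coe, ← SchwartzMap.fourier_coe, FourierTransform.fourier_fourierInv_eq]

theorem integral_fourier_mul_eq {f g : Space d → ℂ} (hf : Integrable f) (hg : Integrable g) :
    ∫ ξ, 𝓕 f ξ * g ξ = ∫ x, f x * 𝓕 g x := by
  have := VectorFourier.integral_fourierIntegral_smul_eq_flip (L := innerₗ (Space d))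
    (μ := volume) (ν := volume) Real.continuous_fourierChar continuous_inner hf hg
  simpa [flip_innerₗ, smul_eq_mul] using! this

theorem integral_fourierInv_mul_eq {f g : Space d → ℂ} (hf : Integrable f) (hg : Integrable g) :
    ∫ ξ, 𝓕⁻ f ξ * g ξ = ∫ x, f x * 𝓕⁻ g x := by
  have h := integral_fourier_mul_eq (hf) (hg.comp_neg)
  have h1 : ∫ ξ, 𝓕⁻ f ξ * g ξ = ∫ ξ, 𝓕 f ξ * g (-ξ) := by
    rw [← integral_neg_eq_self (μ := (volume : Measure (Space d)))]
    simp only [Real.fourierInv_eq_fourier_neg, neg_neg]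
  rw [h1, h]
  congr 1; ext x
  rw [Real.fourierInv_eq_fourier_comp_neg]

theorem isInvFT_of_integrable {G : Space d → ℂ} (hG : Integrable G) : IsInvFT (𝓕⁻ G) G := by
  intro φ hφ
  exact integral_fourierInv_mul_eq hG (hφ.1.continuous.integrable_of_hasCompactSupport hφ.2)

/-- The L² transform is compatible with the transform of tempered distributions, and smooth
compactly supported functions are Schwartz. -/
theorem isInvFT_Lp (G : Lp (α := Space d) ℂ 2 volume) : IsInvFT (𝓕⁻ G : Lp (α := Space d) ℂ 2 volume) G := by
  intro φ hφ
  obtain ⟨Φ, rfl⟩ := hφ.exists_schwartz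
  have h := Lp.fourierInv_toTemperedDistribution_eq G
  have h2 := congrArg (fun T : 𝓢'(Space d, ℂ) => T Φ) h
  simp only [TemperedDistribution.fourierInv_apply, Lp.toTemperedDistribution_apply,
    smul_eq_mul, SchwartzMap.fourierInv_coe] at h2
  rw [← SchwartzMap.fourierInv_coe]
  simpa only [mul_comm, SchwartzMap.fourierInv_coe] using h2.symm

theorem IsInvFT.congr {g g' G G' : Space d → ℂ} (h : IsInvFT g G) (hg : g =ᵐ[volume] g')
    (hG : G =ᵐ[volume] G') : IsInvFT g' G' := by
  intro φ hφ
  have h1 : ∫ x, g' x * φ x = ∫ x, g x * φ x :=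
    integral_congr_ae (hg.mono fun x hx => by simp only [hx])
  have h2 : ∫ x, G' x * 𝓕⁻ φ x = ∫ x, G x * 𝓕⁻ φ x :=
    integral_congr_ae (hG.mono fun x hx => by simp only [hx])
  rw [h1, h2, h φ hφ]

theorem exists_isInvFT_left {G : Space d → ℂ} (hG : MemLp G 2) :
    ∃ g : Space d → ℂ, MemLp g 2 ∧ IsInvFT g G :=
  ⟨_, Lp.memLp _, (isInvFT_Lp (hG.toLp G)).congr (ae_eq_refl _) hG.coeFn_toLp⟩

theorem isTestC_ofReal {χ : Space d → ℝ} (h : IsTest χ) : IsTestC (fun x => (χ x : ℂ)) :=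
  ⟨Complex.ofRealCLM.contDiff.comp h.1, h.2.comp_left (g := fun r : ℝ => (r : ℂ)) rfl⟩

theorem IsInvFT.unique {g g' G : Space d → ℂ} (h : IsInvFT g G) (h' : IsInvFT g' G)
    (hg : LocallyIntegrable g) (hg' : LocallyIntegrable g') : g =ᵐ[volume] g' := by
  refine ae_eq_of_integral_contDiff_smul_eq hg hg' fun χ h1 h2 => ?_
  have := (h _ (isTestC_ofReal ⟨h1, h2⟩)).trans (h' _ (isTestC_ofReal ⟨h1, h2⟩)).symm
  simpa only [Complex.real_smul, mul_comm] using this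

theorem memLp_two_locallyIntegrable {X : Type*} [TopologicalSpace X] [MeasurableSpace X]
    {F : Type*} [NormedAddCommGroup F] {μ : Measure X} [IsLocallyFiniteMeasure μ] {g : X → F}
    (h : MemLp g 2 μ) : LocallyIntegrable g μ :=
  h.locallyIntegrable one_le_two

/-- The Fourier inversion theorem, almost everywhere. -/
theorem fourierInv_fourier_ae {u : Space d → ℂ} (hu : Integrable u) (hu' : Integrable (𝓕 u)) :
    𝓕⁻ (𝓕 u) =ᵐ[volume] u := by
  have hc : Continuous (𝓕⁻ (𝓕 u)) := by
    have : 𝓕⁻ (𝓕 u) = fun v => 𝓕 (𝓕 u) (-v) := by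
      ext v; rw [Real.fourierInv_eq_fourier_neg]
    rw [this]
    exact (VectorFourier.fourierIntegral_continuous Real.continuous_fourierChar
      (L := innerₗ (Space d)) continuous_inner hu').comp continuous_neg
  refine ae_eq_of_integral_contDiff_smul_eq hc.locallyIntegrable hu.locallyIntegrable
    fun χ h1 h2 => ?_
  have hφ := isTestC_ofReal ⟨h1, h2⟩
  -- Both transforms are moved onto the test function, where inversion is known. Continuity of `u`
  -- is not assumed, so the conclusion can only hold almost everywhere.
  have e1 := isInvFT_of_integrable hu' _ hφ
  rw [integral_fourier_mul_eq hu hφ.integrable_fourierInv, hφ.fourier_fourierInv] at e1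
  simpa only [Complex.real_smul, mul_comm] using e1

/-- The transform given by the integral and the Plancherel transform pair equally with test
functions, so they agree almost everywhere. -/
theorem memLp_fourier {u : Space d → ℂ} (hu : Integrable u) (hu2 : MemLp u 2) :
    MemLp (𝓕 u) 2 := by
  have hc : Continuous (𝓕 u) := VectorFourier.fourierIntegral_continuous Real.continuous_fourierChar
      (L := innerₗ (Space d)) continuous_inner hu
  let U : Lp (α := Space d) ℂ 2 volume := 𝓕 (hu2.toLp u)
  have key : 𝓕 u =ᵐ[volume] (U : Space d → ℂ) := by
    refine ae_eq_of_integral_contDiff_smul_eq hc.locallyIntegrable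
      (memLp_two_locallyIntegrable (Lp.memLp U)) fun χ h1 h2 => ?_
    have hφ := isTestC_ofReal ⟨h1, h2⟩
    obtain ⟨Φ, hΦ⟩ := hφ.exists_schwartz
    have h := Lp.fourier_toTemperedDistribution_eq (hu2.toLp u)
    have h2 := congrArg (fun T : 𝓢'(Space d, ℂ) => T Φ) h
    simp only [TemperedDistribution.fourier_apply, Lp.toTemperedDistribution_apply,
      smul_eq_mul, SchwartzMap.fourier_coe] at h2
    have h3 := integral_fourier_mul_eq hu Φ.integrable
    have h4 : ∫ x, 𝓕 (Φ : Space d → ℂ) x * (hu2.toLp u) x = ∫ x, u x * 𝓕 (Φ : Space d → ℂ) x :=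
      integral_congr_ae (hu2.coeFn_toLp.mono fun x hx => by simp only [hx, mul_comm])
    rw [h4, ← h3] at h2
    simp only [Complex.real_smul]
    simp only [hΦ] at h2
    rw [← h2]
    simp only [mul_comm]
  exact (memLp_congr_ae key).2 (Lp.memLp U)

/-! ### Spectral densities and superpositions of plane waves. -/

/-- `W` is measurable and `(1 + |ξ|)^s W ∈ L²`. -/
def Dec (s : ℕ) (W : Space d → ℂ) : Prop :=
  Measurable W ∧ MemLp (fun ξ => (1 + ‖ξ‖) ^ s * ‖W ξ‖) 2 (volume : Measure (Space d))

/-- Hermitian symmetry, the Fourier side of being real valued. -/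
def Herm (W : Space d → ℂ) : Prop := ∀ ξ, W (-ξ) = (starRingEnd ℂ) (W ξ)

/-- The Fourier multiplier `2πi ξ_j` of `∂_j`. -/
def dW (j : Fin d) (W : Space d → ℂ) (ξ : Space d) : ℂ := 2 * Real.pi * Complex.I * ξ j * W ξ

/-- The real plane wave `Re (W(ξ) e^{2πi⟨ξ,x⟩})`. -/
def trig (W : Space d → ℂ) (x ξ : Space d) : ℝ :=
  (Complex.exp (((2 * Real.pi * inner ℝ ξ x : ℝ) : ℂ) * Complex.I) * W ξ).re

/-- The superposition of the plane waves `trig W`. -/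
def pot (W : Space d → ℂ) (x : Space d) : ℝ := ∫ ξ, trig W x ξ

theorem abs_trig_le (W : Space d → ℂ) (x ξ : Space d) : |trig W x ξ| ≤ ‖W ξ‖ := by
  refine (Complex.abs_re_le_norm _).trans ?_
  rw [norm_mul, Complex.norm_exp_ofReal_mul_I, one_mul]

theorem measurable_trig {W : Space d → ℂ} (hW : Measurable W) :
    Measurable (fun q : Space d × Space d => trig W q.1 q.2) := by
  unfold trig
  fun_prop

theorem continuous_trig (W : Space d → ℂ) (ξ : Space d) : Continuous (fun x => trig W x ξ) := by
  unfold trig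
  fun_prop

theorem contDiff_trig (W : Space d → ℂ) (ξ : Space d) : ContDiff ℝ ∞ (fun x => trig W x ξ) := by
  have h1 : ContDiff ℝ ∞ (fun x : Space d => (2 * Real.pi * inner ℝ ξ x : ℝ)) :=
    contDiff_const.mul (contDiff_const.inner ℝ contDiff_id)
  have h2 : ContDiff ℝ ∞ (fun x : Space d =>
      Complex.exp (((2 * Real.pi * inner ℝ ξ x : ℝ) : ℂ) * Complex.I) * W ξ) :=
    (((Complex.ofRealCLM.contDiff.comp h1).mul contDiff_const).cexp).mul contDiff_const
  exact Complex.reCLM.contDiff.comp h2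

theorem partialD_trig (W : Space d → ℂ) (ξ x : Space d) (j : Fin d) :
    partialD j (fun x => trig W x ξ) x = trig (dW j W) x ξ := by
  have hL : HasFDerivAt (fun x : Space d => (2 * Real.pi * inner ℝ ξ x : ℝ))
      ((2 * Real.pi) • innerSL ℝ ξ) x := by
    simpa using ((innerSL ℝ ξ).hasFDerivAt (x := x)).const_mul (2 * Real.pi)
  have h2 := (((Complex.ofRealCLM.hasFDerivAt.comp x hL).mul_const Complex.I).cexp).mul_const (W ξ)
  have h3 := Complex.reCLM.hasFDerivAt.comp x h2
  have h4 : HasFDerivAt (fun x => trig W x ξ) _ x := h3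
  rw [partialD, h4.fderiv]
  simp only [trig, dW, ContinuousLinearMap.comp_apply, smul_apply,
    Complex.ofRealCLM_apply, Complex.reCLM_apply, innerSL_apply_apply, smul_eq_mul,
    EuclideanSpace.inner_single_right, Function.comp_apply]
  congr 1
  push_cast
  simp
  ring

theorem integrable_trig {W : Space d → ℂ} (hW : Integrable W) (hm : Measurable W) (x : Space d) :
    Integrable (trig W x) :=
  hW.norm.mono' ((measurable_trig hm).comp (measurable_const.prodMk measurable_id)).aestronglyMeasurable
    (Eventually.of_forall fun ξ => by simpa using abs_trig_le W x ξ)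

theorem abs_pot_le {W : Space d → ℂ} (hW : Integrable W) (x : Space d) :
    |pot W x| ≤ ∫ ξ, ‖W ξ‖ :=
  norm_integral_le_of_norm_le (f := trig W x) hW.norm
    (Eventually.of_forall fun ξ => by simpa using abs_trig_le W x ξ)

theorem continuous_pot {W : Space d → ℂ} (hW : Integrable W) (hm : Measurable W) :
    Continuous (pot W) := by
  refine continuous_of_dominated (bound := fun ξ => ‖W ξ‖)
    (fun x => (integrable_trig hW hm x).aestronglyMeasurable)
    (fun x => Eventually.of_forall fun ξ => by simpa using abs_trig_le W x ξ) hW.norm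
    (Eventually.of_forall fun ξ => continuous_trig W ξ)

theorem pot_eq_re {W : Space d → ℂ} (hW : Integrable W) (x : Space d) :
    pot W x = (𝓕⁻ W x).re := by
  rw [Real.fourierInv_eq', pot]
  have : Integrable (fun v : Space d =>
      Complex.exp (((2 * Real.pi * inner ℝ v x : ℝ) : ℂ) * Complex.I) • W v) := by
    have hc : Continuous (fun v : Space d =>
      Complex.exp (((2 * Real.pi * inner ℝ v x : ℝ) : ℂ) * Complex.I)) := by fun_prop
    refine hW.norm.mono' (hc.aestronglyMeasurable.smul hW.aestronglyMeasurable)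
      (Eventually.of_forall fun ξ => ?_)
    rw [norm_smul, Complex.norm_exp_ofReal_mul_I, one_mul]
  exact integral_re this

theorem Herm.dW {W : Space d → ℂ} (h : Herm W) (j : Fin d) : Herm (dW j W) := by
  intro ξ
  simp [HighField.dW, h ξ, map_ofNat (starRingEnd ℂ)]

/-- Under `ξ ↦ -ξ` the wave `W(ξ)e^{2πi⟨ξ,x⟩}` turns into its conjugate; the factor `i` turns this
evenness of the real part into oddness. This is the source of the skew symmetry of `Θ`. -/
theorem Herm.trig_I_neg {W : Space d → ℂ} (h : Herm W) (x ξ : Space d) :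
    trig (fun ξ => Complex.I * W ξ) x (-ξ) = -trig (fun ξ => Complex.I * W ξ) x ξ := by
  unfold trig
  simp only [h ξ]
  rw [← Complex.conj_re]
  simp [← Complex.exp_conj, map_ofNat (starRingEnd ℂ)]

theorem Dec.mono {s t : ℕ} (hst : s ≤ t) {W : Space d → ℂ} (h : Dec t W) : Dec s W := by
  refine ⟨h.1, h.2.mono ?_ (Eventually.of_forall fun ξ => ?_)⟩
  · have := h.1
    exact Measurable.aestronglyMeasurable (by fun_prop)
  · rw [Real.norm_of_nonneg (by positivity), Real.norm_of_nonneg (by positivity)]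
    gcongr
    simp

theorem abs_coord_le (ξ : Space d) (j : Fin d) : |ξ j| ≤ ‖ξ‖ := by
  simpa using PiLp.norm_apply_le ξ j

theorem norm_dW_le (W : Space d → ℂ) (j : Fin d) (ξ : Space d) :
    ‖dW j W ξ‖ ≤ 2 * Real.pi * ‖ξ‖ * ‖W ξ‖ := by
  have := abs_coord_le ξ j
  simp only [dW, norm_mul, Complex.norm_I, Complex.norm_real, Real.norm_eq_abs,
    abs_of_pos Real.pi_pos, mul_one, RCLike.norm_ofNat]
  have := Real.pi_pos
  gcongr

theorem measurable_dW {W : Space d → ℂ} (h : Measurable W) (j : Fin d) : Measurable (dW j W) := by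
  have : Measurable (fun ξ : Space d => ξ j) := by fun_prop
  unfold dW
  fun_prop

theorem Dec.dW {s : ℕ} {W : Space d → ℂ} (h : Dec (s + 1) W) (j : Fin d) :
    Dec s (HighField.dW j W) := by
  have hm := measurable_dW h.1 j
  refine ⟨hm, h.2.of_le_mul (c := 2 * Real.pi) ?_ (Eventually.of_forall fun ξ => ?_)⟩
  · exact Measurable.aestronglyMeasurable (by fun_prop)
  · rw [Real.norm_of_nonneg (by positivity), Real.norm_of_nonneg (by positivity)]
    have := norm_dW_le W j ξ
    have h0 := Real.pi_pos
    calc (1 + ‖ξ‖) ^ s * ‖HighField.dW j W ξ‖ ≤ (1 + ‖ξ‖) ^ s * (2 * Real.pi * (1 + ‖ξ‖) * ‖W ξ‖) := by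
          gcongr
          refine this.trans ?_
          gcongr
          linarith
      _ = _ := by ring

/-- The hypothesis `2k > d` enters here. It serves both for integrability of spectral densities and
for velocity integrals of weighted functions. -/
theorem memLp_one_add_norm_pow_inv {k : ℕ} (hk : d < 2 * k) :
    MemLp (fun ξ : Space d => ((1 + ‖ξ‖) ^ k)⁻¹) 2 := by
  have h := integrable_one_add_norm (E := Space d) (μ := volume) (r := 2 * k)
    (by simpa using by exact_mod_cast hk)
  rw [memLp_two_iff_integrable_sq (Measurable.aestronglyMeasurable (by fun_prop))]
  refine h.congr (Eventually.of_forall fun ξ => ?_)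
  simp only
  rw [Real.rpow_neg (by positivity), inv_pow, ← pow_mul, mul_comm k 2]
  norm_cast

/-- Cauchy-Schwarz: `k` of the `k + i` weights pay for integrability and the other `i` remain. -/
theorem Dec.integrable_pow {k i : ℕ} (hk : d < 2 * k) {W : Space d → ℂ} (h : Dec (k + i) W) :
    Integrable (fun ξ => (1 + ‖ξ‖) ^ i * ‖W ξ‖) := by
  have := (memLp_one_add_norm_pow_inv hk).integrable_mul h.2
  refine this.congr (Eventually.of_forall fun ξ => ?_)
  have : (1 + ‖ξ‖) ^ k ≠ 0 := by positivity
  simp only [Pi.mul_apply]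
  field_simp
  ring

theorem Dec.integrable {k : ℕ} (hk : d < 2 * k) {W : Space d → ℂ} (h : Dec k W) :
    Integrable W := by
  have := Dec.integrable_pow (i := 0) hk h
  simp only [pow_zero, one_mul] at this
  exact (integrable_norm_iff h.1.aestronglyMeasurable).1 this

/-! ### Sobolev functions and their Hermitian spectral densities. -/

theorem IsInvFT.conj_neg {f : Space d → ℝ} {G : Space d → ℂ}
    (h : IsInvFT (fun x => (f x : ℂ)) G) :
    IsInvFT (fun x => (f x : ℂ)) (fun ξ => (starRingEnd ℂ) (G (-ξ))) := by
  intro φ hφ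
  have hc : IsTestC (fun x => (starRingEnd ℂ) (φ x)) :=
    ⟨Complex.conjCLE.contDiff.comp hφ.1, hφ.2.comp_left (g := starRingEnd ℂ) (map_zero _)⟩
  have h1 := congrArg (starRingEnd ℂ) (h _ hc)
  rw [← integral_conj, ← integral_conj] at h1
  simp only [map_mul, Complex.conj_ofReal, Complex.conj_conj] at h1
  rw [h1, ← integral_neg_eq_self]
  congr 1; ext ξ
  congr 1
  rw [Real.fourierInv_eq', Real.fourierInv_eq', ← integral_conj]
  congr 1; ext v
  simp [← Complex.exp_conj, map_ofNat (starRingEnd ℂ)]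

/-- The Bessel weight times the L² Fourier transform agrees, as a tempered distribution, with an L²
function, hence almost everywhere. The weight `(1 + |ξ|²)^(s/2)` is then compared with `(1 +
|ξ|)^s`. -/
theorem MemH.exists_isInvFT_measurable {s : ℕ} {f : Space d → ℝ} (h : MemH s f) :
    MemLp f 2 ∧ ∃ W : Space d → ℂ, Dec s W ∧ IsInvFT (fun x => (f x : ℂ)) W := by
  obtain ⟨hf, hS⟩ := h
  have hf2 : MemLp f 2 := by simpa using hf.re
  refine ⟨hf2, ?_⟩
  obtain ⟨f', hf'⟩ := TemperedDistribution.memSobolev_iff_exists_smulLeftCLM_fourier.1 hS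
  rw [Lp.fourier_toTemperedDistribution_eq] at hf'
  set G : Lp (α := Space d) ℂ 2 volume := 𝓕 (hf.toLp _) with hG
  have hinv : IsInvFT (fun x => (f x : ℂ)) G := by
    refine (isInvFT_Lp G).congr ?_ (ae_eq_refl _)
    rw [hG, FourierTransform.fourierInv_fourier_eq]
    exact hf.coeFn_toLp
  have hGm : Measurable (G : Space d → ℂ) := (Lp.stronglyMeasurable G).measurable
  have hw : (fun ξ => (((1 + ‖ξ‖ ^ 2) ^ ((s : ℝ) / 2) : ℝ) : ℂ) * G ξ) =ᵐ[volume] f' := by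
    have hcont : Continuous (fun ξ : Space d => (((1 + ‖ξ‖ ^ 2) ^ ((s : ℝ) / 2) : ℝ) : ℂ)) := by
      have h0 : ∀ ξ : Space d, 1 + ‖ξ‖ ^ 2 ≠ 0 := fun ξ => by positivity
      exact Complex.continuous_ofReal.comp
        (Continuous.rpow_const (by fun_prop) fun ξ => Or.inl (h0 ξ))
    have hloc : LocallyIntegrable (fun ξ => (((1 + ‖ξ‖ ^ 2) ^ ((s : ℝ) / 2) : ℝ) : ℂ) * G ξ) := by
      have := (memLp_two_locallyIntegrable (Lp.memLp G)).continuous_smul hcont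
      exact this
    refine ae_eq_of_integral_contDiff_smul_eq hloc
      (memLp_two_locallyIntegrable (Lp.memLp f')) fun χ h1 h2 => ?_
    obtain ⟨Φ, hΦ⟩ := (isTestC_ofReal ⟨h1, h2⟩).exists_schwartz
    have h3 := congrArg (fun T : 𝓢'(Space d, ℂ) => T Φ) hf'
    simp only [TemperedDistribution.smulLeftCLM_apply_apply, Lp.toTemperedDistribution_apply] at h3
    rw [SchwartzMap.smulLeftCLM_apply (by fun_prop)] at h3
    simp only [hΦ, smul_eq_mul] at h3
    simp only [Complex.real_smul]
    rw [← h3]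
    congr 1; ext ξ; ring
  have hDec : MemLp (fun ξ => (1 + ‖ξ‖) ^ s * ‖G ξ‖) 2 := by
    -- The constant comes from `(1 + t)² ≤ 2(1 + t²)`.
    refine (Lp.memLp f').of_le_mul (c := (2 : ℝ) ^ ((s : ℝ) / 2))
      (Measurable.aestronglyMeasurable (by fun_prop)) ?_
    filter_upwards [hw] with ξ hξ
    rw [← hξ, Real.norm_of_nonneg (by positivity), norm_mul, Complex.norm_real,
      Real.norm_of_nonneg (by positivity), ← mul_assoc, ← Real.mul_rpow (by norm_num) (by positivity)]
    gcongr
    calc (1 + ‖ξ‖) ^ s = ((1 + ‖ξ‖) ^ 2) ^ ((s : ℝ) / 2) := by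
          rw [← Real.rpow_natCast, ← Real.rpow_natCast, ← Real.rpow_mul (by positivity)]
          congr 1; push_cast; ring
      _ ≤ _ := by
          gcongr
          nlinarith [sq_nonneg (1 - ‖ξ‖)]
  exact ⟨G, ⟨hGm, hDec⟩, hinv⟩

/-- For real `f` the reflected conjugate of a spectral density is again one. The average of the two
is Hermitian at every point, not only almost everywhere, as `Herm` demands. -/
theorem MemH.exists_isInvFT {s : ℕ} {f : Space d → ℝ} (h : MemH s f) :
    MemLp f 2 ∧ ∃ W : Space d → ℂ, Dec s W ∧ Herm W ∧ IsInvFT (fun x => (f x : ℂ)) W := by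
  obtain ⟨hf2, G, ⟨hGm, hDec⟩, hinv⟩ := h.exists_isInvFT_measurable
  refine ⟨hf2, ?_⟩
  have hG2 : MemLp G 2 := by
    have := (Dec.mono (Nat.zero_le s) ⟨hGm, hDec⟩).2
    simp only [pow_zero, one_mul] at this
    exact (memLp_norm_iff hGm.aestronglyMeasurable).1 this
  refine ⟨fun ξ => (G ξ + (starRingEnd ℂ) (G (-ξ))) / 2, ⟨by fun_prop, ?_⟩, ?_, ?_⟩
  · have hD2 : MemLp (fun ξ => (1 + ‖ξ‖) ^ s * ‖G (-ξ)‖) 2 := by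
      have := hDec.comp_measurePreserving (Measure.measurePreserving_neg (volume : Measure (Space d)))
      simpa [Function.comp_def] using this
    refine (hDec.add hD2).mono (Measurable.aestronglyMeasurable (by fun_prop))
      (Eventually.of_forall fun ξ => ?_)
    simp only [Pi.add_apply]
    rw [Real.norm_of_nonneg (by positivity), Real.norm_of_nonneg (by positivity), ← mul_add]
    gcongr
    rw [norm_div]
    have := norm_add_le (G ξ) ((starRingEnd ℂ) (G (-ξ)))
    rw [RCLike.norm_conj] at this
    have h1 : ‖(2 : ℂ)‖ = 2 := by simp
    rw [h1]
    have := norm_nonneg (G ξ)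
    have := norm_nonneg (G (-ξ))
    linarith
  · intro ξ
    simp only [neg_neg, map_div₀, map_add, Complex.conj_conj, map_ofNat]
    rw [add_comm]
  · intro φ hφ
    have e1 := hinv φ hφ
    have e2 := hinv.conj_neg φ hφ
    have i1 : Integrable (fun x => G x * 𝓕⁻ φ x) := hG2.integrable_mul hφ.memLp_fourierInv
    have i2 : Integrable (fun x => (starRingEnd ℂ) (G (-x)) * 𝓕⁻ φ x) := by
      have hn : MemLp (fun x => (starRingEnd ℂ) (G (-x))) 2 := by
        have := hG2.comp_measurePreserving
          (Measure.measurePreserving_neg (volume : Measure (Space d)))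
        exact this.star
      exact hn.integrable_mul hφ.memLp_fourierInv
    have : (fun x => (G x + (starRingEnd ℂ) (G (-x))) / 2 * 𝓕⁻ φ x)
        = fun x => (1 / 2 : ℂ) * (G x * 𝓕⁻ φ x + (starRingEnd ℂ) (G (-x)) * 𝓕⁻ φ x) := by
      ext x; ring
    rw [this, integral_const_mul, integral_add i1 i2, ← e1, ← e2]
    ring

theorem IsInvFT.ae_eq_pot {f : Space d → ℝ} {W : Space d → ℂ} (hf : LocallyIntegrable f)
    (h : IsInvFT (fun x => (f x : ℂ)) W) (hW : Integrable W) : f =ᵐ[volume] pot W := by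
  have hc : Continuous (𝓕⁻ W) := by
    have : 𝓕⁻ W = fun v => 𝓕 W (-v) := by
      ext v; rw [Real.fourierInv_eq_fourier_neg]
    rw [this]
    exact (VectorFourier.fourierIntegral_continuous Real.continuous_fourierChar
      (L := innerₗ (Space d)) continuous_inner hW).comp continuous_neg
  have hf' : LocallyIntegrable (fun x => (f x : ℂ)) := fun x => by
    obtain ⟨s, hs, h⟩ := hf x
    exact ⟨s, hs, h.ofReal⟩
  filter_upwards [h.unique (isInvFT_of_integrable hW) hf' hc.locallyIntegrable] with x hx
  rw [pot_eq_re hW, ← hx, Complex.ofReal_re]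

/-! ### Weak derivatives from the Fourier side. -/

theorem IsTestC.fourierInv_fderiv {φ : Space d → ℂ} (h : IsTestC φ) (j : Fin d) (ξ : Space d) :
    𝓕⁻ (fun x => fderiv ℝ φ x (EuclideanSpace.single j 1)) ξ
      = -(2 * Real.pi * Complex.I * ξ j * 𝓕⁻ φ ξ) := by
  obtain ⟨Φ, rfl⟩ := h.exists_schwartz
  have h1 := congrArg (fun Ψ : 𝓢(Space d, ℂ) => Ψ ξ)
    (SchwartzMap.fourierInv_lineDerivOp_eq Φ (EuclideanSpace.single j (1 : ℝ)))
  have h2 : (fun x => fderiv ℝ Φ x (EuclideanSpace.single j 1))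
      = ((∂_{EuclideanSpace.single j (1 : ℝ)} Φ : 𝓢(Space d, ℂ)) : Space d → ℂ) := by
    ext x; rw [SchwartzMap.lineDerivOp_apply_eq_fderiv]
  rw [h2, ← SchwartzMap.fourierInv_coe, ← SchwartzMap.fourierInv_coe]
  rw [h1]
  simp only [neg_smul, neg_apply, smul_apply, smul_eq_mul]
  rw [SchwartzMap.smulLeftCLM_apply_apply (by fun_prop)]
  simp [mul_assoc, EuclideanSpace.inner_single_right]

/-- A function whose Fourier transform decays has an `L²` weak derivative. -/
theorem IsInvFT.exists_weakDeriv {f : Space d → ℝ} {G : Space d → ℂ} (hf : MemLp f 2)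
    (h : IsInvFT (fun x => (f x : ℂ)) G) (j : Fin d) (hG : MemLp (dW j G) 2) :
    ∃ g : Space d → ℝ, MemLp g 2 ∧ IsWeakDeriv j f g := by
  obtain ⟨g, hg, hgG⟩ := exists_isInvFT_left hG
  -- The inverse transform `g` of `2πiξ_j G` is not known to be real. Since `f` and `χ` are real,
  -- taking real parts in the pairing suffices.
  refine ⟨fun x => (g x).re, hg.re, memLp_two_locallyIntegrable hf,
    memLp_two_locallyIntegrable hg.re, fun χ hχ => ?_⟩
  have hφ := isTestC_ofReal hχ
  have hd : ∀ x, fderiv ℝ (fun x => (χ x : ℂ)) x (EuclideanSpace.single j 1)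
      = ((partialD j χ x : ℝ) : ℂ) := fun x => by
    have h1 : HasFDerivAt χ (fderiv ℝ χ x) x :=
      (hχ.1.differentiable (by simp)).differentiableAt.hasFDerivAt
    have h2 : HasFDerivAt (fun x => (χ x : ℂ)) (Complex.ofRealCLM.comp (fderiv ℝ χ x)) x :=
      Complex.ofRealCLM.hasFDerivAt.comp x h1
    rw [h2.fderiv, partialD]
    rfl
  have hφ' : IsTestC (fun x => fderiv ℝ (fun x => (χ x : ℂ)) x (EuclideanSpace.single j 1)) := by
    refine ⟨?_, ?_⟩
    · exact (hφ.1.fderiv_right (m := ∞) (by simp)).clm_apply contDiff_const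
    · exact hφ.2.fderiv_apply (𝕜 := ℝ) _
  have e1 := h _ hφ'
  have e2 := hgG _ hφ
  have e3 : ∫ x, (f x : ℂ) * ((partialD j χ x : ℝ) : ℂ) = -∫ x, g x * (χ x : ℂ) := by
    simp only [hd] at e1
    rw [e1, e2, ← integral_neg]
    congr 1; ext ξ
    simp only [← hd, hφ.fourierInv_fderiv]
    simp only [dW]; ring
  have e4 := congrArg Complex.re e3
  have hχ2 : MemLp (fun x => (χ x : ℂ)) 2 := hφ.1.continuous.memLp_of_hasCompactSupport hφ.2
  have i1 : Integrable (fun x => g x * (χ x : ℂ)) := hg.integrable_mul hχ2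
  rw [Complex.neg_re] at e4
  have e5 : (∫ x, g x * (χ x : ℂ)).re = ∫ x, (g x).re * χ x := by
    have := (integral_re i1).symm
    simpa using this
  have e6 : (∫ x, (f x : ℂ) * ((partialD j χ x : ℝ) : ℂ)).re = ∫ x, f x * partialD j χ x := by
    rw [← Complex.ofReal_re (∫ x, f x * partialD j χ x), ← integral_complex_ofReal]
    push_cast; rfl
  rw [← e6, e4, e5]

theorem Dec.memLp {s : ℕ} {W : Space d → ℂ} (h : Dec s W) : MemLp W 2 := by
  have := (h.mono (Nat.zero_le s)).2
  simp only [pow_zero, one_mul] at this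
  exact (memLp_norm_iff h.1.aestronglyMeasurable).1 this

theorem MemH.exists_weakDeriv {f : Space d → ℝ} (h : MemH 1 f) (j : Fin d) :
    ∃ g : Space d → ℝ, MemLp g 2 ∧ IsWeakDeriv j f g := by
  obtain ⟨hf, W, hW, -, hI⟩ := h.exists_isInvFT
  exact hI.exists_weakDeriv hf j (Dec.memLp (s := 0) (hW.dW j))

/-! ### Integration by parts against plane waves -/

theorem IsTest.mul_trig {χ : Space d → ℝ} (h : IsTest χ) (W : Space d → ℂ) (ξ : Space d) :
    IsTest (fun x => χ x * trig W x ξ) :=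
  ⟨h.1.mul (contDiff_trig W ξ), h.2.mul_right⟩

theorem IsTest.partialD {χ : Space d → ℝ} (h : IsTest χ) (j : Fin d) : IsTest (partialD j χ) :=
  ⟨(h.1.fderiv_right (m := ∞) (by simp)).clm_apply contDiff_const, h.2.fderiv_apply (𝕜 := ℝ) _⟩

theorem IsTest.differentiable {X : Type*} [NormedAddCommGroup X] [NormedSpace ℝ X] {χ : X → ℝ}
    (h : IsTest χ) : Differentiable ℝ χ := h.1.differentiable (by simp)

theorem IsTest.continuous {X : Type*} [NormedAddCommGroup X] [NormedSpace ℝ X] {χ : X → ℝ}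
    (h : IsTest χ) : Continuous χ := h.1.continuous

theorem partialD_mul_trig {χ : Space d → ℝ} (h : IsTest χ) (W : Space d → ℂ) (ξ x : Space d)
    (j : Fin d) : HighField.partialD j (fun x => χ x * trig W x ξ) x
      = HighField.partialD j χ x * trig W x ξ + χ x * trig (dW j W) x ξ := by
  have h2 : DifferentiableAt ℝ (fun x => trig W x ξ) x :=
    ((contDiff_trig W ξ).differentiable (by simp)).differentiableAt
  rw [← partialD_trig]
  simp only [HighField.partialD]
  rw [fderiv_fun_mul h.differentiable.differentiableAt h2]
  simp [mul_comm]
  ring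

theorem integrable_prod_trig {f : Space d → ℝ} (hf : Integrable f) {W : Space d → ℂ}
    (hW : Integrable W) (hm : Measurable W) :
    Integrable (fun q : Space d × Space d => f q.1 * trig W q.1 q.2) := by
  refine (hf.norm.mul_prod hW.norm).mono' ?_ (Eventually.of_forall fun q => ?_)
  · exact hf.aestronglyMeasurable.comp_fst.mul (measurable_trig hm).aestronglyMeasurable
  · rw [norm_mul]
    gcongr
    exact abs_trig_le W q.1 q.2

theorem integral_mul_pot {f : Space d → ℝ} (hf : Integrable f) {W : Space d → ℂ}
    (hW : Integrable W) (hm : Measurable W) :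
    Integrable (fun ξ => ∫ x, f x * trig W x ξ) ∧
    ∫ x, f x * pot W x = ∫ ξ, ∫ x, f x * trig W x ξ := by
  have := integrable_prod_trig hf hW hm
  refine ⟨this.integral_prod_right, ?_⟩
  rw [integral_integral_swap (f := fun ξ x => f x * trig W x ξ) this.swap]
  simp only [integral_const_mul, pot]

theorem LocallyIntegrable.mul_test {f χ : Space d → ℝ} (hf : LocallyIntegrable f)
    (hχ : IsTest χ) : Integrable (fun x => f x * χ x) := by
  have := hf.integrable_smul_right_of_hasCompactSupport hχ.continuous hχ.2
  simpa [mul_comm] using this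

/-- If `a = -∑ ∂_l b_l` weakly, then this may be tested with `χ · pot W`. -/
theorem weak_div_mul_pot {a : Space d → ℝ} {b : Fin d → Space d → ℝ} (ha : LocallyIntegrable a)
    (hb : ∀ l, LocallyIntegrable (b l))
    (hab : ∀ χ : Space d → ℝ, IsTest χ → ∫ x, a x * χ x = ∑ l, ∫ x, b l x * partialD l χ x)
    {W : Space d → ℂ} (hW : Integrable W) (hm : Measurable W)
    (hdW : ∀ l, Integrable (dW l W)) {χ : Space d → ℝ} (hχ : IsTest χ) :
    ∫ x, a x * χ x * pot W x = ∑ l, ∫ x, b l x *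
      (partialD l χ x * pot W x + χ x * pot (dW l W) x) := by
  have i1 := fun l => LocallyIntegrable.mul_test (hb l) (hχ.partialD l)
  have i2 := fun l => LocallyIntegrable.mul_test (hb l) hχ
  have hl : ∀ l, ∫ x, b l x * (partialD l χ x * pot W x + χ x * pot (dW l W) x)
      = ∫ ξ, ((∫ x, b l x * partialD l χ x * trig W x ξ)
        + ∫ x, b l x * χ x * trig (dW l W) x ξ) := fun l => by
    obtain ⟨j1, k1⟩ := integral_mul_pot (i1 l) hW hm
    obtain ⟨j2, k2⟩ := integral_mul_pot (i2 l) (hdW l) (measurable_dW hm l)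
    rw [integral_add j1 j2, ← k1, ← k2, ← integral_add]
    · congr 1; ext x; ring
    · exact (i1 l).mul_bdd (c := ∫ ξ, ‖W ξ‖) (continuous_pot hW hm).aestronglyMeasurable
        (Eventually.of_forall fun x => abs_pot_le hW x)
    · exact (i2 l).mul_bdd (c := ∫ ξ, ‖dW l W ξ‖)
        (continuous_pot (hdW l) (measurable_dW hm l)).aestronglyMeasurable
        (Eventually.of_forall fun x => abs_pot_le (hdW l) x)
  rw [(integral_mul_pot (LocallyIntegrable.mul_test ha hχ) hW hm).2, Finset.sum_congr rfl fun l _ => hl l,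
    ← integral_finsetSum]
  · congr 1; ext ξ
    -- `χ · pot W` need not be smooth, but `χ` times a single plane wave is a test function. The
    -- identity is applied for each frequency and then integrated in `ξ`.
    have := hab _ (hχ.mul_trig W ξ)
    simp only [partialD_mul_trig hχ] at this
    simp only [mul_assoc]
    rw [this]
    refine Finset.sum_congr rfl fun l _ => ?_
    rw [← integral_add]
    · congr 1; ext x; ring
    · refine ((i1 l).mul_bdd (c := ‖W ξ‖) (continuous_trig W ξ).aestronglyMeasurable
        (Eventually.of_forall fun x => abs_trig_le W x ξ)).congr (Eventually.of_forall fun x => ?_)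
      simp only; ring
    · refine ((i2 l).mul_bdd (c := ‖dW l W ξ‖) (continuous_trig (dW l W) ξ).aestronglyMeasurable
        (Eventually.of_forall fun x => abs_trig_le _ x ξ)).congr (Eventually.of_forall fun x => ?_)
      simp only; ring
  · intro l _
    exact (integral_mul_pot (i1 l) hW hm).1.add
      (integral_mul_pot (i2 l) (hdW l) (measurable_dW hm l)).1

theorem integral_partialD_eq_zero {χ : Space d → ℝ} (h : IsTest χ) (j : Fin d) :
    ∫ x, partialD j χ x = 0 := by
  have hi := h.continuous.integrable_of_hasCompactSupport (μ := volume) h.2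
  have hi' := (h.partialD j).continuous.integrable_of_hasCompactSupport (μ := volume) (h.partialD j).2
  have := integral_mul_fderiv_eq_neg_fderiv_mul_of_integrable (μ := (volume : Measure (Space d)))
    (f := fun _ => (1 : ℝ)) (g := χ) (v := EuclideanSpace.single j 1) (by simp)
    (by simpa [partialD] using! hi') (by simpa using hi) (by simp) (fun x _ => h.differentiable x)
  simpa [partialD] using this

theorem isWeakDeriv_pot {W : Space d → ℂ} (hW : Integrable W) (hm : Measurable W)
    (hdW : ∀ l, Integrable (dW l W)) (j : Fin d) : IsWeakDeriv j (pot W) (pot (dW j W)) := by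
  refine ⟨(continuous_pot hW hm).locallyIntegrable,
    (continuous_pot (hdW j) (measurable_dW hm j)).locallyIntegrable, fun χ hχ => ?_⟩
  -- The constant field `e_j` has zero divergence, so testing it with `χ · pot W` is the integration
  -- by parts that is wanted.
  have := weak_div_mul_pot (a := 0) (b := fun l _ => if l = j then 1 else 0)
    (locallyIntegrable_zero) (fun l => locallyIntegrable_const _)
    (fun χ hχ => by
      simp only [Pi.zero_apply, zero_mul, integral_zero, integral_const_mul,
        integral_partialD_eq_zero hχ, mul_zero, Finset.sum_const_zero]) hW hm hdW hχ
  rw [Finset.sum_eq_single j (fun l _ hl => by simp [hl]) (by simp)] at this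
  simp only [Pi.zero_apply, zero_mul, integral_zero, one_mul, if_true] at this
  rw [integral_add] at this
  · have e1 : ∫ x, pot W x * partialD j χ x = ∫ x, partialD j χ x * pot W x := by
      simp only [mul_comm]
    have e2 : ∫ x, pot (dW j W) x * χ x = ∫ x, χ x * pot (dW j W) x := by
      simp only [mul_comm]
    rw [e1, e2]; linarith
  · simpa [mul_comm] using LocallyIntegrable.mul_test (continuous_pot hW hm).locallyIntegrable (hχ.partialD j)
  · simpa [mul_comm] using LocallyIntegrable.mul_test
      (continuous_pot (hdW j) (measurable_dW hm j)).locallyIntegrable hχ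

theorem IsWeakDeriv.unique {j : Fin d} {f f' g g' : Space d → ℝ} (h : IsWeakDeriv j f g)
    (h' : IsWeakDeriv j f' g') (hf : f =ᵐ[volume] f') : g =ᵐ[volume] g' := by
  refine ae_eq_of_integral_contDiff_smul_eq h.2.1 h'.2.1 fun χ h1 h2 => ?_
  have e1 := h.2.2 χ ⟨h1, h2⟩
  have e2 := h'.2.2 χ ⟨h1, h2⟩
  have e3 : ∫ x, f x * partialD j χ x = ∫ x, f' x * partialD j χ x :=
    integral_congr_ae (hf.mono fun x hx => by simp only [hx])
  simp only [smul_eq_mul, mul_comm (χ _)]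
  linarith

theorem IsWeakDeriv.congr_left {j : Fin d} {f f' g : Space d → ℝ} (h : IsWeakDeriv j f g)
    (hf : f =ᵐ[volume] f') : IsWeakDeriv j f' g := by
  refine ⟨h.1.congr hf, h.2.1, fun χ hχ => ?_⟩
  rw [← h.2.2 χ hχ]
  exact integral_congr_ae (hf.mono fun x hx => by simp only [hx])

theorem weakDeriv_ae_eq {j : Fin d} {f g : Space d → ℝ} (h : IsWeakDeriv j f g) :
    weakDeriv j f =ᵐ[volume] g := by
  have hex : ∃ g, IsWeakDeriv j f g := ⟨g, h⟩
  rw [weakDeriv, dif_pos hex]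
  exact hex.choose_spec.unique h (ae_eq_refl _)

/-! ### Integral operators in velocity -/

theorem lintegral_mul_sq_le {X : Type*} [MeasurableSpace X] (μ : Measure X) {f g : X → ℝ≥0∞}
    (hf : AEMeasurable f μ) (hg : AEMeasurable g μ) :
    (∫⁻ x, f x * g x ∂μ) ^ 2 ≤ (∫⁻ x, f x ^ 2 ∂μ) * ∫⁻ x, g x ^ 2 ∂μ := by
  have h := ENNReal.lintegral_mul_le_Lp_mul_Lq μ Real.HolderConjugate.two_two hf hg
  have h2 := pow_le_pow_left₀ (zero_le) h 2
  refine h2.trans (le_of_eq ?_)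
  rw [mul_pow]
  congr 1 <;>
  · rw [← ENNReal.rpow_natCast, ← ENNReal.rpow_mul]
    norm_num

/-- Cauchy-Schwarz after splitting `h` as `h^(1/2) h^(1/2)`, as in the proof of Young's inequality.
-/
theorem lintegral_sq_mul_le {X : Type*} [MeasurableSpace X] (μ : Measure X) {k h u : X → ℝ≥0∞}
    (hk : AEMeasurable k μ) (hh : AEMeasurable h μ) (hu : AEMeasurable u μ) :
    (∫⁻ x, k x * (h x * u x) ∂μ) ^ 2 ≤ (∫⁻ x, h x ∂μ) * ∫⁻ x, h x * (k x * u x) ^ 2 ∂μ := by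
  have e : ∀ x, h x ^ (1 / 2 : ℝ) * h x ^ (1 / 2 : ℝ) = h x := fun x => by
    rw [← ENNReal.rpow_add_of_nonneg _ _ (by norm_num) (by norm_num)]
    norm_num
  have := lintegral_mul_sq_le μ (hh.pow_const (1 / 2 : ℝ))
    ((hh.pow_const (1 / 2 : ℝ)).mul (hk.mul hu))
  convert this using 2
  · congr 1; ext x
    simp only [Pi.mul_apply]
    rw [← mul_assoc (h x ^ _), e]; ring
  · congr 1; ext x
    rw [sq, e]
  · congr 1; ext x
    simp only [Pi.mul_apply]
    rw [mul_pow _ (k x * u x), sq (h x ^ _), e]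

theorem ae_comp_add_smul {a : ℝ} (ha : a ≠ 0) {P : Space d → Prop} (h : ∀ᵐ v, P v) (v : Space d) :
    ∀ᵐ ξ : Space d, P (v + a • ξ) := by
  have h1 : Measure.QuasiMeasurePreserving (fun ξ : Space d => a • ξ) volume volume := by
    refine ⟨by fun_prop, ?_⟩
    rw [Measure.map_addHaar_smul _ ha]
    exact Measure.smul_absolutelyContinuous
  have h2 : Measure.QuasiMeasurePreserving (fun ξ : Space d => v + ξ) volume volume :=
    (measurePreserving_add_left volume v).quasiMeasurePreserving
  exact (h2.comp h1).ae h

theorem lintegral_comp_add_smul {a : ℝ} (ha : a ≠ 0) {h : Space d → ℝ≥0∞} (hm : Measurable h)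
    (v : Space d) :
    ∫⁻ ξ, h (v + a • ξ) = ENNReal.ofReal |(a ^ d)⁻¹| * ∫⁻ ξ, h ξ := by
  have h1 : ∫⁻ ξ, h (v + a • ξ) = ∫⁻ ξ, h (v + ξ) ∂(Measure.map (fun ξ => a • ξ) volume) := by
    rw [lintegral_map (by fun_prop) (by fun_prop)]
  rw [h1, Measure.map_addHaar_smul _ ha, lintegral_smul_measure, finrank_euclideanSpace_fin,
    lintegral_add_left_eq_self (μ := volume) h v]
  rfl

/-- A Young type inequality. -/
theorem young {a : ℝ} (ha : a ≠ 0) {k1 k2 b u : Space d → ℝ≥0∞} (hk1 : Measurable k1)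
    (hk2 : Measurable k2) (hb : Measurable b) (hu : Measurable u) :
    ∫⁻ v, (∫⁻ ξ, (k1 ξ + k2 ξ * b (v + a • ξ)) * u (v + a • ξ)) ^ 2
      ≤ 4 * ((∫⁻ ξ, k1 ξ) ^ 2 + ENNReal.ofReal |(a ^ d)⁻¹| * ((∫⁻ ξ, k2 ξ ^ 2) * ∫⁻ v, b v ^ 2))
        * ∫⁻ v, u v ^ 2 := by
  have sq_le : ∀ A B : ℝ≥0∞, (A + B) ^ 2 ≤ 4 * A ^ 2 + 4 * B ^ 2 := fun A B => by
    rcases le_total A B with h | h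
    · calc (A + B) ^ 2 ≤ (B + B) ^ 2 := by gcongr
        _ = 4 * B ^ 2 := by ring
        _ ≤ _ := le_add_self
    · calc (A + B) ^ 2 ≤ (A + A) ^ 2 := by gcongr
        _ = 4 * A ^ 2 := by ring
        _ ≤ _ := le_self_add
  have trans : ∀ (k : Space d → ℝ≥0∞) (h : Space d → ℝ≥0∞), Measurable k → Measurable h →
      ∫⁻ v, ∫⁻ ξ, k ξ * h (v + a • ξ) = (∫⁻ ξ, k ξ) * ∫⁻ v, h v := fun k h hk hh => by
    rw [lintegral_lintegral_swap (by fun_prop)]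
    have : ∀ ξ, ∫⁻ v, k ξ * h (v + a • ξ) = k ξ * ∫⁻ v, h v := fun ξ => by
      rw [lintegral_const_mul _ (by fun_prop), lintegral_add_right_eq_self (μ := volume) h]
    simp only [this]
    rw [lintegral_mul_const _ hk]
  set A : Space d → ℝ≥0∞ := fun v => ∫⁻ ξ, k1 ξ * u (v + a • ξ) with hA
  set B : Space d → ℝ≥0∞ := fun v => ∫⁻ ξ, k2 ξ * (b (v + a • ξ) * u (v + a • ξ)) with hB
  have hAm : Measurable A := Measurable.lintegral_prod_right' (f := fun q : Space d × Space d =>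
    k1 q.2 * u (q.1 + a • q.2)) (by fun_prop)
  have hBm : Measurable B := Measurable.lintegral_prod_right' (f := fun q : Space d × Space d =>
    k2 q.2 * (b (q.1 + a • q.2) * u (q.1 + a • q.2))) (by fun_prop)
  have hAB : ∀ v, ∫⁻ ξ, (k1 ξ + k2 ξ * b (v + a • ξ)) * u (v + a • ξ) = A v + B v := fun v => by
    rw [hA, hB]
    simp only
    rw [← lintegral_add_left (by fun_prop)]
    congr 1; ext ξ; ring
  -- The `k1` part is Young's inequality for an L¹ kernel acting on L².
  have h1 : ∫⁻ v, A v ^ 2 ≤ (∫⁻ ξ, k1 ξ) ^ 2 * ∫⁻ v, u v ^ 2 := by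
    calc ∫⁻ v, A v ^ 2 ≤ ∫⁻ v, (∫⁻ ξ, k1 ξ) * ∫⁻ ξ, k1 ξ * u (v + a • ξ) ^ 2 := by
          refine lintegral_mono fun v => ?_
          have := lintegral_sq_mul_le volume (k := fun _ => 1) (h := k1)
            (u := fun ξ => u (v + a • ξ)) aemeasurable_const hk1.aemeasurable (by fun_prop)
          simpa only [one_mul] using this
      _ = _ := by
          have m : Measurable (fun v => ∫⁻ ξ, k1 ξ * u (v + a • ξ) ^ 2) :=
            Measurable.lintegral_prod_right'
              (f := fun q : Space d × Space d => k1 q.2 * u (q.1 + a • q.2) ^ 2) (by fun_prop)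
          rw [lintegral_const_mul _ m,
            trans k1 (fun v => u v ^ 2) hk1 (by fun_prop)]
          ring
  -- For the `k2` part, `b u` is in L¹ by Cauchy-Schwarz, and an L² kernel maps L¹ to L². The
  -- Jacobian of `ξ ↦ v + aξ` produces the factor `|a^d|⁻¹`.
  have h2 : ∫⁻ v, B v ^ 2 ≤ ENNReal.ofReal |(a ^ d)⁻¹| *
      ((∫⁻ ξ, k2 ξ ^ 2) * ∫⁻ v, b v ^ 2) * ∫⁻ v, u v ^ 2 := by
    set c := ENNReal.ofReal |(a ^ d)⁻¹| with hc
    set H := ∫⁻ v, b v * u v with hH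
    have hH2 : H ^ 2 ≤ (∫⁻ v, b v ^ 2) * ∫⁻ v, u v ^ 2 :=
      lintegral_mul_sq_le volume hb.aemeasurable hu.aemeasurable
    calc ∫⁻ v, B v ^ 2 ≤ ∫⁻ v, (c * H) * ∫⁻ ξ, k2 ξ ^ 2 * (b (v + a • ξ) * u (v + a • ξ)) := by
          refine lintegral_mono fun v => ?_
          have := lintegral_sq_mul_le volume (k := k2)
            (h := fun ξ => b (v + a • ξ) * u (v + a • ξ))
            (u := fun _ => 1) hk2.aemeasurable (by fun_prop) aemeasurable_const
          rw [lintegral_comp_add_smul ha (h := fun v => b v * u v) (by fun_prop)] at this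
          simp only [mul_one] at this
          refine this.trans (le_of_eq ?_)
          simp only [mul_comm]
          rfl
      _ = c * H * ((∫⁻ ξ, k2 ξ ^ 2) * H) := by
          have m : Measurable
              (fun v => ∫⁻ ξ, k2 ξ ^ 2 * (b (v + a • ξ) * u (v + a • ξ))) :=
            Measurable.lintegral_prod_right' (f := fun q : Space d × Space d =>
              k2 q.2 ^ 2 * (b (q.1 + a • q.2) * u (q.1 + a • q.2))) (by fun_prop)
          rw [lintegral_const_mul _ m,
            trans (fun ξ => k2 ξ ^ 2) (fun v => b v * u v) (by fun_prop) (by fun_prop)]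
      _ = c * (∫⁻ ξ, k2 ξ ^ 2) * H ^ 2 := by ring
      _ ≤ c * (∫⁻ ξ, k2 ξ ^ 2) * ((∫⁻ v, b v ^ 2) * ∫⁻ v, u v ^ 2) := by gcongr
      _ = _ := by ring
  calc _ = ∫⁻ v, (A v + B v) ^ 2 := by simp only [hAB]
    _ ≤ ∫⁻ v, (4 * A v ^ 2 + 4 * B v ^ 2) := lintegral_mono fun v => sq_le _ _
    _ = 4 * (∫⁻ v, A v ^ 2) + 4 * ∫⁻ v, B v ^ 2 := by
        rw [lintegral_add_left (by fun_prop), lintegral_const_mul _ (by fun_prop),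
          lintegral_const_mul _ (by fun_prop)]
    _ ≤ 4 * ((∫⁻ ξ, k1 ξ) ^ 2 * ∫⁻ v, u v ^ 2) + 4 * (ENNReal.ofReal |(a ^ d)⁻¹| *
      ((∫⁻ ξ, k2 ξ ^ 2) * ∫⁻ v, b v ^ 2) * ∫⁻ v, u v ^ 2) := by gcongr
    _ = _ := by ring

/-- The integral operator in velocity with kernel `K`. -/
def kint (a : ℝ) (K : Phase d → Space d → ℝ) (u : Phase d → ℝ) (p : Phase d) : ℝ :=
  ∫ ξ, K p ξ * u (p.1, p.2 + a • ξ)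

/-- A measurable kernel with the pointwise bound that makes `kint` bounded on `L²`. -/
structure KerBd (a : ℝ) (K : Phase d → Space d → ℝ) (k1 k2 b : Space d → ℝ≥0∞) : Prop where
  meas : Measurable (fun q : Phase d × Space d => K q.1 q.2)
  meas1 : Measurable k1
  meas2 : Measurable k2
  measb : Measurable b
  bound : ∀ p ξ, ‖K p ξ‖ₑ ≤ k1 ξ + k2 ξ * b (p.2 + a • ξ)

/-- The constant of the Young inequality. -/
def kerConst (a : ℝ) (k1 k2 b : Space d → ℝ≥0∞) : ℝ≥0∞ :=
  4 * ((∫⁻ ξ, k1 ξ) ^ 2 + ENNReal.ofReal |(a ^ d)⁻¹| * ((∫⁻ ξ, k2 ξ ^ 2) * ∫⁻ v, b v ^ 2))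

theorem ae_fiber {P : Phase d → Prop} (h : ∀ᵐ p, P p) : ∀ᵐ x : Space d, ∀ᵐ v : Space d, P (x, v) := by
  rw [Measure.volume_eq_prod] at h
  exact Measure.ae_ae_of_ae_prod h

theorem ae_of_ae_fiber {P : Phase d → Prop} (hP : MeasurableSet {p | P p})
    (h : ∀ᵐ x : Space d, ∀ᵐ v : Space d, P (x, v)) : ∀ᵐ p, P p := by
  rw [Measure.volume_eq_prod]
  exact (Measure.ae_prod_iff_ae_ae hP).2 h

theorem ae_of_ae_fst {P : Space d → Prop} (h : ∀ᵐ x, P x) : ∀ᵐ p : Phase d, P p.1 := by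
  rw [Measure.volume_eq_prod]
  exact Measure.quasiMeasurePreserving_fst.ae h

/-- Since `ξ ↦ v + aξ` pulls null sets back to null sets, a null modification of `u` is invisible at
every `v` on almost every fibre. -/
theorem kint_congr_fiber {a : ℝ} (ha : a ≠ 0) (K : Phase d → Space d → ℝ) {u u' : Phase d → ℝ}
    (h : u =ᵐ[volume] u') : ∀ᵐ x : Space d, ∀ v, kint a K u (x, v) = kint a K u' (x, v) := by
  filter_upwards [ae_fiber h] with x hx v
  refine integral_congr_ae ?_
  filter_upwards [ae_comp_add_smul ha hx v] with ξ hξ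
  simp only [hξ]

theorem kint_congr {a : ℝ} (ha : a ≠ 0) (K : Phase d → Space d → ℝ) {u u' : Phase d → ℝ}
    (h : u =ᵐ[volume] u') : kint a K u =ᵐ[volume] kint a K u' := by
  filter_upwards [ae_of_ae_fst (kint_congr_fiber ha K h)] with p hp
  exact hp p.2

/-- The bound on the kernel does not involve `x`, so `young` applies on each fibre with the same
constant. -/
theorem KerBd.lintegral_le {a : ℝ} (ha : a ≠ 0) {K : Phase d → Space d → ℝ}
    {k1 k2 b : Space d → ℝ≥0∞} (hK : KerBd a K k1 k2 b) {u : Phase d → ℝ} (hu : Measurable u) :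
    ∫⁻ p : Phase d, (∫⁻ ξ, ‖K p ξ * u (p.1, p.2 + a • ξ)‖ₑ) ^ 2
      ≤ kerConst a k1 k2 b * ∫⁻ p, ‖u p‖ₑ ^ 2 := by
  have := hK.meas; have := hK.meas1; have := hK.meas2; have := hK.measb
  have m1 : Measurable (fun p : Phase d =>
      ∫⁻ ξ, (k1 ξ + k2 ξ * b (p.2 + a • ξ)) * ‖u (p.1, p.2 + a • ξ)‖ₑ) :=
    Measurable.lintegral_prod_right' (f := fun q : Phase d × Space d =>
      (k1 q.2 + k2 q.2 * b (q.1.2 + a • q.2)) * ‖u (q.1.1, q.1.2 + a • q.2)‖ₑ) (by fun_prop)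
  calc _ ≤ ∫⁻ p : Phase d,
        (∫⁻ ξ, (k1 ξ + k2 ξ * b (p.2 + a • ξ)) * ‖u (p.1, p.2 + a • ξ)‖ₑ) ^ 2 := by
        refine lintegral_mono fun p => ?_
        refine pow_le_pow_left₀ (zero_le) (lintegral_mono fun ξ => ?_) 2
        rw [enorm_mul]
        gcongr
        exact hK.bound p ξ
    _ = ∫⁻ x : Space d, ∫⁻ v : Space d,
        (∫⁻ ξ, (k1 ξ + k2 ξ * b (v + a • ξ)) * ‖u (x, v + a • ξ)‖ₑ) ^ 2 := by
        rw [Measure.volume_eq_prod, lintegral_prod _ (by fun_prop)]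
    _ ≤ ∫⁻ x : Space d, kerConst a k1 k2 b * ∫⁻ v, ‖u (x, v)‖ₑ ^ 2 := by
        refine lintegral_mono fun x => ?_
        exact young ha (u := fun v => ‖u (x, v)‖ₑ) hK.meas1 hK.meas2 hK.measb (by fun_prop)
    _ = _ := by
        have m : Measurable (fun x => ∫⁻ v, ‖u (x, v)‖ₑ ^ 2) :=
          Measurable.lintegral_prod_right' (f := fun q : Phase d => ‖u q‖ₑ ^ 2) (by fun_prop)
        rw [lintegral_const_mul _ m,
          Measure.volume_eq_prod, lintegral_prod _ (by fun_prop)]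

theorem lintegral_sq_lt_top {X : Type*} [MeasurableSpace X] {μ : Measure X} {f : X → ℝ}
    (h : MemLp f 2 μ) : ∫⁻ x, ‖f x‖ₑ ^ 2 ∂μ < ⊤ := by
  have := (eLpNorm_lt_top_iff_lintegral_rpow_enorm_lt_top (by norm_num) (by norm_num)).1 h.2
  simpa using this

theorem memLp_two_of_lintegral {X : Type*} [MeasurableSpace X] {μ : Measure X} {f : X → ℝ}
    (hf : AEStronglyMeasurable f μ) (h : ∫⁻ x, ‖f x‖ₑ ^ 2 ∂μ < ⊤) : MemLp f 2 μ := by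
  refine ⟨hf, (eLpNorm_lt_top_iff_lintegral_rpow_enorm_lt_top (by norm_num) (by norm_num)).2 ?_⟩
  simpa using h

theorem eLpNorm_two_sq {X : Type*} [MeasurableSpace X] {μ : Measure X} (f : X → ℝ) :
    eLpNorm f 2 μ ^ 2 = ∫⁻ x, ‖f x‖ₑ ^ 2 ∂μ := by
  rw [eLpNorm_eq_lintegral_rpow_enorm_toReal (by norm_num) (by norm_num)]
  rw [← ENNReal.rpow_natCast, ← ENNReal.rpow_mul]
  simp

theorem KerBd.integrable {a : ℝ} (ha : a ≠ 0) {K : Phase d → Space d → ℝ}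
    {k1 k2 b : Space d → ℝ≥0∞} (hK : KerBd a K k1 k2 b) (hC : kerConst a k1 k2 b < ⊤)
    {u : Phase d → ℝ} (hu : Measurable u) (h2 : MemLp u 2) :
    ∀ᵐ p : Phase d, Integrable (fun ξ => K p ξ * u (p.1, p.2 + a • ξ)) := by
  have := hK.meas
  have h := (hK.lintegral_le ha hu).trans_lt (ENNReal.mul_lt_top hC (lintegral_sq_lt_top h2))
  have m1 : Measurable (fun p : Phase d => (∫⁻ ξ, ‖K p ξ * u (p.1, p.2 + a • ξ)‖ₑ) ^ 2) :=
    (Measurable.lintegral_prod_right' (f := fun q : Phase d × Space d =>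
      ‖K q.1 q.2 * u (q.1.1, q.1.2 + a • q.2)‖ₑ) (by fun_prop)).pow_const 2
  filter_upwards [ae_lt_top m1 h.ne] with p hp
  refine ⟨Measurable.aestronglyMeasurable ?_, ?_⟩
  · exact (show Measurable (fun q : Phase d × Space d => K q.1 q.2 * u (q.1.1, q.1.2 + a • q.2)) by
      fun_prop).comp (measurable_const.prodMk measurable_id)
  · exact (ENNReal.pow_lt_top_iff.1 hp).resolve_right (by norm_num)

theorem KerBd.memLp {a : ℝ} (ha : a ≠ 0) {K : Phase d → Space d → ℝ}
    {k1 k2 b : Space d → ℝ≥0∞} (hK : KerBd a K k1 k2 b) (hC : kerConst a k1 k2 b < ⊤)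
    {u : Phase d → ℝ} (hu : Measurable u) (h2 : MemLp u 2) :
    MemLp (kint a K u) 2 ∧
      ∫⁻ p, ‖kint a K u p‖ₑ ^ 2 ≤ kerConst a k1 k2 b * ∫⁻ p, ‖u p‖ₑ ^ 2 := by
  have := hK.meas
  have hle : ∫⁻ p, ‖kint a K u p‖ₑ ^ 2 ≤ kerConst a k1 k2 b * ∫⁻ p, ‖u p‖ₑ ^ 2 :=
    (lintegral_mono fun p => pow_le_pow_left₀ (zero_le) (enorm_integral_le_lintegral_enorm _) 2).trans
      (hK.lintegral_le ha hu)
  refine ⟨memLp_two_of_lintegral ?_ ?_, hle⟩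
  · exact (StronglyMeasurable.integral_prod_right (f := fun p ξ => K p ξ * u (p.1, p.2 + a • ξ))
      (Measurable.stronglyMeasurable (by fun_prop))).aestronglyMeasurable
  · exact hle.trans_lt (ENNReal.mul_lt_top hC (lintegral_sq_lt_top h2))

/-- `L²` of phase space. -/
abbrev L2P (d : ℕ) := Lp (α := Phase d) ℝ 2 volume

/-- A bounded kernel defines a bounded operator on `L²`. -/
theorem KerBd.exists_clm {a : ℝ} (ha : a ≠ 0) {K : Phase d → Space d → ℝ}
    {k1 k2 b : Space d → ℝ≥0∞} (hK : KerBd a K k1 k2 b) (hC : kerConst a k1 k2 b < ⊤) :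
    ∃ T : L2P d →L[ℝ] L2P d, (∀ u : L2P d, T u =ᵐ[volume] kint a K u) ∧
      ‖T‖ ^ 2 ≤ (kerConst a k1 k2 b).toReal := by
  have hmem : ∀ u : L2P d, MemLp (kint a K u) 2 := fun u =>
    (hK.memLp ha hC (Lp.stronglyMeasurable u).measurable (Lp.memLp u)).1
  have hint : ∀ u : L2P d, ∀ᵐ p : Phase d, Integrable (fun ξ => K p ξ * u (p.1, p.2 + a • ξ)) :=
    fun u => hK.integrable ha hC (Lp.stronglyMeasurable u).measurable (Lp.memLp u)
  let L : L2P d →ₗ[ℝ] L2P d :=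
    { toFun := fun u => (hmem u).toLp _
      map_add' := fun u u' => by
        rw [← MemLp.toLp_add, MemLp.toLp_eq_toLp_iff]
        filter_upwards [kint_congr ha K (Lp.coeFn_add u u'), hint u, hint u'] with p h1 h2 h3
        rw [h1]
        simp only [kint, Pi.add_apply, mul_add]
        exact integral_add h2 h3
      map_smul' := fun c u => by
        simp only [RingHom.id_apply]
        rw [← MemLp.toLp_const_smul, MemLp.toLp_eq_toLp_iff]
        filter_upwards [kint_congr ha K (Lp.coeFn_smul c u)] with p h1
        rw [h1]
        simp only [kint, Pi.smul_apply, smul_eq_mul]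
        rw [← integral_const_mul]
        congr 1; ext ξ; ring }
  have hb : ∀ u, ‖L u‖ ≤ √(kerConst a k1 k2 b).toReal * ‖u‖ := fun u => by
    have h := (hK.memLp ha hC (Lp.stronglyMeasurable u).measurable (Lp.memLp u)).2
    rw [← eLpNorm_two_sq, ← eLpNorm_two_sq] at h
    have h' : (eLpNorm (kint a K u) 2 volume).toReal ^ 2
        ≤ (kerConst a k1 k2 b).toReal * (eLpNorm u 2 volume).toReal ^ 2 := by
      rw [← ENNReal.toReal_pow, ← ENNReal.toReal_pow, ← ENNReal.toReal_mul]
      refine ENNReal.toReal_mono ?_ h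
      exact (ENNReal.mul_lt_top hC (ENNReal.pow_lt_top (Lp.memLp u).2)).ne
    have e1 : ‖L u‖ = (eLpNorm (kint a K u) 2 volume).toReal := Lp.norm_toLp _ (hmem u)
    rw [e1, Lp.norm_def]
    refine le_of_sq_le_sq ?_ (by positivity)
    rw [mul_pow, Real.sq_sqrt ENNReal.toReal_nonneg]
    exact h'
  refine ⟨L.mkContinuous _ hb, fun u => (hmem u).coeFn_toLp, ?_⟩
  have := L.mkContinuous_norm_le (Real.sqrt_nonneg _) hb
  calc _ ≤ (√(kerConst a k1 k2 b).toReal) ^ 2 := by gcongr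
    _ = _ := Real.sq_sqrt ENNReal.toReal_nonneg

theorem measurePreserving_shift (w : Space d) :
    MeasurePreserving (fun p : Phase d => (p.1, p.2 + w)) volume volume := by
  rw [Measure.volume_eq_prod]
  exact (MeasurePreserving.id _).prod (measurePreserving_add_right volume w)

/-- Cauchy-Schwarz for `ψ` and the absolute kernel integral of `u`; this licenses the use of Fubini
in bilinear pairings. -/
theorem KerBd.integrable_prod {a : ℝ} (ha : a ≠ 0) {K : Phase d → Space d → ℝ}
    {k1 k2 b : Space d → ℝ≥0∞} (hK : KerBd a K k1 k2 b) (hC : kerConst a k1 k2 b < ⊤)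
    {u ψ : Phase d → ℝ} (hu : Measurable u) (h2 : MemLp u 2) (hψ : Measurable ψ)
    (hψ2 : MemLp ψ 2) :
    Integrable (fun q : Phase d × Space d => K q.1 q.2 * u (q.1.1, q.1.2 + a • q.2) * ψ q.1)
      (volume.prod volume) := by
  have mKu : Measurable (fun q : Phase d × Space d => K q.1 q.2 * u (q.1.1, q.1.2 + a • q.2)) :=
    hK.meas.mul (hu.comp (by fun_prop))
  have mF : Measurable (fun q : Phase d × Space d =>
      K q.1 q.2 * u (q.1.1, q.1.2 + a • q.2) * ψ q.1) := mKu.mul (hψ.comp measurable_fst)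
  refine ⟨mF.aestronglyMeasurable, ?_⟩
  rw [HasFiniteIntegral, lintegral_prod _ mF.enorm.aemeasurable]
  have e : ∀ p : Phase d, ∫⁻ ξ, ‖K p ξ * u (p.1, p.2 + a • ξ) * ψ p‖ₑ
      = (∫⁻ ξ, ‖K p ξ * u (p.1, p.2 + a • ξ)‖ₑ) * ‖ψ p‖ₑ := fun p => by
    simp only [enorm_mul (_ * _) (ψ p)]
    rw [lintegral_mul_const' _ _ enorm_ne_top]
  simp only [e]
  have m1 : Measurable (fun p : Phase d => ∫⁻ ξ, ‖K p ξ * u (p.1, p.2 + a • ξ)‖ₑ) :=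
    Measurable.lintegral_prod_right' (f := fun q : Phase d × Space d =>
      ‖K q.1 q.2 * u (q.1.1, q.1.2 + a • q.2)‖ₑ) mKu.enorm
  have h3 := lintegral_mul_sq_le (volume : Measure (Phase d)) m1.aemeasurable
    (g := fun p => ‖ψ p‖ₑ) (by fun_prop)
  have h4 := (hK.lintegral_le ha hu).trans_lt (ENNReal.mul_lt_top hC (lintegral_sq_lt_top h2))
  have h5 := h3.trans_lt (ENNReal.mul_lt_top h4 (lintegral_sq_lt_top hψ2))
  exact (ENNReal.pow_lt_top_iff.1 h5).resolve_right (by norm_num)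

theorem KerBd.integral_kint_mul {a : ℝ} (ha : a ≠ 0) {K : Phase d → Space d → ℝ}
    {k1 k2 b : Space d → ℝ≥0∞} (hK : KerBd a K k1 k2 b) (hC : kerConst a k1 k2 b < ⊤)
    {u ψ : Phase d → ℝ} (hu : Measurable u) (h2 : MemLp u 2) (hψ : Measurable ψ)
    (hψ2 : MemLp ψ 2) :
    Integrable (fun ξ : Space d => ∫ p : Phase d, K p ξ * u (p.1, p.2 + a • ξ) * ψ p) ∧
    ∫ p, kint a K u p * ψ p = ∫ ξ : Space d, ∫ p : Phase d, K p ξ * u (p.1, p.2 + a • ξ) * ψ p := by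
  have hi := hK.integrable_prod ha hC hu h2 hψ hψ2
  refine ⟨hi.integral_prod_right, ?_⟩
  rw [← integral_integral_swap (f := fun (p : Phase d) ξ => K p ξ * u (p.1, p.2 + a • ξ) * ψ p) hi]
  congr 1; ext p
  rw [kint, integral_mul_const]

theorem integral_comp_shift (w : Space d) (f : Phase d → ℝ) :
    ∫ p : Phase d, f (p.1, p.2 + w) = ∫ p, f p :=
  (measurePreserving_shift w).integral_comp
    ((MeasurableEquiv.prodCongr (MeasurableEquiv.refl _)
      (MeasurableEquiv.addRight w)).measurableEmbedding) f

/-- Odd kernels act as skew symmetric operators. -/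
theorem integral_kint_mul_self {a : ℝ} (ha : a ≠ 0) {κ : Space d → Space d → ℝ}
    (hodd : ∀ x ξ, κ x (-ξ) = -κ x ξ) {k1 k2 b : Space d → ℝ≥0∞}
    (hK : KerBd a (fun p => κ p.1) k1 k2 b) (hC : kerConst a k1 k2 b < ⊤) {u : Phase d → ℝ}
    (hu : Measurable u) (h2 : MemLp u 2) :
    ∫ p, kint a (fun p => κ p.1) u p * u p = 0 := by
  have e1 := (hK.integral_kint_mul ha hC hu h2 hu h2).2
  -- Translating `v` by `aξ` exchanges the two copies of `u`, and oddness of the kernel supplies the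
  -- sign. The substitution `ξ ↦ -ξ` then shows that the double integral equals its own negative.
  have e2 : ∀ ξ : Space d, ∫ p : Phase d, κ p.1 (-ξ) * u (p.1, p.2 + a • (-ξ)) * u p
      = -∫ p : Phase d, κ p.1 ξ * u (p.1, p.2 + a • ξ) * u p := fun ξ => by
    rw [← integral_comp_shift (a • ξ)
      (fun p : Phase d => κ p.1 (-ξ) * u (p.1, p.2 + a • (-ξ)) * u p), ← integral_neg]
    congr 1; ext p
    simp only [hodd, smul_neg, add_neg_cancel_right]
    ring
  have e3 : ∫ ξ : Space d, ∫ p : Phase d, κ p.1 ξ * u (p.1, p.2 + a • ξ) * u p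
      = -∫ ξ : Space d, ∫ p : Phase d, κ p.1 ξ * u (p.1, p.2 + a • ξ) * u p := by
    conv_lhs => rw [← integral_neg_eq_self (μ := (volume : Measure (Space d)))]
    rw [← integral_neg]
    congr 1; ext ξ
    exact e2 ξ
  rw [e1]
  linarith

/-! ### Solving coercive equations in invariant subspaces -/

/-- Lax-Milgram for the restriction of `B` to the closed invariant subspace `G`, where it stays
coercive; thus the solution inherits membership in `G`. The bound follows from `c‖w‖² ≤ ⟨Bw, w⟩ =
⟨s, w⟩`. -/
theorem exists_solution_of_coercive {H : Type*} [NormedAddCommGroup H] [InnerProductSpace ℝ H]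
    [CompleteSpace H] (B : H →L[ℝ] H) {c : ℝ} (hc : 0 < c)
    (hB : ∀ x, c * ‖x‖ ^ 2 ≤ inner ℝ (B x) x) (G : Submodule ℝ H) (hG : IsClosed (G : Set H))
    (hBG : ∀ x ∈ G, B x ∈ G) {s : H} (hs : s ∈ G) : ∃ w ∈ G, B w = s ∧ c * ‖w‖ ≤ ‖s‖ := by
  have : CompleteSpace G := hG.completeSpace_coe
  let Bg : G →L[ℝ] G := (B.comp G.subtypeL).codRestrict G fun x => hBG x x.2
  let b : G →L[ℝ] G →L[ℝ] ℝ := (innerSL ℝ).comp Bg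
  have hb : IsCoercive b := ⟨c, hc, fun u => by
    have := hB u
    have e : b u u = inner ℝ (B u) (u : H) := rfl
    rw [e, mul_assoc, ← sq]
    exact this⟩
  have hr := hb.range_eq_top
  obtain ⟨w, hw⟩ : ∃ w : G, InnerProductSpace.continuousLinearMapOfBilin b w = ⟨s, hs⟩ := by
    have : (⟨s, hs⟩ : G) ∈ (InnerProductSpace.continuousLinearMapOfBilin b).range := by
      rw [hr]; trivial
    exact this
  have hw' : Bg w = ⟨s, hs⟩ := by
    rw [← hw]
    refine ext_inner_right ℝ fun v => ?_
    rw [InnerProductSpace.continuousLinearMapOfBilin_apply]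
    rfl
  have hws : B w = s := congrArg Subtype.val hw'
  refine ⟨w, w.2, hws, ?_⟩
  have h1 := hB w
  rw [hws] at h1
  have h2 := real_inner_le_norm s (w : H)
  rcases (norm_nonneg (w : H)).eq_or_lt with h0 | h0
  · rw [← h0]; simp
  · nlinarith

/-! ### The kernel of the pseudo-differential operator -/

/-- Velocity kernel of `Θ[pot W]`; `β = 2/ħ`. -/
def ker (β : ℝ) (W : Space d → ℂ) (x ξ : Space d) : ℝ :=
  β * trig (fun ξ => Complex.I * W ξ) x ξ

/-- The operator with kernel `ker`. -/
def opK (a β : ℝ) (W : Space d → ℂ) : (Phase d → ℝ) → Phase d → ℝ :=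
  kint a fun p => ker β W p.1

theorem abs_ker_le (β : ℝ) (W : Space d → ℂ) (x ξ : Space d) : |ker β W x ξ| ≤ |β| * ‖W ξ‖ := by
  rw [ker, abs_mul]
  gcongr
  refine (abs_trig_le _ x ξ).trans ?_
  simp

theorem measurable_ker (β : ℝ) {W : Space d → ℂ} (hW : Measurable W) :
    Measurable (fun q : Space d × Space d => ker β W q.1 q.2) :=
  (measurable_trig (hW.const_mul Complex.I)).const_mul β

theorem measurable_ker_phase (β : ℝ) {W : Space d → ℂ} (hW : Measurable W) :
    Measurable (fun q : Phase d × Space d => ker β W q.1.1 q.2) := by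
  have h : Measurable (fun q : Phase d × Space d => (q.1.1, q.2)) := by fun_prop
  have h2 := (measurable_ker β hW).comp h
  exact h2

theorem Herm.ker_neg {W : Space d → ℂ} (h : Herm W) (β : ℝ) (x ξ : Space d) :
    ker β W x (-ξ) = -ker β W x ξ := by
  rw [ker, h.trig_I_neg, ker]
  ring

theorem contDiff_ker (β : ℝ) (W : Space d → ℂ) (ξ : Space d) :
    ContDiff ℝ ∞ (fun x => ker β W x ξ) :=
  contDiff_const.mul (contDiff_trig _ ξ)

theorem partialD_ker (β : ℝ) (W : Space d → ℂ) (ξ x : Space d) (j : Fin d) :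
    partialD j (fun x => ker β W x ξ) x = ker β (dW j W) x ξ := by
  have h := partialD_trig (fun ξ => Complex.I * W ξ) ξ x j
  have e : dW j (fun ξ => Complex.I * W ξ) = fun ξ => Complex.I * dW j W ξ := by
    ext ξ; simp only [dW]; ring
  rw [e] at h
  unfold ker
  rw [← h]
  simp only [partialD]
  rw [fderiv_const_mul]
  · rfl
  · exact ((contDiff_trig _ ξ).differentiable (by simp)).differentiableAt

theorem kerBd_ker (a β : ℝ) {W : Space d → ℂ} (hm : Measurable W) :
    KerBd a (fun p => ker β W p.1) (fun ξ => ‖β‖ₑ * ‖W ξ‖ₑ) 0 0 where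
  meas := measurable_ker_phase β hm
  meas1 := by fun_prop
  meas2 := measurable_const
  measb := measurable_const
  bound := fun p ξ => by
    simp only [Pi.zero_apply, mul_zero, add_zero]
    rw [← ofReal_norm, ← ofReal_norm, ← ofReal_norm, ← ENNReal.ofReal_mul (norm_nonneg _)]
    exact ENNReal.ofReal_le_ofReal (abs_ker_le β W p.1 ξ)

theorem kerConst_ker_lt_top (a β : ℝ) {W : Space d → ℂ} (hW : Integrable W) :
    kerConst a (fun ξ => ‖β‖ₑ * ‖W ξ‖ₑ) (0 : Space d → ℝ≥0∞) (0 : Space d → ℝ≥0∞) < ⊤ := by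
  have h : ∫⁻ ξ, ‖β‖ₑ * ‖W ξ‖ₑ < ⊤ := by
    rw [lintegral_const_mul' _ _ enorm_ne_top]
    exact ENNReal.mul_lt_top enorm_lt_top hW.2
  simp only [kerConst, Pi.zero_apply]
  simp only [ne_eq, OfNat.ofNat_ne_zero, not_false_eq_true, zero_pow, lintegral_const, zero_mul,
    mul_zero, add_zero]
  exact ENNReal.mul_lt_top (by norm_num) (ENNReal.pow_lt_top h)

theorem exists_clm_opK {a : ℝ} (ha : a ≠ 0) (β : ℝ) {W : Space d → ℂ} (hW : Integrable W)
    (hm : Measurable W) : ∃ T : L2P d →L[ℝ] L2P d, ∀ u : L2P d, T u =ᵐ[volume] opK a β W u := by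
  obtain ⟨T, hT, -⟩ := (kerBd_ker a β hm).exists_clm ha (kerConst_ker_lt_top a β hW)
  exact ⟨T, hT⟩

theorem opK_congr {a : ℝ} (ha : a ≠ 0) (β : ℝ) (W : Space d → ℂ) {u u' : Phase d → ℝ}
    (h : u =ᵐ[volume] u') : opK a β W u =ᵐ[volume] opK a β W u' := kint_congr ha _ h

/-- Skew symmetry of `Θ`, which makes `ν - Θ` coercive on L² with constant `ν`, whatever the size of
the potential. -/
theorem inner_opK_self {a : ℝ} (ha : a ≠ 0) {β : ℝ} {W : Space d → ℂ} (hW : Integrable W)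
    (hm : Measurable W) (hH : Herm W) {T : L2P d →L[ℝ] L2P d}
    (hT : ∀ u : L2P d, T u =ᵐ[volume] opK a β W u) (u : L2P d) : inner ℝ (T u) u = 0 := by
  rw [L2.inner_def, ← integral_kint_mul_self ha (hH.ker_neg β) (kerBd_ker a β hm)
    (kerConst_ker_lt_top a β hW) (Lp.stronglyMeasurable u).measurable (Lp.memLp u)]
  refine integral_congr_ae ?_
  filter_upwards [hT u] with p hp
  rw [hp]
  simp [opK, mul_comm]

/-- `ν w - Θ w = s` almost everywhere. -/
def SolvesK (a β ν : ℝ) (W : Space d → ℂ) (w s : Phase d → ℝ) : Prop :=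
  (fun p => ν * w p - opK a β W w p) =ᵐ[volume] s

theorem SolvesK.congr {a : ℝ} (ha : a ≠ 0) {β ν : ℝ} {W : Space d → ℂ} {w w' s s' : Phase d → ℝ}
    (h : SolvesK a β ν W w s) (hw : w =ᵐ[volume] w') (hs : s =ᵐ[volume] s') :
    SolvesK a β ν W w' s' := by
  unfold SolvesK at h ⊢
  filter_upwards [h, hw, hs, opK_congr ha β W hw] with p h1 h2 h3 h4
  rw [← h2, ← h3, ← h4, h1]

theorem SolvesK.toLp {a : ℝ} (ha : a ≠ 0) {β ν : ℝ} {W : Space d → ℂ}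
    {T : L2P d →L[ℝ] L2P d} (hT : ∀ u : L2P d, T u =ᵐ[volume] opK a β W u) {w s : Phase d → ℝ}
    (hw : MemLp w 2 volume) (hs : MemLp s 2 volume) (h : SolvesK a β ν W w s) :
    ν • (hw.toLp w : L2P d) - T (hw.toLp w) = hs.toLp s := by
  refine Lp.ext ?_
  filter_upwards [Lp.coeFn_sub (ν • hw.toLp w) (T (hw.toLp w)), Lp.coeFn_smul ν (hw.toLp w),
    hT (hw.toLp w), hw.coeFn_toLp, hs.coeFn_toLp, h, opK_congr ha β W hw.coeFn_toLp]
    with p h1 h2 h3 h4 h5 h6 h7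
  rw [h1, Pi.sub_apply, h2, Pi.smul_apply, h3, h4, h5, h7, ← h6]
  rfl

/-- Pair the equation for the difference with the difference itself: the skew part drops out and
`ν‖w - w'‖² = 0` remains. -/
theorem SolvesK.unique {a : ℝ} (ha : a ≠ 0) {β ν : ℝ} (hν : 0 < ν) {W : Space d → ℂ}
    (hW : Integrable W) (hm : Measurable W) (hH : Herm W) {w w' s s' : Phase d → ℝ}
    (hw : MemLp w 2) (hw' : MemLp w' 2) (hs : MemLp s 2) (h : SolvesK a β ν W w s)
    (h' : SolvesK a β ν W w' s') (hss : s =ᵐ[volume] s') : w =ᵐ[volume] w' := by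
  obtain ⟨T, hT⟩ := exists_clm_opK ha β hW hm
  have e1 := h.toLp ha hT hw hs
  have e2 := (h'.congr ha (ae_eq_refl _) hss.symm).toLp ha hT hw' hs
  have e3 : ν • (hw.toLp w - hw'.toLp w') - T (hw.toLp w - hw'.toLp w') = 0 := by
    rw [map_sub, smul_sub, sub_sub_sub_comm, e1, e2, sub_self]
  have e4 := congrArg (fun z => inner ℝ z (hw.toLp w - hw'.toLp w')) e3
  simp only [inner_sub_left (ν • _), inner_smul_left, inner_zero_left, inner_opK_self ha hW hm hH hT,
    real_inner_self_eq_norm_sq] at e4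
  simp only [conj_trivial, sub_zero, mul_eq_zero, hν.ne', false_or, sq_eq_zero_iff, norm_eq_zero,
    sub_eq_zero] at e4
  exact (MemLp.toLp_eq_toLp_iff hw hw').1 e4

/-! ### The resolvent in weighted spaces -/

/-- `(1 + |v|)^j w ∈ L²`. -/
def MemY (j : ℕ) (w : Phase d → ℝ) : Prop := MemLp (fun p => (1 + ‖p.2‖) ^ j * w p) 2

/-- Used with `A = R + |v|` and `B = R + |v + aξ|`. With `r = t/B` the quotient differs from 1 by at
most `r`, and `r(1 + r)^(j-1)` is estimated separately for `r ≤ 1` and `r ≥ 1`. The two resulting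
terms fit the two parts of the bound in `KerBd`. -/
theorem abs_pow_div_sub_one_le {j : ℕ} (hj : j ≠ 0) {A B t : ℝ} (hB : 0 < B)
    (ht : |A - B| ≤ t) : |A ^ j / B ^ j - 1| ≤ j * 2 ^ j * (t / B + t ^ j * (B ^ j)⁻¹) := by
  obtain ⟨i, rfl⟩ := Nat.exists_eq_succ_of_ne_zero hj
  have ht0 : 0 ≤ t := (abs_nonneg _).trans ht
  have h1 : |(A / B) ^ (i + 1) - 1 ^ (i + 1)| ≤ |A / B - 1| * (i + 1 : ℕ) * max |A / B| |1| ^ i :=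
    abs_pow_sub_pow_le (A / B) 1 (i + 1)
  have h2 : |A / B - 1| ≤ t / B := by
    rw [div_sub_one hB.ne', abs_div, abs_of_pos hB]
    gcongr
  set r := t / B with hr
  have hr0 : 0 ≤ r := by positivity
  have h3 : max |A / B| |1| ≤ 1 + r := by
    rw [abs_one]
    refine max_le ?_ (by linarith)
    calc |A / B| = |(A / B - 1) + 1| := by ring_nf
      _ ≤ |A / B - 1| + |1| := abs_add_le _ _
      _ ≤ _ := by rw [abs_one]; linarith
  have h4 : r * (1 + r) ^ i ≤ 2 ^ i * (r + r ^ (i + 1)) := by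
    rcases le_total r 1 with h | h
    · calc r * (1 + r) ^ i ≤ r * 2 ^ i := by gcongr; linarith
        _ ≤ _ := by nlinarith [pow_pos (show (0 : ℝ) < 2 by norm_num) i, pow_nonneg hr0 (i + 1)]
    · calc r * (1 + r) ^ i ≤ r * (2 * r) ^ i := by gcongr; linarith
        _ = 2 ^ i * r ^ (i + 1) := by rw [mul_pow]; ring
        _ ≤ _ := by nlinarith [pow_pos (show (0 : ℝ) < 2 by norm_num) i]
  have e : r ^ (i + 1) = t ^ (i + 1) * (B ^ (i + 1))⁻¹ := by rw [hr, div_pow]; rfl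
  rw [← div_pow, Nat.succ_eq_add_one, ← e]
  rw [one_pow] at h1
  calc |(A / B) ^ (i + 1) - 1| ≤ |A / B - 1| * (i + 1 : ℕ) * max |A / B| |1| ^ i := h1
    _ ≤ r * (i + 1 : ℕ) * (1 + r) ^ i := by gcongr
    _ = (i + 1 : ℕ) * (r * (1 + r) ^ i) := by ring
    _ ≤ (i + 1 : ℕ) * (2 ^ i * (r + r ^ (i + 1))) := by gcongr
    _ ≤ (i + 1 : ℕ) * (2 ^ (i + 1) * (r + r ^ (i + 1))) := by
        gcongr
        · norm_num
        · omega
    _ = _ := by ring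

/-- The difference of the weighted kernel and the kernel. -/
def kerD (a β : ℝ) (W : Space d → ℂ) (j : ℕ) (R : ℝ) (p : Phase d) (ξ : Space d) : ℝ :=
  ker β W p.1 ξ * ((R + ‖p.2‖) ^ j / (R + ‖p.2 + a • ξ‖) ^ j - 1)

/-- In the first term `B ≥ R` yields the small factor `R⁻¹`. In the second term the decay `B^(-j)`
is retained and later integrated in the velocity. -/
theorem kerBd_kerD (a β : ℝ) {W : Space d → ℂ} (hm : Measurable W) {j : ℕ} (hj : j ≠ 0) {R : ℝ}
    (hR : 0 < R) :
    KerBd a (kerD a β W j R)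
      (fun ξ => ENNReal.ofReal R⁻¹ * ENNReal.ofReal (|β| * j * 2 ^ j * |a| * (‖ξ‖ * ‖W ξ‖)))
      (fun ξ => ENNReal.ofReal (|β| * j * 2 ^ j * |a| ^ j * (‖ξ‖ ^ j * ‖W ξ‖)))
      (fun v => ENNReal.ofReal (((R + ‖v‖) ^ j)⁻¹)) where
  meas := (measurable_ker_phase β hm).mul (by fun_prop)
  meas1 := by fun_prop
  meas2 := by fun_prop
  measb := by fun_prop
  bound := fun p ξ => by
    rw [← ENNReal.ofReal_mul (by positivity), ← ENNReal.ofReal_mul (by positivity),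
      ← ENNReal.ofReal_add (by positivity) (by positivity), ← ofReal_norm]
    refine ENNReal.ofReal_le_ofReal ?_
    have hB : 0 < R + ‖p.2 + a • ξ‖ := by positivity
    have ht : |(R + ‖p.2‖) - (R + ‖p.2 + a • ξ‖)| ≤ |a| * ‖ξ‖ := by
      have := abs_norm_sub_norm_le p.2 (p.2 + a • ξ)
      rw [sub_add_cancel_left, norm_neg, norm_smul, Real.norm_eq_abs] at this
      rwa [add_sub_add_left_eq_sub]
    have h := abs_pow_div_sub_one_le hj hB ht
    have h2 : |a| * ‖ξ‖ / (R + ‖p.2 + a • ξ‖) ≤ |a| * ‖ξ‖ / R := by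
      gcongr
      linarith [norm_nonneg (p.2 + a • ξ)]
    rw [kerD, Real.norm_eq_abs, abs_mul]
    calc _ ≤ (|β| * ‖W ξ‖) * (j * 2 ^ j * (|a| * ‖ξ‖ / R + (|a| * ‖ξ‖) ^ j *
          ((R + ‖p.2 + a • ξ‖) ^ j)⁻¹)) := by
          gcongr
          · exact abs_ker_le β W p.1 ξ
          · exact h.trans (by gcongr)
      _ = _ := by rw [mul_pow]; ring

/-- Dominated convergence, with the integrand at `N = 0` as dominating function; it is integrable
because `2j > d`. -/
theorem tendsto_lintegral_weight_inv {j : ℕ} (hj : d < 2 * j) :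
    Tendsto (fun N : ℕ => ∫⁻ v : Space d, ENNReal.ofReal ((((N : ℝ) + 1 + ‖v‖) ^ j)⁻¹) ^ 2)
      atTop (𝓝 0) := by
  have hj0 : j ≠ 0 := by omega
  have h := tendsto_lintegral_of_dominated_convergence (μ := (volume : Measure (Space d)))
    (F := fun (N : ℕ) v => ENNReal.ofReal ((((N : ℝ) + 1 + ‖v‖) ^ j)⁻¹) ^ 2) (f := fun _ => 0)
    (fun v => ENNReal.ofReal (((1 + ‖v‖) ^ j)⁻¹) ^ 2) (fun N => by fun_prop)
    (fun N => Eventually.of_forall fun v => by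
      simp only
      gcongr
      linarith [(Nat.cast_nonneg N : (0 : ℝ) ≤ N)]) ?_ ?_
  · simpa using h
  · have := lintegral_sq_lt_top (memLp_one_add_norm_pow_inv hj)
    refine ((lintegral_congr fun v => ?_).trans_lt this).ne
    rw [← ofReal_norm, Real.norm_of_nonneg (by positivity)]
  · refine Eventually.of_forall fun v => ?_
    have h1 : Tendsto (fun N : ℕ => ((((N : ℝ) + 1 + ‖v‖) ^ j)⁻¹)) atTop (𝓝 0) := by
      refine tendsto_inv_atTop_zero.comp ((tendsto_pow_atTop hj0).comp ?_)
      exact tendsto_atTop_add_const_right _ _ (tendsto_atTop_add_const_right _ _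
        tendsto_natCast_atTop_atTop)
    have h2 := ENNReal.Tendsto.pow (n := 2) (ENNReal.tendsto_ofReal h1)
    simpa using h2

/-- Both parts of the Young constant vanish as the weight is flattened, so the commutator of `Θ`
with the weight becomes an arbitrarily small perturbation. -/
theorem tendsto_kerConst_kerD (a β : ℝ) {j : ℕ} (hj : d < 2 * j) {W : Space d → ℂ}
    (hW : Dec j W) (hW1 : Integrable (fun ξ => ‖ξ‖ * ‖W ξ‖)) :
    Tendsto (fun N : ℕ => kerConst a
      (fun ξ : Space d => ENNReal.ofReal ((N : ℝ) + 1)⁻¹ *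
        ENNReal.ofReal (|β| * j * 2 ^ j * |a| * (‖ξ‖ * ‖W ξ‖)))
      (fun ξ => ENNReal.ofReal (|β| * j * 2 ^ j * |a| ^ j * (‖ξ‖ ^ j * ‖W ξ‖)))
      (fun v => ENNReal.ofReal ((((N : ℝ) + 1 + ‖v‖) ^ j)⁻¹))) atTop (𝓝 0) := by
  have hm := hW.1
  set A := ∫⁻ ξ, ENNReal.ofReal (|β| * j * 2 ^ j * |a| * (‖ξ‖ * ‖W ξ‖)) with hA
  set B := ∫⁻ ξ, ENNReal.ofReal (|β| * j * 2 ^ j * |a| ^ j * (‖ξ‖ ^ j * ‖W ξ‖)) ^ 2 with hB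
  have hA' : A ≠ ⊤ := by
    have := (hW1.const_mul (|β| * j * 2 ^ j * |a|)).lintegral_lt_top
    exact this.ne
  have hB' : B ≠ ⊤ := by
    have h2 : MemLp (fun ξ => |β| * j * 2 ^ j * |a| ^ j * (‖ξ‖ ^ j * ‖W ξ‖)) 2 := by
      refine hW.2.of_le_mul (c := |β| * j * 2 ^ j * |a| ^ j)
        (Measurable.aestronglyMeasurable (by fun_prop)) (Eventually.of_forall fun ξ => ?_)
      rw [Real.norm_of_nonneg (by positivity), Real.norm_of_nonneg (by positivity)]
      gcongr
      linarith
    refine ((lintegral_congr fun ξ => ?_).trans_lt (lintegral_sq_lt_top h2)).ne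
    rw [← ofReal_norm, Real.norm_of_nonneg (by positivity)]
  have hr : Tendsto (fun N : ℕ => ENNReal.ofReal ((N : ℝ) + 1)⁻¹) atTop (𝓝 0) := by
    have h1 : Tendsto (fun N : ℕ => ((N : ℝ) + 1)⁻¹) atTop (𝓝 0) :=
      tendsto_inv_atTop_zero.comp (tendsto_atTop_add_const_right _ _ tendsto_natCast_atTop_atTop)
    simpa using ENNReal.tendsto_ofReal h1
  have h1 : Tendsto (fun N : ℕ => (ENNReal.ofReal ((N : ℝ) + 1)⁻¹ * A) ^ 2) atTop (𝓝 0) := by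
    have := ENNReal.Tendsto.pow (n := 2)
      (ENNReal.Tendsto.mul_const (b := A) hr (Or.inr hA'))
    simpa using this
  have h2 : Tendsto (fun N : ℕ => ENNReal.ofReal |(a ^ d)⁻¹| *
      (B * ∫⁻ v : Space d, ENNReal.ofReal ((((N : ℝ) + 1 + ‖v‖) ^ j)⁻¹) ^ 2)) atTop (𝓝 0) := by
    have := ENNReal.Tendsto.const_mul (a := ENNReal.ofReal |(a ^ d)⁻¹|)
      (ENNReal.Tendsto.const_mul (a := B) (tendsto_lintegral_weight_inv hj) (Or.inr hB'))
      (Or.inr ENNReal.ofReal_ne_top)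
    simpa using this
  have h3 := ENNReal.Tendsto.const_mul (a := 4) (h1.add h2) (Or.inr (by norm_num))
  simp only [add_zero, mul_zero] at h3
  refine h3.congr fun N => ?_
  rw [kerConst, lintegral_const_mul' _ _ ENNReal.ofReal_ne_top]

/-- The Young constant of `kerD`. -/
def kerDConst (a β : ℝ) (W : Space d → ℂ) (j : ℕ) (R : ℝ) : ℝ≥0∞ := kerConst a
  (fun ξ : Space d => ENNReal.ofReal R⁻¹ * ENNReal.ofReal (|β| * j * 2 ^ j * |a| * (‖ξ‖ * ‖W ξ‖)))
  (fun ξ => ENNReal.ofReal (|β| * j * 2 ^ j * |a| ^ j * (‖ξ‖ ^ j * ‖W ξ‖)))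
  (fun v => ENNReal.ofReal (((R + ‖v‖) ^ j)⁻¹))

theorem exists_kerDConst_lt (a β : ℝ) {j : ℕ} (hj : d < 2 * j) {W : Space d → ℂ}
    (hW : Dec j W) (hW1 : Integrable (fun ξ => ‖ξ‖ * ‖W ξ‖)) {δ : ℝ≥0∞} (hδ : 0 < δ) :
    ∃ R : ℝ, 1 ≤ R ∧ kerDConst a β W j R < δ := by
  obtain ⟨N, hN⟩ := ((tendsto_kerConst_kerD a β hj hW hW1).eventually_lt_const hδ).exists
  exact ⟨N + 1, by linarith [(Nat.cast_nonneg N : (0 : ℝ) ≤ N)], hN⟩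

/-- Conjugation of `opK` with the weight. -/
theorem weight_mul_opK {a β : ℝ} (ha : a ≠ 0) {W : Space d → ℂ} (hm : Measurable W)
    (hW : Integrable W) {j : ℕ} (hj : j ≠ 0) {R : ℝ} (hR : 0 < R) (hC : kerDConst a β W j R < ⊤)
    {U : Phase d → ℝ} (hUm : Measurable U) (hU : MemLp U 2) :
    ∀ᵐ p : Phase d, (R + ‖p.2‖) ^ j * opK a β W (fun p => U p / (R + ‖p.2‖) ^ j) p
      = opK a β W U p + kint a (kerD a β W j R) U p := by
  filter_upwards [(kerBd_ker a β hm).integrable ha (kerConst_ker_lt_top a β hW) hUm hU,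
    (kerBd_kerD a β hm hj hR).integrable ha hC hUm hU] with p h1 h2
  simp only [opK, kint]
  rw [← integral_add h1 h2, ← integral_const_mul]
  congr 1; ext ξ
  have : (R + ‖p.2 + a • ξ‖) ^ j ≠ 0 := by positivity
  simp only [kerD]
  field_simp
  ring

theorem norm_weight_mul {R : ℝ} (hR : 0 ≤ R) (v : Space d) (j : ℕ) (x : ℝ) :
    ‖(R + ‖v‖) ^ j * x‖ = (R + ‖v‖) ^ j * ‖x‖ := by
  rw [norm_mul, Real.norm_of_nonneg (by positivity)]

theorem memY_iff {j : ℕ} {R : ℝ} (hR : 1 ≤ R) {w : Phase d → ℝ} :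
    MemY j w ↔ MemLp (fun p => (R + ‖p.2‖) ^ j * w p) 2 := by
  constructor
  · intro h
    have e : (fun p : Phase d => (R + ‖p.2‖) ^ j * w p) = fun p =>
        ((R + ‖p.2‖) ^ j / (1 + ‖p.2‖) ^ j) * ((1 + ‖p.2‖) ^ j * w p) := by
      ext p
      have : (1 + ‖p.2‖) ^ j ≠ 0 := by positivity
      field_simp
    rw [e]
    refine h.of_le_mul (c := R ^ j) ?_ (Eventually.of_forall fun p => ?_)
    · exact (Measurable.aestronglyMeasurable (by fun_prop)).mul h.1
    · rw [norm_mul, Real.norm_of_nonneg (by positivity)]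
      gcongr
      rw [div_le_iff₀ (by positivity), ← mul_pow]
      gcongr
      nlinarith [norm_nonneg p.2]
  · intro h
    have e : (fun p : Phase d => (1 + ‖p.2‖) ^ j * w p) = fun p =>
        ((1 + ‖p.2‖) ^ j / (R + ‖p.2‖) ^ j) * ((R + ‖p.2‖) ^ j * w p) := by
      ext p
      have : (R + ‖p.2‖) ^ j ≠ 0 := by positivity
      field_simp
    unfold MemY
    rw [e]
    refine h.of_le_mul (c := 1) ?_ (Eventually.of_forall fun p => ?_)
    · exact (Measurable.aestronglyMeasurable (by fun_prop)).mul h.1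
    · rw [norm_mul, Real.norm_of_nonneg (by positivity)]
      gcongr
      rw [div_le_one (by positivity)]
      gcongr

theorem eLpNorm_weight_le {j : ℕ} {R : ℝ} (hR : 1 ≤ R) (w : Phase d → ℝ) :
    eLpNorm (fun p => (1 + ‖p.2‖) ^ j * w p) 2 volume
      ≤ eLpNorm (fun p => (R + ‖p.2‖) ^ j * w p) 2 volume ∧
    eLpNorm (fun p => (R + ‖p.2‖) ^ j * w p) 2 volume
      ≤ ENNReal.ofReal (R ^ j) * eLpNorm (fun p => (1 + ‖p.2‖) ^ j * w p) 2 volume := by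
  constructor
  · refine eLpNorm_mono fun p => ?_
    rw [norm_weight_mul zero_le_one, norm_weight_mul (by linarith)]
    gcongr
  · refine eLpNorm_le_mul_eLpNorm_of_ae_le_mul (Eventually.of_forall fun p => ?_) 2
    rw [norm_weight_mul zero_le_one, norm_weight_mul (by linarith), ← mul_assoc, ← mul_pow]
    gcongr
    nlinarith [norm_nonneg p.2]

theorem MemY.aestronglyMeasurable {j : ℕ} {w : Phase d → ℝ} (h : MemY j w) :
    AEStronglyMeasurable w volume := by
  have e : w = fun p : Phase d => ((1 + ‖p.2‖) ^ j)⁻¹ * ((1 + ‖p.2‖) ^ j * w p) := by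
    ext p
    have : (1 + ‖p.2‖) ^ j ≠ 0 := by positivity
    field_simp
  rw [e]
  exact (Measurable.aestronglyMeasurable (by fun_prop)).mul h.1

theorem MemY.mono {i j : ℕ} (hij : i ≤ j) {w : Phase d → ℝ} (h : MemY j w) : MemY i w := by
  refine MemLp.mono h ((Measurable.aestronglyMeasurable (by fun_prop)).mul h.aestronglyMeasurable)
    (Eventually.of_forall fun p => ?_)
  rw [norm_weight_mul zero_le_one, norm_weight_mul zero_le_one]
  gcongr
  simp

theorem MemY.memLp {j : ℕ} {w : Phase d → ℝ} (h : MemY j w) : MemLp w 2 := by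
  have := h.mono (Nat.zero_le j)
  simpa only [MemY, pow_zero, one_mul] using! this

theorem MemY.congr {j : ℕ} {w w' : Phase d → ℝ} (h : MemY j w) (hw : w =ᵐ[volume] w') :
    MemY j w' :=
  (memLp_congr_ae (hw.mono fun p hp => by simp only [hp])).1 h

theorem MemY.add {j : ℕ} {w w' : Phase d → ℝ} (h : MemY j w) (h' : MemY j w') :
    MemY j (fun p => w p + w' p) := by
  have := MemLp.add h h'
  simpa only [MemY, mul_add] using! this

theorem MemY.const_mul {j : ℕ} {w : Phase d → ℝ} (h : MemY j w) (c : ℝ) :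
    MemY j (fun p => c * w p) := by
  have := MemLp.const_mul h c
  simpa only [MemY, mul_left_comm] using! this

theorem MemY.sum {ι : Type*} (s : Finset ι) {j : ℕ} {w : ι → Phase d → ℝ}
    (h : ∀ i ∈ s, MemY j (w i)) : MemY j (fun p => ∑ i ∈ s, w i p) := by
  have := memLp_finsetSum s h
  simpa only [MemY, Finset.mul_sum] using! this

theorem MemY.coord_mul {j : ℕ} {w : Phase d → ℝ} (h : MemY (j + 1) w) (i : Fin d) :
    MemY j (fun p => p.2 i * w p) := by
  refine MemLp.mono h ((Measurable.aestronglyMeasurable (by fun_prop)).mul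
    ((Measurable.aestronglyMeasurable (by fun_prop)).mul h.aestronglyMeasurable))
    (Eventually.of_forall fun p => ?_)
  rw [norm_weight_mul zero_le_one, norm_weight_mul zero_le_one, norm_mul, pow_succ, mul_assoc]
  gcongr
  have := abs_coord_le p.2 i
  rw [Real.norm_eq_abs]
  linarith

theorem opK_memY {a β : ℝ} (ha : a ≠ 0) {W : Space d → ℂ} (hW : Integrable W)
    (hW1 : Integrable (fun ξ => ‖ξ‖ * ‖W ξ‖)) {j : ℕ} (hj : d < 2 * j) (hD : Dec j W)
    {u : Phase d → ℝ} (hu : MemY j u) : MemY j (opK a β W u) := by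
  -- Boundedness of `Θ` in the weighted space only needs a finite commutator constant, so `δ = ⊤` is
  -- enough.
  obtain ⟨R, hR, hC⟩ := exists_kerDConst_lt a β hj hD hW1 (δ := ⊤) (by simp)
  have hR0 : 0 < R := by linarith
  have hj0 : j ≠ 0 := by omega
  have h := (memY_iff hR).1 hu
  set U : L2P d := h.toLp _ with hUdef
  have hUm := (Lp.stronglyMeasurable U).measurable
  have hU := Lp.memLp U
  have hu' : (fun p : Phase d => U p / (R + ‖p.2‖) ^ j) =ᵐ[volume] u := by
    filter_upwards [h.coeFn_toLp] with p hp
    rw [hp]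
    have : (R + ‖p.2‖) ^ j ≠ 0 := by positivity
    field_simp
  rw [memY_iff hR]
  have m1 := ((kerBd_ker a β hD.1).memLp ha (kerConst_ker_lt_top a β hW) hUm hU).1
  have m2 := ((kerBd_kerD a β hD.1 hj0 hR0).memLp ha hC hUm hU).1
  refine (memLp_congr_ae ?_).1 (m1.add m2)
  filter_upwards [weight_mul_opK ha hD.1 hW hj0 hR0 hC hUm hU, opK_congr ha β W hu'] with p h1 h2
  rw [← h2, h1]
  rfl

/-- Solvability of `ν w - Θ w = s` in weighted spaces. -/
theorem exists_resolvent {a β ν : ℝ} (ha : a ≠ 0) (hν : 0 < ν) {W : Space d → ℂ}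
    (hW : Integrable W) (hW1 : Integrable (fun ξ => ‖ξ‖ * ‖W ξ‖)) (hH : Herm W) {j : ℕ}
    (hj : d < 2 * j) (hD : Dec j W) :
    ∃ C : ℝ≥0∞, C ≠ ⊤ ∧ ∀ s : Phase d → ℝ, MemY j s → ∃ w : Phase d → ℝ, Measurable w ∧ MemY j w ∧
      SolvesK a β ν W w s ∧ eLpNorm (fun p => (1 + ‖p.2‖) ^ j * w p) 2 volume
        ≤ C * eLpNorm (fun p => (1 + ‖p.2‖) ^ j * s p) 2 volume := by
  -- The Young constant bounds the square of the operator norm. With the commutator bounded by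
  -- `ν/2`, half of the coercivity constant `ν` survives.
  obtain ⟨R, hR, hC⟩ := exists_kerDConst_lt a β hj hD hW1 (δ := ENNReal.ofReal ((ν / 2) ^ 2))
    (by rw [ENNReal.ofReal_pos]; positivity)
  have hC' : kerDConst a β W j R < ⊤ := hC.trans ENNReal.ofReal_lt_top
  have hR0 : 0 < R := by linarith
  have hj0 : j ≠ 0 := by omega
  obtain ⟨T, hT⟩ := exists_clm_opK ha β hW hD.1
  obtain ⟨D, hDT, hDn⟩ := (kerBd_kerD a β hD.1 hj0 hR0).exists_clm ha hC'
  have hDn' : ‖D‖ ≤ ν / 2 := by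
    refine le_of_sq_le_sq (hDn.trans ?_) (by positivity)
    exact ENNReal.toReal_le_of_le_ofReal (by positivity) hC.le
  refine ⟨ENNReal.ofReal (ν / 2)⁻¹ * ENNReal.ofReal (R ^ j), by finiteness, fun s hs => ?_⟩
  have h := (memY_iff hR).1 hs
  -- The unknown is `U = (R + |v|)^j w`, for which the equation reads `(ν - Θ - D)U = (R + |v|)^j s`
  -- in unweighted L². No invariant subspace is needed here, hence `⊤`.
  obtain ⟨U, -, hU, hUn⟩ := exists_solution_of_coercive
    (ν • ContinuousLinearMap.id ℝ (L2P d) - T - D) (c := ν / 2) (by positivity) (fun x => by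
      have e1 := inner_opK_self ha hW hD.1 hH hT x
      have e2 : inner ℝ (D x) x ≤ ν / 2 * ‖x‖ ^ 2 := by
        calc _ ≤ ‖D x‖ * ‖x‖ := real_inner_le_norm _ _
          _ ≤ (‖D‖ * ‖x‖) * ‖x‖ := by gcongr; exact D.le_opNorm x
          _ ≤ (ν / 2 * ‖x‖) * ‖x‖ := by gcongr
          _ = _ := by ring
      have e3 : inner ℝ ((ν • ContinuousLinearMap.id ℝ (L2P d) - T - D) x) x
          = ν * ‖x‖ ^ 2 - inner ℝ (T x) x - inner ℝ (D x) x := by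
        rw [show (ν • ContinuousLinearMap.id ℝ (L2P d) - T - D) x = ν • x - T x - D x from rfl,
          inner_sub_left, inner_sub_left, real_inner_smul_left, real_inner_self_eq_norm_sq]
      rw [e3, e1]
      linarith) ⊤ isClosed_univ (fun _ _ => trivial) (s := h.toLp _) trivial
  have hUm := (Lp.stronglyMeasurable U).measurable
  have hUL := Lp.memLp U
  have hw : (fun p : Phase d => (R + ‖p.2‖) ^ j * (U p / (R + ‖p.2‖) ^ j)) = U := by
    ext p
    have : (R + ‖p.2‖) ^ j ≠ 0 := by positivity
    field_simp
  refine ⟨fun p => U p / (R + ‖p.2‖) ^ j, by fun_prop, ?_, ?_, ?_⟩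
  · rw [memY_iff hR, hw]
    exact hUL
  · have e : ν • U - T U - D U = h.toLp _ := hU
    have e' : (fun p => ν * U p - opK a β W U p - kint a (kerD a β W j R) U p)
        =ᵐ[volume] fun p => (R + ‖p.2‖) ^ j * s p := by
      refine EventuallyEq.trans ?_ h.coeFn_toLp
      rw [← e]
      filter_upwards [Lp.coeFn_sub (ν • U - T U) (D U), Lp.coeFn_sub (ν • U) (T U),
        Lp.coeFn_smul ν U, hT U, hDT U] with p h1 h2 h3 h4 h5
      rw [h1, Pi.sub_apply, h2, Pi.sub_apply, h3, h4, h5]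
      rfl
    unfold SolvesK
    filter_upwards [e', weight_mul_opK ha hD.1 hW hj0 hR0 hC' hUm hUL] with p h1 h2
    have hp : (R + ‖p.2‖) ^ j ≠ 0 := by positivity
    refine mul_left_cancel₀ hp ?_
    rw [← h1, mul_sub, h2]
    field_simp
    ring
  · refine (eLpNorm_weight_le hR _).1.trans ?_
    rw [hw, mul_assoc]
    refine le_trans ?_ (mul_le_mul_right (eLpNorm_weight_le hR s).2 _)
    have e1 : eLpNorm U 2 volume = ENNReal.ofReal ‖U‖ := by
      rw [Lp.norm_def, ENNReal.ofReal_toReal hUL.2.ne]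
    have e2 : eLpNorm (fun p : Phase d => (R + ‖p.2‖) ^ j * s p) 2 volume
        = ENNReal.ofReal ‖(h.toLp _ : L2P d)‖ := by
      rw [Lp.norm_toLp, ENNReal.ofReal_toReal h.2.ne]
    rw [e1, e2, ← ENNReal.ofReal_mul (by positivity)]
    refine ENNReal.ofReal_le_ofReal ?_
    rw [inv_mul_eq_div, le_div_iff₀' (by positivity)]
    exact hUn

/-! ### Weak derivatives in position on phase space -/

/-- The position derivative `∂_{x_j}` of a test function on phase space. -/
def dX (j : Fin d) (Φ : Phase d → ℝ) (p : Phase d) : ℝ :=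
  fderiv ℝ Φ p (EuclideanSpace.single j 1, 0)

/-- `y` is the weak derivative `∂_{x_j} w` on phase space. -/
def IsWeakX (j : Fin d) (w y : Phase d → ℝ) : Prop :=
  ∀ Φ : Phase d → ℝ, IsTest Φ → ∫ p, y p * Φ p = -∫ p, w p * dX j Φ p

theorem IsTest.dX {Φ : Phase d → ℝ} (h : IsTest Φ) (j : Fin d) : IsTest (dX j Φ) :=
  ⟨(h.1.fderiv_right (m := ∞) (by simp)).clm_apply contDiff_const, h.2.fderiv_apply (𝕜 := ℝ) _⟩

theorem IsTest.memLp {Φ : Phase d → ℝ} (h : IsTest Φ) : MemLp Φ 2 :=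
  h.continuous.memLp_of_hasCompactSupport h.2

theorem IsTest.memLp_space {χ : Space d → ℝ} (h : IsTest χ) : MemLp χ 2 :=
  h.continuous.memLp_of_hasCompactSupport h.2

theorem integrable_mul_test {w : Phase d → ℝ} (hw : MemLp w 2) {Φ : Phase d → ℝ} (h : IsTest Φ) :
    Integrable (fun p => w p * Φ p) :=
  hw.integrable_mul h.memLp

theorem IsWeakX.congr {j : Fin d} {w w' y y' : Phase d → ℝ} (h : IsWeakX j w y)
    (hw : w =ᵐ[volume] w') (hy : y =ᵐ[volume] y') : IsWeakX j w' y' := by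
  intro Φ hΦ
  have e1 : ∫ p, y' p * Φ p = ∫ p, y p * Φ p :=
    integral_congr_ae (hy.mono fun p hp => by simp only [hp])
  have e2 : ∫ p, w' p * dX j Φ p = ∫ p, w p * dX j Φ p :=
    integral_congr_ae (hw.mono fun p hp => by simp only [hp])
  rw [e1, e2, h Φ hΦ]

theorem IsWeakX.add {j : Fin d} {w w' y y' : Phase d → ℝ} (h : IsWeakX j w y)
    (h' : IsWeakX j w' y') (hw : MemLp w 2) (hw' : MemLp w' 2) (hy : MemLp y 2)
    (hy' : MemLp y' 2) : IsWeakX j (fun p => w p + w' p) (fun p => y p + y' p) := by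
  intro Φ hΦ
  simp only [add_mul]
  rw [integral_add (integrable_mul_test hy hΦ) (integrable_mul_test hy' hΦ),
    integral_add (integrable_mul_test hw (hΦ.dX j)) (integrable_mul_test hw' (hΦ.dX j)),
    h Φ hΦ, h' Φ hΦ]
  ring

theorem IsWeakX.const_mul {j : Fin d} {w y : Phase d → ℝ} (h : IsWeakX j w y) (c : ℝ) :
    IsWeakX j (fun p => c * w p) (fun p => c * y p) := by
  intro Φ hΦ
  simp only [mul_assoc, integral_const_mul]
  rw [h Φ hΦ]
  ring

theorem IsWeakX.sum {ι : Type*} (s : Finset ι) {j : Fin d} {w y : ι → Phase d → ℝ}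
    (h : ∀ i ∈ s, IsWeakX j (w i) (y i)) (hw : ∀ i ∈ s, MemLp (w i) 2)
    (hy : ∀ i ∈ s, MemLp (y i) 2) :
    IsWeakX j (fun p => ∑ i ∈ s, w i p) (fun p => ∑ i ∈ s, y i p) := by
  intro Φ hΦ
  simp only [Finset.sum_mul]
  rw [integral_finsetSum _ fun i hi => integrable_mul_test (hy i hi) hΦ,
    integral_finsetSum _ fun i hi => integrable_mul_test (hw i hi) (hΦ.dX j),
    ← Finset.sum_neg_distrib]
  exact Finset.sum_congr rfl fun i hi => h i hi Φ hΦ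

theorem dX_mul {Φ f : Phase d → ℝ} (hf : Differentiable ℝ f) (hΦ : IsTest Φ) (j : Fin d)
    (p : Phase d) : dX j (fun p => f p * Φ p) p = dX j f p * Φ p + f p * dX j Φ p := by
  simp only [dX]
  rw [fderiv_fun_mul hf.differentiableAt hΦ.differentiable.differentiableAt]
  simp
  ring

theorem dX_comp_fst {f : Space d → ℝ} (hf : Differentiable ℝ f) (j : Fin d) (p : Phase d) :
    dX j (fun p => f p.1) p = partialD j f p.1 := by
  have h : HasFDerivAt (fun p : Phase d => f p.1)
      ((fderiv ℝ f p.1).comp (ContinuousLinearMap.fst ℝ (Space d) (Space d))) p :=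
    (hf.differentiableAt.hasFDerivAt).comp p hasFDerivAt_fst
  simp only [dX, partialD]
  rw [h.fderiv]
  rfl

theorem dX_comp_snd {f : Space d → ℝ} (hf : Differentiable ℝ f) (j : Fin d) (p : Phase d) :
    dX j (fun p => f p.2) p = 0 := by
  have h : HasFDerivAt (fun p : Phase d => f p.2)
      ((fderiv ℝ f p.2).comp (ContinuousLinearMap.snd ℝ (Space d) (Space d))) p :=
    (hf.differentiableAt.hasFDerivAt).comp p hasFDerivAt_snd
  simp only [dX]
  rw [h.fderiv]
  simp

theorem IsWeakX.coord_mul {j : Fin d} {w y : Phase d → ℝ} (h : IsWeakX j w y) (i : Fin d) :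
    IsWeakX j (fun p => p.2 i * w p) (fun p => p.2 i * y p) := by
  intro Φ hΦ
  have hc : ContDiff ℝ ∞ (fun v : Space d => v i) := contDiff_piLp_apply 2
  have hd : Differentiable ℝ (fun v : Space d => v i) := hc.differentiable (by simp)
  have hd2 : Differentiable ℝ (fun p : Phase d => p.2 i) := hd.comp differentiable_snd
  have ht : IsTest (fun p : Phase d => p.2 i * Φ p) :=
    ⟨(hc.comp contDiff_snd).mul hΦ.1, hΦ.2.mul_left⟩
  have e := h _ ht
  have e2 : ∀ p, dX j (fun p : Phase d => p.2 i * Φ p) p = p.2 i * dX j Φ p := fun p => by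
    rw [dX_mul hd2 hΦ, dX_comp_snd hd]
    ring
  simp only [e2] at e
  have e3 : ∀ p, p.2 i * y p * Φ p = y p * (p.2 i * Φ p) := fun p => by ring
  have e4 : ∀ p, p.2 i * w p * dX j Φ p = w p * (p.2 i * dX j Φ p) := fun p => by ring
  simp only [e3, e4, e]

theorem IsTest.shift {Φ : Phase d → ℝ} (h : IsTest Φ) (c : Phase d) :
    IsTest (fun p => Φ (p + c)) :=
  ⟨h.1.comp (contDiff_id.add contDiff_const), h.2.comp_homeomorph (Homeomorph.addRight c)⟩

theorem dX_shift {Φ : Phase d → ℝ} (j : Fin d) (c p : Phase d) :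
    dX j (fun p => Φ (p + c)) p = dX j Φ (p + c) := by
  simp only [dX, fderiv_comp_add_right]

/-- Moves the velocity shift onto the test function, so that for each fixed `ξ` the function `u` is
paired with an honest test function. -/
theorem integral_opK_mul_test {a : ℝ} (ha : a ≠ 0) (β : ℝ) {W : Space d → ℂ} (hW : Integrable W)
    (hm : Measurable W) {u : Phase d → ℝ} (hum : Measurable u) (hu : MemLp u 2) {Φ : Phase d → ℝ}
    (hΦ : IsTest Φ) :
    Integrable (fun ξ : Space d => ∫ p : Phase d, u p * (ker β W p.1 ξ * Φ (p + (0, -(a • ξ))))) ∧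
    ∫ p, opK a β W u p * Φ p
      = ∫ ξ : Space d, ∫ p : Phase d, u p * (ker β W p.1 ξ * Φ (p + (0, -(a • ξ)))) := by
  have h := (kerBd_ker a β hm).integral_kint_mul ha (kerConst_ker_lt_top a β hW) hum hu
    hΦ.continuous.measurable hΦ.memLp
  have e : ∀ ξ : Space d, ∫ p : Phase d, ker β W p.1 ξ * u (p.1, p.2 + a • ξ) * Φ p
      = ∫ p : Phase d, u p * (ker β W p.1 ξ * Φ (p + (0, -(a • ξ)))) := fun ξ => by
    rw [← integral_comp_shift (a • ξ)
      (fun p : Phase d => u p * (ker β W p.1 ξ * Φ (p + (0, -(a • ξ)))))]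
    congr 1; ext p
    have : ((p.1, p.2 + a • ξ) : Phase d) + (0, -(a • ξ)) = p := by
      ext <;> simp
    rw [this]
    ring
  simp only [e] at h
  exact h

/-- `∂_j (Θ[V] w) = Θ[V] ∂_j w + Θ[∂_j V] w`. -/
theorem IsWeakX.opK {a : ℝ} (ha : a ≠ 0) (β : ℝ) {W : Space d → ℂ} (hW : Integrable W)
    (hm : Measurable W) {j : Fin d} (hdW : Integrable (dW j W)) {w y : Phase d → ℝ}
    (hwm : Measurable w) (hw : MemLp w 2) (hym : Measurable y) (hy : MemLp y 2)
    (h : IsWeakX j w y) :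
    IsWeakX j (opK a β W w) (fun p => opK a β W y p + opK a β (HighField.dW j W) w p) := by
  intro Φ hΦ
  have hmd := measurable_dW hm j
  have i1 : MemLp (HighField.opK a β W y) 2 :=
    ((kerBd_ker a β hm).memLp ha (kerConst_ker_lt_top a β hW) hym hy).1
  have i2 : MemLp (HighField.opK a β (HighField.dW j W) w) 2 :=
    ((kerBd_ker a β hmd).memLp ha (kerConst_ker_lt_top a β hdW) hwm hw).1
  have c1 := integral_opK_mul_test ha β hW hm hym hy hΦ
  have c2 := integral_opK_mul_test ha β hdW hmd hwm hw hΦ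
  have c3 := integral_opK_mul_test ha β hW hm hwm hw (hΦ.dX j)
  simp only [add_mul]
  rw [integral_add (integrable_mul_test i1 hΦ) (integrable_mul_test i2 hΦ), c1.2, c2.2, c3.2,
    ← integral_add c1.1 c2.1, ← integral_neg]
  congr 1; ext ξ
  have hkd : Differentiable ℝ (fun p : Phase d => ker β W p.1 ξ) :=
    ((contDiff_ker β W ξ).differentiable (by simp)).comp differentiable_fst
  have hs := hΦ.shift (0, -(a • ξ))
  have hs' := (hΦ.dX j).shift (0, -(a • ξ))
  have ht : IsTest (fun p : Phase d => ker β W p.1 ξ * Φ (p + (0, -(a • ξ)))) :=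
    ⟨((contDiff_ker β W ξ).comp contDiff_fst).mul hs.1, hs.2.mul_left⟩
  have ht1 : IsTest (fun p : Phase d => ker β (HighField.dW j W) p.1 ξ * Φ (p + (0, -(a • ξ)))) :=
    ⟨((contDiff_ker β _ ξ).comp contDiff_fst).mul hs.1, hs.2.mul_left⟩
  have ht2 : IsTest (fun p : Phase d => ker β W p.1 ξ * HighField.dX j Φ (p + (0, -(a • ξ)))) :=
    ⟨((contDiff_ker β W ξ).comp contDiff_fst).mul hs'.1, hs'.2.mul_left⟩
  -- For fixed `ξ` the weak derivative is tested with kernel times shifted `Φ`. By the product rule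
  -- `∂_j` falls on `Φ`, or on the kernel, where it replaces `W` by `dW j W`.
  rw [h _ ht, neg_add_eq_iff_eq_add, ← sub_eq_add_neg, eq_sub_iff_add_eq,
    ← integral_add (integrable_mul_test hw ht1) (integrable_mul_test hw ht2)]
  congr 1; ext p
  rw [dX_mul hkd hs, dX_shift,
    dX_comp_fst ((contDiff_ker β W ξ).differentiable (by simp)), partialD_ker]
  ring

/-- The families `φ`, `φ'` encode the graph of a closed operator, in the application `y = ∂_j w`.
The differentiated equation couples to the original one through `T1`, giving a triangular block
system on pairs `(w, y)`. After rescaling the first component the block operator is coercive. The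
rescaled graph is closed, and by `hinv` it is invariant, so the coercive solution lies in it. -/
theorem exists_solution_in_graph {H ι : Type*} [NormedAddCommGroup H] [InnerProductSpace ℝ H]
    [CompleteSpace H] (T T1 : H →L[ℝ] H) {ν : ℝ} (hν : 0 < ν)
    (hT : ∀ u, inner ℝ (T u) u = 0) (φ φ' : ι → H)
    (hinv : ∀ w y, (∀ i, inner ℝ (φ i) y = -inner ℝ (φ' i) w) →
      ∀ i, inner ℝ (φ i) (T y + T1 w) = -inner ℝ (φ' i) (T w)) {s sj : H}
    (hs : ∀ i, inner ℝ (φ i) sj = -inner ℝ (φ' i) s) :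
    ∃ w y, (∀ i, inner ℝ (φ i) y = -inner ℝ (φ' i) w) ∧ ν • w - T w = s ∧
      ν • y - T y = sj + T1 w := by
  -- The unknown is `q = (lam⁻¹ w, y)`, which multiplies the coupling by `lam`. Since `lam ‖T1‖ ≤
  -- ν`, the cross term is at most `ν‖q₁‖‖q₂‖`, and coercivity with constant `ν/2` remains.
  set lam : ℝ := ν / (1 + ‖T1‖) with hlam
  have hl0 : 0 < lam := by positivity
  have hlT : lam * ‖T1‖ ≤ ν := by
    rw [hlam, div_mul_eq_mul_div, div_le_iff₀ (by positivity)]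
    nlinarith [norm_nonneg T1]
  let e := WithLp.prodContinuousLinearEquiv 2 ℝ H H
  let F : WithLp 2 (H × H) →L[ℝ] H :=
    (ContinuousLinearMap.fst ℝ _ _).comp (e : WithLp 2 (H × H) →L[ℝ] H × H)
  let S : WithLp 2 (H × H) →L[ℝ] H :=
    (ContinuousLinearMap.snd ℝ _ _).comp (e : WithLp 2 (H × H) →L[ℝ] H × H)
  let N : H →L[ℝ] H := ν • ContinuousLinearMap.id ℝ H - T
  let B : WithLp 2 (H × H) →L[ℝ] WithLp 2 (H × H) :=
    (e.symm : H × H →L[ℝ] WithLp 2 (H × H)).comp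
      ((N.comp F).prod (N.comp S - lam • T1.comp F))
  have hN : ∀ u, inner ℝ (N u) u = ν * ‖u‖ ^ 2 := fun u => by
    have : N u = ν • u - T u := rfl
    rw [this, inner_sub_left, hT, real_inner_smul_left, real_inner_self_eq_norm_sq, sub_zero]
  have eF : ∀ q, F (B q) = ν • F q - T (F q) := fun _ => rfl
  have eS : ∀ q, S (B q) = (ν • S q - T (S q)) - lam • T1 (F q) := fun _ => rfl
  have hB : ∀ q, ν / 2 * ‖q‖ ^ 2 ≤ inner ℝ (B q) q := fun q => by
    have e1 : inner ℝ (B q) q = inner ℝ (N q.fst) q.fst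
        + inner ℝ (N q.snd - lam • T1 q.fst) q.snd := WithLp.prod_inner_apply _ _
    rw [e1, inner_sub_left, hN, hN, WithLp.prod_norm_sq_eq_of_L2, real_inner_smul_left]
    have h1 : inner ℝ (T1 q.fst) q.snd ≤ ‖T1‖ * ‖q.fst‖ * ‖q.snd‖ :=
      (real_inner_le_norm _ _).trans (by gcongr; exact T1.le_opNorm _)
    have h2 : lam * inner ℝ (T1 q.fst) q.snd ≤ lam * (‖T1‖ * ‖q.fst‖ * ‖q.snd‖) := by gcongr
    have h3 : lam * (‖T1‖ * ‖q.fst‖ * ‖q.snd‖) ≤ ν * (‖q.fst‖ * ‖q.snd‖) := by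
      calc _ = (lam * ‖T1‖) * (‖q.fst‖ * ‖q.snd‖) := by ring
        _ ≤ _ := by gcongr
    nlinarith [sq_nonneg (‖q.fst‖ - ‖q.snd‖)]
  let G : Submodule ℝ (WithLp 2 (H × H)) :=
    { carrier := {q | ∀ i, inner ℝ (φ i) (S q) = -(lam * inner ℝ (φ' i) (F q))}
      add_mem' := fun {q q'} hq hq' i => by
        rw [map_add, map_add, inner_add_right, inner_add_right, hq i, hq' i]
        ring
      zero_mem' := fun i => by simp
      smul_mem' := fun c q hq i => by
        rw [map_smul, map_smul, real_inner_smul_right, real_inner_smul_right, hq i]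
        ring }
  have hG : ∀ q, q ∈ G ↔ ∀ i, inner ℝ (φ i) (S q) = -(lam * inner ℝ (φ' i) (F q)) :=
    fun _ => Iff.rfl
  have hGc : IsClosed (G : Set (WithLp 2 (H × H))) := by
    have : (G : Set (WithLp 2 (H × H))) = ⋂ i, {q |
        inner ℝ (φ i) (S q) = -(lam * inner ℝ (φ' i) (F q))} := by
      ext q
      simp only [Set.mem_iInter]
      rfl
    rw [this]
    refine isClosed_iInter fun i => isClosed_eq ?_ ?_
    · exact continuous_const.inner S.continuous
    · exact (continuous_const.mul (continuous_const.inner F.continuous)).neg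
  have hG' : ∀ q, q ∈ G ↔ ∀ i, inner ℝ (φ i) (S q) = -inner ℝ (φ' i) (lam • F q) := fun q => by
    simp only [hG, real_inner_smul_right]
  have hGB : ∀ q ∈ G, B q ∈ G := fun q hq => by
    have h := hinv _ _ ((hG' q).1 hq)
    rw [hG'] at hq ⊢
    intro i
    have h1 := h i
    have h2 := hq i
    rw [eF, eS]
    simp only [map_smul, inner_add_right, inner_sub_right, real_inner_smul_right] at h1 h2 ⊢
    rw [h2]
    linear_combination -h1
  have hs0 : e.symm (lam⁻¹ • s, sj) ∈ G := by
    rw [hG']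
    have e1 : F (e.symm (lam⁻¹ • s, sj)) = lam⁻¹ • s := rfl
    have e2 : S (e.symm (lam⁻¹ • s, sj)) = sj := rfl
    rw [e1, e2, smul_inv_smul₀ hl0.ne']
    exact hs
  obtain ⟨q, hqG, hq, -⟩ := exists_solution_of_coercive B (by positivity) hB G hGc hGB hs0
  have q1 : ν • F q - T (F q) = lam⁻¹ • s := (eF q).symm.trans (by rw [hq]; rfl)
  have q2 : (ν • S q - T (S q)) - lam • T1 (F q) = sj := (eS q).symm.trans (by rw [hq]; rfl)
  refine ⟨lam • F q, S q, (hG' q).1 hqG, ?_, ?_⟩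
  · rw [map_smul, smul_comm, ← smul_sub, q1, smul_inv_smul₀ hl0.ne']
  · rw [map_smul, ← q2, sub_add_cancel]

theorem IsTest.inner_toLp {Φ : Phase d → ℝ} (hΦ : IsTest Φ) (u : L2P d) :
    inner ℝ (hΦ.memLp.toLp Φ : L2P d) u = ∫ p, u p * Φ p := by
  rw [L2.inner_def]
  refine integral_congr_ae ?_
  filter_upwards [hΦ.memLp.coeFn_toLp] with p hp
  rw [hp]
  simp

/-- Applies `exists_solution_in_graph` to the graph of `∂_{x_j}`, described by all test functions.
Its invariance is the product rule `IsWeakX.opK`. -/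
theorem exists_weakX_resolvent {a β ν : ℝ} (ha : a ≠ 0) (hν : 0 < ν) {W : Space d → ℂ}
    (hW : Integrable W) (hm : Measurable W) (hH : Herm W) {j : Fin d} (hdW : Integrable (dW j W))
    {s sj : Phase d → ℝ} (hs : MemLp s 2) (hsj : MemLp sj 2) (hS : IsWeakX j s sj) :
    ∃ w y : Phase d → ℝ, MemLp w 2 ∧ MemLp y 2 ∧ IsWeakX j w y ∧ SolvesK a β ν W w s ∧
      SolvesK a β ν W y (fun p => sj p + opK a β (dW j W) w p) := by
  have hmd := measurable_dW hm j
  obtain ⟨T, hT⟩ := exists_clm_opK ha β hW hm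
  obtain ⟨T1, hT1⟩ := exists_clm_opK ha β hdW hmd
  have hG : ∀ w y : L2P d, (∀ i : {Φ : Phase d → ℝ // IsTest Φ},
      inner ℝ (i.2.memLp.toLp i.1 : L2P d) y = -inner ℝ ((i.2.dX j).memLp.toLp _ : L2P d) w)
      ↔ IsWeakX j w y := fun w y => by
    constructor
    · intro h Φ hΦ
      have := h ⟨Φ, hΦ⟩
      rwa [hΦ.inner_toLp, (hΦ.dX j).inner_toLp] at this
    · intro h i
      rw [i.2.inner_toLp, (i.2.dX j).inner_toLp]
      exact h i.1 i.2
  obtain ⟨w, y, h1, h2, h3⟩ := exists_solution_in_graph T T1 hν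
    (inner_opK_self ha hW hm hH hT)
    (fun i : {Φ : Phase d → ℝ // IsTest Φ} => (i.2.memLp.toLp i.1 : L2P d))
    (fun i => ((i.2.dX j).memLp.toLp _ : L2P d))
    (s := hs.toLp s) (sj := hsj.toLp sj)
    (fun w y h => by
      rw [hG] at h ⊢
      refine (IsWeakX.opK ha β hW hm hdW (Lp.stronglyMeasurable w).measurable (Lp.memLp w)
        (Lp.stronglyMeasurable y).measurable (Lp.memLp y) h).congr (hT w).symm ?_
      filter_upwards [Lp.coeFn_add (T y) (T1 w), hT y, hT1 w] with p e1 e2 e3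
      rw [e1, Pi.add_apply, e2, e3])
    ((hG _ _).2 (hS.congr hs.coeFn_toLp.symm hsj.coeFn_toLp.symm))
  refine ⟨w, y, Lp.memLp w, Lp.memLp y, (hG w y).1 h1, ?_, ?_⟩
  · unfold SolvesK
    filter_upwards [Lp.coeFn_sub (ν • w) (T w), Lp.coeFn_smul ν w, hT w, hs.coeFn_toLp]
      with p e1 e2 e3 e4
    rw [← e4, ← h2, e1, Pi.sub_apply, e2, e3, Pi.smul_apply, smul_eq_mul]
  · unfold SolvesK
    filter_upwards [Lp.coeFn_sub (ν • y) (T y), Lp.coeFn_smul ν y, hT y, hsj.coeFn_toLp,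
      Lp.coeFn_add (hsj.toLp sj) (T1 w), hT1 w] with p e1 e2 e3 e4 e5 e6
    rw [← e4, ← e6, ← Pi.add_apply, ← e5, ← h3, e1, Pi.sub_apply, e2, e3, Pi.smul_apply,
      smul_eq_mul]

/-! ### Fibres, slices and densities -/

theorem memLp_prod_mul {f g : Space d → ℝ} (hf : MemLp f 2) (hg : MemLp g 2) :
    MemLp (fun p : Phase d => f p.1 * g p.2) 2 := by
  have m : AEStronglyMeasurable (fun p : Phase d => f p.1 * g p.2) volume := by
    rw [Measure.volume_eq_prod]
    exact hf.1.comp_fst.mul hg.1.comp_snd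
  rw [memLp_two_iff_integrable_sq m]
  have h := ((memLp_two_iff_integrable_sq hf.1).1 hf).mul_prod
    ((memLp_two_iff_integrable_sq hg.1).1 hg)
  rw [Measure.volume_eq_prod]
  refine h.congr (Eventually.of_forall fun p => ?_)
  simp only [mul_pow]

/-- Cauchy-Schwarz against `q(x)(1 + |v|)^(-k)`: `k` weights pay for the velocity integral, so `i`
further powers of `v` may be integrated. -/
theorem MemY.integrable_pow_mul_fst {k i : ℕ} (hk : d < 2 * k) {w : Phase d → ℝ}
    (hw : MemY (k + i) w) {q : Space d → ℝ} (hq : MemLp q 2) :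
    Integrable (fun p : Phase d => (1 + ‖p.2‖) ^ i * w p * q p.1) := by
  refine (MemLp.integrable_mul hw (memLp_prod_mul hq (memLp_one_add_norm_pow_inv hk))).congr
    (Eventually.of_forall fun p => ?_)
  have : (1 + ‖p.2‖) ^ k ≠ 0 := by positivity
  simp only [Pi.mul_apply, pow_add]
  field_simp

theorem MemY.integrable_mul_fst {k : ℕ} (hk : d < 2 * k) {w : Phase d → ℝ}
    (hw : MemY k w) {q : Space d → ℝ} (hq : MemLp q 2) :
    Integrable (fun p : Phase d => w p * q p.1) := by
  simpa using MemY.integrable_pow_mul_fst (i := 0) hk hw hq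

theorem ae_fiber_memLp {u : Phase d → ℝ} (hu : MemLp u 2) :
    ∀ᵐ x : Space d, MemLp (fun v => u (x, v)) 2 := by
  have h := (memLp_two_iff_integrable_sq hu.1).1 hu
  have hm := hu.1
  rw [Measure.volume_eq_prod] at h hm
  filter_upwards [h.prod_right_ae, hm.prodMk_left] with x h1 h2
  exact (memLp_two_iff_integrable_sq h2).2 h1

theorem MemY.ae_fiber_integrable {k : ℕ} (hk : d < 2 * k) {w : Phase d → ℝ}
    (hw : MemY k w) : ∀ᵐ x : Space d, Integrable (fun v => w (x, v)) := by
  filter_upwards [ae_fiber_memLp hw] with x hx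
  refine (MemLp.integrable_mul hx (memLp_one_add_norm_pow_inv hk)).congr
    (Eventually.of_forall fun v => ?_)
  have : (1 + ‖v‖) ^ k ≠ 0 := by positivity
  simp only [Pi.mul_apply]
  field_simp

theorem density_congr {u u' : Phase d → ℝ} (h : u =ᵐ[volume] u') :
    density u =ᵐ[volume] density u' := by
  filter_upwards [ae_fiber h] with x hx
  exact integral_congr_ae hx

theorem density_add {k : ℕ} (hk : d < 2 * k) {u u' : Phase d → ℝ} (h : MemY k u)
    (h' : MemY k u') : density (fun p => u p + u' p) =ᵐ[volume] fun x => density u x + density u' x := by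
  filter_upwards [h.ae_fiber_integrable hk, h'.ae_fiber_integrable hk] with x h1 h2
  exact integral_add h1 h2

theorem density_const_mul (c : ℝ) (u : Phase d → ℝ) (x : Space d) :
    density (fun p => c * u p) x = c * density u x := integral_const_mul _ _

theorem density_fst_mul (q : Space d → ℝ) (u : Phase d → ℝ) (x : Space d) :
    density (fun p => q p.1 * u p) x = q x * density u x := integral_const_mul (q x) _

theorem density_sum {ι : Type*} (s : Finset ι) {k : ℕ} (hk : d < 2 * k) {u : ι → Phase d → ℝ}
    (h : ∀ i ∈ s, MemY k (u i)) :
    density (fun p => ∑ i ∈ s, u i p) =ᵐ[volume] fun x => ∑ i ∈ s, density (u i) x := by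
  have h1 : ∀ᵐ x : Space d, ∀ i ∈ s, Integrable (fun v => u i (x, v)) :=
    (Finset.eventually_all s).2 fun i hi => (h i hi).ae_fiber_integrable hk
  filter_upwards [h1] with x hx
  exact integral_finsetSum s hx

theorem aestronglyMeasurable_density {u : Phase d → ℝ} (hu : AEStronglyMeasurable u volume) :
    AEStronglyMeasurable (density u) volume := by
  rw [Measure.volume_eq_prod] at hu
  exact hu.integral_prod_right'

/-- The constant in the bound of the density by the weighted norm. -/
def densConst (d k : ℕ) : ℝ≥0∞ := ∫⁻ v : Space d, ‖((1 + ‖v‖) ^ k)⁻¹‖ₑ ^ 2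

theorem densConst_lt_top {k : ℕ} (hk : d < 2 * k) : densConst d k < ⊤ :=
  lintegral_sq_lt_top (memLp_one_add_norm_pow_inv hk)

/-- Cauchy-Schwarz in the velocity variable against `(1 + |v|)^(-k)`. -/
theorem eLpNorm_density_sq_le (k : ℕ) {u : Phase d → ℝ} (hu : AEStronglyMeasurable u volume) :
    eLpNorm (density u) 2 volume ^ 2
      ≤ densConst d k * eLpNorm (fun p => (1 + ‖p.2‖) ^ k * u p) 2 volume ^ 2 := by
  have hm : AEStronglyMeasurable (fun p : Phase d => (1 + ‖p.2‖) ^ k * u p) volume :=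
    (Measurable.aestronglyMeasurable (by fun_prop)).mul hu
  rw [Measure.volume_eq_prod] at hm
  have hm2 : AEMeasurable (fun p : Phase d => ‖(1 + ‖p.2‖) ^ k * u p‖ₑ ^ 2)
    (volume.prod volume) := (hm.enorm).pow_const 2
  rw [eLpNorm_two_sq, eLpNorm_two_sq, Measure.volume_eq_prod, lintegral_prod _ hm2,
    ← lintegral_const_mul'' _ hm2.lintegral_prod_right']
  refine lintegral_mono_ae ?_
  filter_upwards [hm.prodMk_left] with x hx
  calc ‖density u x‖ₑ ^ 2 ≤ (∫⁻ v, ‖u (x, v)‖ₑ) ^ 2 := by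
        gcongr
        exact enorm_integral_le_lintegral_enorm _
    _ = (∫⁻ v : Space d, ‖((1 + ‖v‖) ^ k)⁻¹‖ₑ * ‖(1 + ‖v‖) ^ k * u (x, v)‖ₑ) ^ 2 := by
        congr 1
        refine lintegral_congr fun v => ?_
        rw [← enorm_mul, inv_mul_cancel_left₀ (by positivity)]
    _ ≤ _ := lintegral_mul_sq_le _ (Measurable.aemeasurable (by fun_prop)) hx.enorm

theorem MemY.memLp_density {k : ℕ} (hk : d < 2 * k) {w : Phase d → ℝ} (hw : MemY k w) :
    MemLp (density w) 2 := by
  refine ⟨aestronglyMeasurable_density hw.aestronglyMeasurable, ?_⟩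
  have h := eLpNorm_density_sq_le k hw.aestronglyMeasurable
  have h2 : eLpNorm (density w) 2 volume ^ 2 < ⊤ :=
    h.trans_lt (ENNReal.mul_lt_top (densConst_lt_top hk) (ENNReal.pow_lt_top hw.2))
  by_contra hc
  rw [not_lt, top_le_iff] at hc
  simp [hc] at h2

theorem MemY.integral_mul_fst {k : ℕ} (hk : d < 2 * k) {w : Phase d → ℝ}
    (hw : MemY k w) {q : Space d → ℝ} (hq : MemLp q 2) :
    ∫ p : Phase d, w p * q p.1 = ∫ x, density w x * q x := by
  have h := hw.integrable_mul_fst hk hq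
  rw [Measure.volume_eq_prod] at h ⊢
  rw [integral_prod _ h]
  exact integral_congr_ae (Eventually.of_forall fun x => integral_mul_const (q x) _)

theorem MemY.integral_mul_fst_symm {k : ℕ} (hk : d < 2 * k) {w : Phase d → ℝ}
    (hw : MemY k w) {q : Space d → ℝ} (hq : MemLp q 2) :
    Integrable (fun v : Space d => ∫ x : Space d, w (x, v) * q x) ∧
    ∫ v : Space d, ∫ x : Space d, w (x, v) * q x = ∫ x, density w x * q x := by
  have h := hw.integrable_mul_fst hk hq
  rw [← hw.integral_mul_fst hk hq]
  rw [Measure.volume_eq_prod] at h ⊢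
  exact ⟨h.integral_prod_right, (integral_prod_symm _ h).symm⟩

theorem IsTest.prod_mul {χ θ : Space d → ℝ} (hχ : IsTest χ) (hθ : IsTest θ) :
    IsTest (fun p : Phase d => χ p.1 * θ p.2) := by
  refine ⟨(hχ.1.comp contDiff_fst).mul (hθ.1.comp contDiff_snd), ?_⟩
  refine HasCompactSupport.intro (hχ.2.prod hθ.2) fun p hp => ?_
  rw [Set.mem_prod, not_and_or] at hp
  rcases hp with hp | hp
  · simp [image_eq_zero_of_notMem_tsupport hp]
  · simp [image_eq_zero_of_notMem_tsupport hp]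

theorem dX_prod_mul {χ θ : Space d → ℝ} (hχ : IsTest χ) (hθ : IsTest θ) (j : Fin d)
    (p : Phase d) : dX j (fun p : Phase d => χ p.1 * θ p.2) p = partialD j χ p.1 * θ p.2 := by
  have e : HasFDerivAt (fun p : Phase d => χ p.1 * θ p.2)
      (χ p.1 • (fderiv ℝ θ p.2).comp (ContinuousLinearMap.snd ℝ (Space d) (Space d))
        + θ p.2 • (fderiv ℝ χ p.1).comp (ContinuousLinearMap.fst ℝ (Space d) (Space d))) p :=
    ((hχ.differentiable p.1).hasFDerivAt.comp p hasFDerivAt_fst).mul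
      ((hθ.differentiable p.2).hasFDerivAt.comp p hasFDerivAt_snd)
  rw [dX, e.fderiv]
  simp [partialD, mul_comm]

/-- By Fubini the hypothesis says that the `x`-integral of `G`, as a function of `v`, is orthogonal
to all test functions. -/
theorem ae_slice {G : Phase d → ℝ} (hG : Integrable G)
    (h : ∀ θ : Space d → ℝ, IsTest θ → ∫ p, G p * θ p.2 = 0) :
    ∀ᵐ v : Space d, ∫ x : Space d, G (x, v) = 0 := by
  rw [Measure.volume_eq_prod] at hG
  refine ae_eq_zero_of_integral_contDiff_smul_eq_zero hG.integral_prod_right.locallyIntegrable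
    fun θ h1 h2 => ?_
  obtain ⟨B, hB⟩ := h2.exists_bound_of_continuous h1.continuous
  have hGθ : Integrable (fun p : Phase d => G p * θ p.2) (volume.prod volume) :=
    hG.mul_bdd (c := B) (h1.continuous.comp continuous_snd).aestronglyMeasurable
      (Eventually.of_forall fun p => hB p.2)
  rw [← h θ ⟨h1, h2⟩, Measure.volume_eq_prod, integral_prod_symm _ hGθ]
  refine integral_congr_ae (Eventually.of_forall fun v => ?_)
  simp only [integral_mul_const, smul_eq_mul]
  exact mul_comm _ _

/-- Test with products `χ(x)θ(v)` and vary `θ`. The exceptional set of velocities may depend on `χ`.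
This form matches `IsStreamDensity`, where the `x`-integral is taken at fixed velocity. -/
theorem IsWeakX.slice {k : ℕ} (hk : d < 2 * k) {j : Fin d} {w y : Phase d → ℝ}
    (h : IsWeakX j w y) (hw : MemY k w) (hy : MemY k y) {χ : Space d → ℝ} (hχ : IsTest χ) :
    ∀ᵐ v : Space d, ∫ x, y (x, v) * χ x = -∫ x, w (x, v) * partialD j χ x := by
  have i1 := hy.integrable_mul_fst hk hχ.memLp_space
  have i2 := hw.integrable_mul_fst hk (hχ.partialD j).memLp_space
  have hs := ae_slice (i1.add i2) fun θ hθ => by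
    have e := h _ (hχ.prod_mul hθ)
    simp only [dX_prod_mul hχ hθ] at e
    have a1 := integrable_mul_test hy.memLp (hχ.prod_mul hθ)
    have a2 : Integrable (fun p => w p * (partialD j χ p.1 * θ p.2)) :=
      integrable_mul_test hw.memLp ((hχ.partialD j).prod_mul hθ)
    simp only [Pi.add_apply, add_mul, mul_assoc]
    rw [integral_add a1 a2, e, neg_add_cancel]
  rw [Measure.volume_eq_prod] at i1 i2
  filter_upwards [hs, i1.prod_left_ae, i2.prod_left_ae] with v h1 h2 h3
  simp only [Pi.add_apply] at h1
  rw [integral_add h2 h3] at h1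
  linarith

theorem IsWeakDeriv.isWeakX {j : Fin d} {f g : Space d → ℝ} (h : IsWeakDeriv j f g)
    (hf : MemLp f 2) (hg : MemLp g 2) {F : Space d → ℝ} (hF : MemLp F 2) :
    IsWeakX j (fun p => f p.1 * F p.2) (fun p => g p.1 * F p.2) := by
  intro Φ hΦ
  have i1 := integrable_mul_test (memLp_prod_mul hg hF) hΦ
  have i2 := integrable_mul_test (memLp_prod_mul hf hF) (hΦ.dX j)
  rw [Measure.volume_eq_prod] at i1 i2 ⊢
  rw [integral_prod_symm _ i1, integral_prod_symm _ i2, ← integral_neg]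
  refine integral_congr_ae (Eventually.of_forall fun v => ?_)
  have hemb : Topology.IsClosedEmbedding (fun x : Space d => (x, v)) :=
    Topology.IsClosedEmbedding.of_continuous_injective_isClosedMap (by fun_prop)
      (fun x y hxy => (Prod.ext_iff.1 hxy).1) (isClosedMap_prodMk_right v)
  have ht : IsTest (fun x : Space d => Φ (x, v)) :=
    ⟨hΦ.1.comp (contDiff_id.prodMk contDiff_const), hΦ.2.comp_isClosedEmbedding hemb⟩
  have e : ∀ x, partialD j (fun x : Space d => Φ (x, v)) x = dX j Φ (x, v) := fun x => by
    have : HasFDerivAt (fun x : Space d => Φ (x, v))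
        ((fderiv ℝ Φ (x, v)).comp (ContinuousLinearMap.inl ℝ (Space d) (Space d))) x :=
      (hΦ.differentiable (x, v)).hasFDerivAt.comp x (hasFDerivAt_prodMk_left x v)
    rw [partialD, this.fderiv]
    rfl
  have h2 := h.2.2 _ ht
  simp only [e] at h2
  have c1 : ∀ x, g x * F v * Φ (x, v) = F v * (g x * Φ (x, v)) := fun x => by ring
  have c2 : ∀ x, f x * F v * dX j Φ (x, v) = F v * (f x * dX j Φ (x, v)) := fun x => by ring
  simp only [c1, c2, integral_const_mul, h2]
  ring

/-! ### Velocity moments and Fourier transform of kernel operators -/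

theorem integrable_prod_fiber {κ u : Space d → ℝ} (hκ : Integrable κ) (hum : Measurable u)
    (hu : Integrable u) (a : ℝ) :
    Integrable (fun q : Space d × Space d => κ q.1 * u (q.2 + a • q.1)) := by
  have hm : AEStronglyMeasurable (fun q : Space d × Space d => κ q.1 * u (q.2 + a • q.1))
      (volume.prod volume) :=
    hκ.1.comp_fst.mul (hum.comp (by fun_prop : Measurable
      (fun q : Space d × Space d => q.2 + a • q.1))).aestronglyMeasurable
  rw [Measure.volume_eq_prod, integrable_prod_iff hm]
  refine ⟨Eventually.of_forall fun ξ => (hu.comp_add_right (a • ξ)).const_mul (κ ξ), ?_⟩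
  refine (hκ.norm.mul_const (∫ v, ‖u v‖)).congr (Eventually.of_forall fun ξ => ?_)
  simp only [norm_mul, integral_const_mul]
  rw [integral_add_right_eq_self (fun v => ‖u v‖)]

theorem integrable_fiber_conv {κ u : Space d → ℝ} (hκ : Integrable κ) (hum : Measurable u)
    (hu : Integrable u) (a : ℝ) : Integrable (fun v => ∫ ξ, κ ξ * u (v + a • ξ)) := by
  have h := integrable_prod_fiber hκ hum hu a
  rw [Measure.volume_eq_prod] at h
  exact h.integral_prod_right

theorem fourier_fiber_conv {κ u : Space d → ℝ} (hκ : Integrable κ) (hum : Measurable u)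
    (hu : Integrable u) (a : ℝ) (η : Space d) :
    𝓕 (fun v => ((∫ ξ, κ ξ * u (v + a • ξ) : ℝ) : ℂ)) η
      = (∫ ξ, (κ ξ : ℂ) * Real.fourierChar (a * inner ℝ ξ η)) * 𝓕 (fun v => (u v : ℂ)) η := by
  have h := integrable_prod_fiber hκ hum hu a
  rw [Measure.volume_eq_prod] at h
  have h' : Integrable (fun q : Space d × Space d =>
      (Real.fourierChar (-inner ℝ q.2 η) : ℂ) * ((κ q.1 * u (q.2 + a • q.1) : ℝ) : ℂ))
      (volume.prod volume) := by
    refine h.ofReal.bdd_mul (c := 1) ?_ (Eventually.of_forall fun q =>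
      (Circle.norm_coe _).le)
    exact Continuous.aestronglyMeasurable (by fun_prop)
  rw [Real.fourier_eq, ← integral_mul_const]
  simp only [Circle.smul_def, smul_eq_mul]
  calc ∫ v, (Real.fourierChar (-inner ℝ v η) : ℂ) * ((∫ ξ, κ ξ * u (v + a • ξ) : ℝ) : ℂ)
      = ∫ v, ∫ ξ, (Real.fourierChar (-inner ℝ v η) : ℂ) * ((κ ξ * u (v + a • ξ) : ℝ) : ℂ) := by
        refine integral_congr_ae (Eventually.of_forall fun v => ?_)
        simp only [integral_const_mul, integral_complex_ofReal]
    _ = ∫ ξ, ∫ v, (Real.fourierChar (-inner ℝ v η) : ℂ) * ((κ ξ * u (v + a • ξ) : ℝ) : ℂ) :=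
        (integral_integral_swap h').symm
    _ = _ := by
        refine integral_congr_ae (Eventually.of_forall fun ξ => ?_)
        have e := integral_add_right_eq_self (μ := (volume : Measure (Space d))) (fun v =>
          (Real.fourierChar (-inner ℝ (v - a • ξ) η) : ℂ) * ((κ ξ * u v : ℝ) : ℂ)) (a • ξ)
        simp only [add_sub_cancel_right] at e
        simp only [e, Real.fourier_eq, Circle.smul_def, smul_eq_mul]
        rw [← integral_const_mul]
        refine integral_congr_ae (Eventually.of_forall fun v => ?_)
        have e2 : -inner ℝ (v - a • ξ) η = a * inner ℝ ξ η + -inner ℝ v η := by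
          rw [inner_sub_left, real_inner_smul_left]; ring
        simp only [e2, AddChar.map_add_eq_mul, Circle.coe_mul, Complex.ofReal_mul]
        ring

/-- The convolution theorem at frequency zero. -/
theorem integral_fiber_conv {κ u : Space d → ℝ} (hκ : Integrable κ) (hum : Measurable u)
    (hu : Integrable u) (a : ℝ) :
    ∫ v, ∫ ξ, κ ξ * u (v + a • ξ) = (∫ ξ, κ ξ) * ∫ v, u v := by
  have h := fourier_fiber_conv hκ hum hu a 0
  simp only [Real.fourier_eq, inner_zero_right, neg_zero, mul_zero, AddChar.map_zero_eq_one,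
    one_smul, Circle.coe_one, mul_one, integral_complex_ofReal] at h
  exact_mod_cast h

theorem integrable_ker (β : ℝ) {W : Space d → ℂ} (hW : Integrable W) (hm : Measurable W)
    (x : Space d) : Integrable (ker β W x) :=
  (integrable_trig (hW.const_mul _) (hm.const_mul _) x).const_mul β

/-- The kernel integral vanishes for Hermitian `W`. It is kept here because the lemma is also
applied to `cW j W`, whose kernel is even in `ξ` when `W` is Hermitian. -/
theorem density_opK {a : ℝ} (ha : a ≠ 0) (β : ℝ) {k : ℕ} (hk : d < 2 * k) {W : Space d → ℂ}
    (hW : Integrable W) (hm : Measurable W) {u : Phase d → ℝ} (hu : MemY k u) :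
    density (opK a β W u) =ᵐ[volume] fun x => (∫ ξ, ker β W x ξ) * density u x := by
  obtain ⟨u', hu', huu⟩ := hu.aestronglyMeasurable
  have hY := hu.congr huu
  filter_upwards [density_congr (opK_congr ha β W huu), density_congr huu,
    hY.ae_fiber_integrable hk] with x h1 h2 h3
  rw [h1, h2]
  exact integral_fiber_conv (integrable_ker β hW hm x)
    (hu'.measurable.comp measurable_prodMk_left) h3 a

/-- The function `ξ ↦ ξ_j W(ξ)`. -/
def cW (j : Fin d) (W : Space d → ℂ) (ξ : Space d) : ℂ := ξ j * W ξ

theorem ker_cW (β : ℝ) (j : Fin d) (W : Space d → ℂ) (x ξ : Space d) :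
    ker β (cW j W) x ξ = ξ j * ker β W x ξ := by
  simp only [ker, trig, cW]
  have : Complex.exp ((2 * Real.pi * inner ℝ ξ x : ℝ) * Complex.I) * (Complex.I * (ξ j * W ξ))
    = (ξ j : ℝ) * (Complex.exp ((2 * Real.pi * inner ℝ ξ x : ℝ) * Complex.I)
      * (Complex.I * W ξ)) := by ring
  rw [this, Complex.re_ofReal_mul]
  ring

/-- The first moment of the kernel in `ξ` is the force: up to the factor `2π`, the multiplier `iξ_j`
is the one of `∂_j`. -/
theorem integral_ker_cW (β : ℝ) (j : Fin d) (W : Space d → ℂ) (x : Space d) :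
    ∫ ξ, ker β (cW j W) x ξ = β / (2 * Real.pi) * pot (dW j W) x := by
  rw [pot, ← integral_const_mul]
  refine integral_congr_ae (Eventually.of_forall fun ξ => ?_)
  simp only [ker, trig, cW, dW]
  have : Complex.exp ((2 * Real.pi * inner ℝ ξ x : ℝ) * Complex.I)
      * (2 * Real.pi * Complex.I * ξ j * W ξ)
    = (2 * Real.pi : ℝ) * (Complex.exp ((2 * Real.pi * inner ℝ ξ x : ℝ) * Complex.I)
      * (Complex.I * (ξ j * W ξ))) := by push_cast; ring
  rw [this, Complex.re_ofReal_mul]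
  field_simp

theorem Herm.integral_ker (β : ℝ) {W : Space d → ℂ} (h : Herm W) (x : Space d) :
    ∫ ξ, ker β W x ξ = 0 := by
  have e := integral_neg_eq_self (ker β W x) volume
  simp only [h.ker_neg, integral_neg] at e
  linarith

theorem Herm.cW_cW {W : Space d → ℂ} (h : Herm W) (i j : Fin d) : Herm (cW i (cW j W)) := by
  intro ξ
  simp [cW, h ξ]

theorem measurable_cW {W : Space d → ℂ} (h : Measurable W) (j : Fin d) : Measurable (cW j W) :=
  (by fun_prop : Measurable fun ξ : Space d => ((ξ j : ℝ) : ℂ)).mul h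

theorem norm_cW_le (W : Space d → ℂ) (j : Fin d) (ξ : Space d) : ‖cW j W ξ‖ ≤ ‖ξ‖ * ‖W ξ‖ := by
  rw [cW, norm_mul, Complex.norm_real]
  gcongr
  exact abs_coord_le ξ j

/-- Write `v_j = (v + aξ)_j - aξ_j` under the integral; the second term multiplies the spectral
density by `ξ_j`. -/
theorem coord_mul_opK {a : ℝ} (ha : a ≠ 0) (β : ℝ) {W : Space d → ℂ} (hW : Integrable W)
    (hm : Measurable W) (j : Fin d) (hW1 : Integrable (cW j W)) {u : Phase d → ℝ}
    (hu : MemLp u 2) :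
    (fun p => p.2 j * opK a β W u p) =ᵐ[volume]
      fun p => opK a β W (fun p => p.2 j * u p) p - a * opK a β (cW j W) u p := by
  obtain ⟨u', hu', huu⟩ := hu.1
  have huu2 : (fun p : Phase d => p.2 j * u p) =ᵐ[volume] fun p => p.2 j * u' p :=
    huu.mono fun p hp => by simp only [hp]
  have hL := (memLp_congr_ae huu).1 hu
  filter_upwards [opK_congr ha β W huu, opK_congr ha β W huu2, opK_congr ha β (cW j W) huu,
    (kerBd_ker a β hm).integrable ha (kerConst_ker_lt_top a β hW) hu'.measurable hL,
    (kerBd_ker a β (measurable_cW hm j)).integrable ha (kerConst_ker_lt_top a β hW1)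
      hu'.measurable hL] with p h1 h2 h3 h4 h5
  rw [h1, h2, h3, eq_sub_iff_add_eq]
  simp only [opK, kint]
  rw [← integral_const_mul, ← integral_const_mul, ← integral_add (h4.const_mul _) (h5.const_mul _)]
  refine integral_congr_ae (Eventually.of_forall fun ξ => ?_)
  simp only [ker_cW, PiLp.add_apply, PiLp.smul_apply, smul_eq_mul]
  ring

/-! ### Admissible spectral potentials -/

/-- The spectral side of a potential in `H^{k+2}` with `2k > d`. -/
structure Admissible (k : ℕ) (W : Space d → ℂ) : Prop where
  dim : d < 2 * k
  dec : Dec (k + 2) W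
  herm : Herm W

namespace Admissible

variable {k : ℕ} {W : Space d → ℂ} (h : Admissible k W)
include h

theorem measurable : Measurable W := h.dec.1

theorem decK : Dec k W := h.dec.mono (by omega)

theorem integrable : Integrable W := h.decK.integrable h.dim

theorem dec_dW (j : Fin d) : Dec (k + 1) (dW j W) := Dec.dW (s := k + 1) h.dec j

theorem dec_dW_dW (i j : Fin d) : Dec k (dW i (dW j W)) := Dec.dW (h.dec_dW j) i

theorem integrable_dW (j : Fin d) : Integrable (dW j W) :=
  ((h.dec_dW j).mono (by omega)).integrable h.dim

theorem integrable_dW_dW (i j : Fin d) : Integrable (dW i (dW j W)) :=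
  (h.dec_dW_dW i j).integrable h.dim

theorem integrable_norm_mul : Integrable (fun ξ => ‖ξ‖ * ‖W ξ‖) := by
  have hm := h.measurable
  refine ((h.dec.mono (by omega : k + 1 ≤ k + 2)).integrable_pow h.dim).mono'
    (Measurable.aestronglyMeasurable (by fun_prop)) (Eventually.of_forall fun ξ => ?_)
  rw [Real.norm_of_nonneg (by positivity), pow_one]
  gcongr
  linarith

theorem integrable_norm_mul_dW (j : Fin d) : Integrable (fun ξ => ‖ξ‖ * ‖dW j W ξ‖) := by
  have hm := measurable_dW h.measurable j
  refine ((h.dec_dW j).integrable_pow h.dim).mono'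
    (Measurable.aestronglyMeasurable (by fun_prop)) (Eventually.of_forall fun ξ => ?_)
  rw [Real.norm_of_nonneg (by positivity), pow_one]
  gcongr
  linarith

theorem integrable_cW (j : Fin d) : Integrable (cW j W) :=
  h.integrable_norm_mul.mono' (measurable_cW h.measurable j).aestronglyMeasurable
    (Eventually.of_forall fun ξ => norm_cW_le W j ξ)

theorem integrable_cW_cW (i j : Fin d) : Integrable (cW i (cW j W)) := by
  refine (h.dec.integrable_pow h.dim).mono'
    (measurable_cW (measurable_cW h.measurable j) i).aestronglyMeasurable
    (Eventually.of_forall fun ξ => (norm_cW_le _ i ξ).trans ?_)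
  calc ‖ξ‖ * ‖cW j W ξ‖ ≤ (1 + ‖ξ‖) * ((1 + ‖ξ‖) * ‖W ξ‖) := by
        gcongr
        · linarith
        · exact (norm_cW_le W j ξ).trans (by gcongr; linarith)
    _ = _ := by ring

theorem integrable_cW_dW (i j : Fin d) : Integrable (cW i (dW j W)) :=
  (h.integrable_norm_mul_dW j).mono'
    (measurable_cW (measurable_dW h.measurable j) i).aestronglyMeasurable
    (Eventually.of_forall fun ξ => norm_cW_le _ i ξ)

end Admissible

/-! ### Moments of `opK` -/

theorem ae_fiber_integrable_opK {a : ℝ} (ha : a ≠ 0) (β : ℝ) {k : ℕ} (hk : d < 2 * k)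
    {W : Space d → ℂ} (hW : Integrable W) (hm : Measurable W) {u : Phase d → ℝ} (hu : MemY k u) :
    ∀ᵐ x : Space d, Integrable (fun v => opK a β W u (x, v)) := by
  obtain ⟨u', hu', huu⟩ := hu.aestronglyMeasurable
  have hY := hu.congr huu
  filter_upwards [ae_fiber (opK_congr ha β W huu), hY.ae_fiber_integrable hk] with x h1 h3
  refine Integrable.congr ?_ (EventuallyEq.symm h1)
  exact integrable_fiber_conv (integrable_ker β hW hm x)
    (hu'.measurable.comp measurable_prodMk_left) h3 a

/-- After commuting `v_i` past `Θ`, the first term has zero density because the kernel is odd. The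
commutator contributes the force. -/
theorem density_coord_opK {a : ℝ} (ha : a ≠ 0) (β : ℝ) {k : ℕ} (hk : d < 2 * k) {W : Space d → ℂ}
    (hW : Integrable W) (hm : Measurable W) (hH : Herm W) {i : Fin d} (hWi : Integrable (cW i W))
    {u : Phase d → ℝ} (hu : MemY (k + 1) u) :
    density (fun p => p.2 i * opK a β W u p) =ᵐ[volume]
      fun x => -(a * β / (2 * Real.pi)) * (pot (dW i W) x * density u x) := by
  have hu0 : MemY k u := hu.mono (by omega)
  have hui : MemY k (fun p => p.2 i * u p) := hu.coord_mul i
  have hc := measurable_cW hm i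
  filter_upwards [density_congr (coord_mul_opK ha β hW hm i hWi hu.memLp),
    density_opK ha β hk hW hm hui, density_opK ha β hk hWi hc hu0,
    ae_fiber_integrable_opK ha β hk hW hm hui,
    ae_fiber_integrable_opK ha β hk hWi hc hu0] with x h1 h2 h3 i1 i2
  have e : density (fun p => opK a β W (fun p => p.2 i * u p) p - a * opK a β (cW i W) u p) x
      = density (opK a β W (fun p => p.2 i * u p)) x - a * density (opK a β (cW i W) u) x := by
    simp only [density]
    rw [integral_sub i1 (i2.const_mul a), integral_const_mul]
  rw [h1, e, h2, h3, hH.integral_ker, integral_ker_cW]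
  ring

theorem integral_sub_sub_add {X : Type*} [MeasurableSpace X] {μ : Measure X} {f g h l : X → ℝ}
    (hf : Integrable f μ) (hg : Integrable g μ) (hh : Integrable h μ) (hl : Integrable l μ)
    (a b : ℝ) : ∫ x, (f x - a * g x - a * h x + b * l x) ∂μ
      = ∫ x, f x ∂μ - a * ∫ x, g x ∂μ - a * ∫ x, h x ∂μ + b * ∫ x, l x ∂μ := by
  have e1 : Integrable (fun x => f x - a * g x) μ := hf.sub (hg.const_mul a)
  have e2 : Integrable (fun x => f x - a * g x - a * h x) μ := e1.sub (hh.const_mul a)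
  rw [integral_add e2 (hl.const_mul b), integral_sub e1 (hh.const_mul a),
    integral_sub hf (hg.const_mul a), integral_const_mul, integral_const_mul, integral_const_mul]

/-- Commuting both coordinates leaves terms of orders 0, 1 and 2 in `a`. Those of orders 0 and 2
have odd kernels and integrate to zero. Hence the nonlocality of `Θ` is not visible in moments up to
the second, and all quantum corrections come from the equilibrium. -/
theorem density_coord_coord_opK {a : ℝ} (ha : a ≠ 0) (β : ℝ) {k : ℕ} {W : Space d → ℂ}
    (h : Admissible k W) (i j : Fin d) {u : Phase d → ℝ} (hu : MemY (k + 2) u) :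
    density (fun p => p.2 i * (p.2 j * opK a β W u p)) =ᵐ[volume]
      fun x => -(a * β / (2 * Real.pi)) *
        (pot (dW i W) x * density (fun p => p.2 j * u p) x
          + pot (dW j W) x * density (fun p => p.2 i * u p) x) := by
  have hu0 : MemY k u := hu.mono (by omega)
  have hu1 : MemY (k + 1) u := hu.mono (by omega)
  have huj : MemY (k + 1) (fun p => p.2 j * u p) := MemY.coord_mul (j := k + 1) hu j
  have huij : MemY k (fun p => p.2 i * (p.2 j * u p)) := huj.coord_mul i
  have hui : MemY k (fun p => p.2 i * u p) := hu1.coord_mul i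
  have hm := h.measurable
  have hci := measurable_cW hm i
  have hcj := measurable_cW hm j
  have hcij := measurable_cW hcj i
  have eq : (fun p : Phase d => p.2 i * (p.2 j * opK a β W u p)) =ᵐ[volume] fun p =>
      opK a β W (fun p => p.2 i * (p.2 j * u p)) p
        - a * opK a β (cW i W) (fun p => p.2 j * u p) p
        - a * opK a β (cW j W) (fun p => p.2 i * u p) p
        + a ^ 2 * opK a β (cW i (cW j W)) u p := by
    filter_upwards [coord_mul_opK ha β h.integrable hm j (h.integrable_cW j) hu.memLp,
      coord_mul_opK ha β h.integrable hm i (h.integrable_cW i) huj.memLp,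
      coord_mul_opK ha β (h.integrable_cW j) hcj i (h.integrable_cW_cW i j) hu.memLp]
      with p h1 h2 h3
    rw [h1, mul_sub, h2, mul_left_comm, h3]
    ring
  filter_upwards [density_congr eq,
    density_opK ha β h.dim h.integrable hm huij,
    density_opK ha β h.dim (h.integrable_cW i) hci (huj.mono (by omega)),
    density_opK ha β h.dim (h.integrable_cW j) hcj hui,
    density_opK ha β h.dim (h.integrable_cW_cW i j) hcij hu0,
    ae_fiber_integrable_opK ha β h.dim h.integrable hm huij,
    ae_fiber_integrable_opK ha β h.dim (h.integrable_cW i) hci (huj.mono (by omega)),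
    ae_fiber_integrable_opK ha β h.dim (h.integrable_cW j) hcj hui,
    ae_fiber_integrable_opK ha β h.dim (h.integrable_cW_cW i j) hcij hu0]
    with x h1 h2 h3 h4 h5 i2 i3 i4 i5
  rw [h1]
  simp only [density] at h2 h3 h4 h5 ⊢
  rw [integral_sub_sub_add i2 i3 i4 i5, h2, h3, h4, h5,
    h.herm.integral_ker, (h.herm.cW_cW i j).integral_ker, integral_ker_cW, integral_ker_cW]
  ring

/-! ### The multiplier of `opK` -/

/-- Oddness of the kernel kills the cosine part of the character, so the symbol of `Θ` is purely
imaginary. -/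
theorem Herm.integral_ker_mul_char {W : Space d → ℂ} (h : Herm W) (hW : Integrable W)
    (hm : Measurable W) (β a : ℝ) (x η : Space d) :
    ∫ ξ, (ker β W x ξ : ℂ) * Real.fourierChar (a * inner ℝ ξ η)
      = Complex.I * ((∫ ξ, ker β W x ξ * Real.sin (2 * Real.pi * (a * inner ℝ ξ η)) : ℝ) : ℂ) := by
  have hk := integrable_ker β hW hm x
  have i1 : Integrable (fun ξ => ker β W x ξ * Real.cos (2 * Real.pi * (a * inner ℝ ξ η))) :=
    hk.mul_bdd (c := 1) (Continuous.aestronglyMeasurable (by fun_prop))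
      (Eventually.of_forall fun ξ => Real.abs_cos_le_one _)
  have i2 : Integrable (fun ξ => ker β W x ξ * Real.sin (2 * Real.pi * (a * inner ℝ ξ η))) :=
    hk.mul_bdd (c := 1) (Continuous.aestronglyMeasurable (by fun_prop))
      (Eventually.of_forall fun ξ => Real.abs_sin_le_one _)
  have z : ∫ ξ, ker β W x ξ * Real.cos (2 * Real.pi * (a * inner ℝ ξ η)) = 0 := by
    have e := integral_neg_eq_self
      (fun ξ => ker β W x ξ * Real.cos (2 * Real.pi * (a * inner ℝ ξ η))) volume
    simp only [h.ker_neg, inner_neg_left, mul_neg, Real.cos_neg, neg_mul, integral_neg] at e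
    linarith
  have e : ∀ ξ, (ker β W x ξ : ℂ) * Real.fourierChar (a * inner ℝ ξ η)
      = ((ker β W x ξ * Real.cos (2 * Real.pi * (a * inner ℝ ξ η)) : ℝ) : ℂ)
        + Complex.I * ((ker β W x ξ * Real.sin (2 * Real.pi * (a * inner ℝ ξ η)) : ℝ) : ℂ) :=
    fun ξ => by
      rw [Real.fourierChar_apply, Complex.exp_mul_I]
      push_cast
      ring
  simp only [e]
  rw [integral_add i1.ofReal (i2.ofReal.const_mul _), integral_const_mul, integral_complex_ofReal,
    integral_complex_ofReal, z]
  simp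

theorem trig_add_sub_trig_sub (W : Space d → ℂ) (x y ξ : Space d) :
    trig W (x + y) ξ - trig W (x - y) ξ
      = 2 * (trig (fun ξ => Complex.I * W ξ) x ξ * Real.sin (2 * Real.pi * inner ℝ ξ y)) := by
  simp only [trig]
  rw [inner_add_right, inner_sub_right, mul_add, mul_sub]
  set θ := 2 * Real.pi * inner ℝ ξ x
  set φ := 2 * Real.pi * inner ℝ ξ y
  simp only [Complex.exp_ofReal_mul_I_re, Complex.exp_ofReal_mul_I_im, Complex.mul_re,
    Complex.mul_im, Complex.I_re, Complex.I_im, Real.cos_add, Real.sin_add, Real.cos_sub,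
    Real.sin_sub]
  ring

/-- Evaluation at `2πη` reconciles the kernel `e^{-iv·η}` with the normalization `e^{-2πi⟨v,η⟩}` of
`𝓕`. The identity fixes the shift `a = πħ/m` and the amplitude `β = 2/ħ` of the velocity kernel. -/
theorem deltaV_pot {c : Constants} (hc : c.Pos) {W : Space d → ℂ} (hW : Integrable W)
    (hm : Measurable W) (x η : Space d) :
    deltaV c (pot W) x ((2 * Real.pi) • η)
      = ∫ ξ, ker (2 / c.hbar) W x ξ *
          Real.sin (2 * Real.pi * (Real.pi * c.hbar / c.mass * inner ℝ ξ η)) := by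
  obtain ⟨h1, -, h3, -⟩ := hc
  have e : (c.hbar / (2 * c.mass)) • (2 * Real.pi) • η = (Real.pi * c.hbar / c.mass) • η := by
    rw [smul_smul]
    congr 1
    field_simp
  rw [deltaV, e, pot, pot, ← integral_sub (integrable_trig hW hm _) (integrable_trig hW hm _),
    ← integral_const_mul]
  refine integral_congr_ae (Eventually.of_forall fun ξ => ?_)
  simp only [trig_add_sub_trig_sub, real_inner_smul_right, ker]
  ring

/-- The shift scale of the velocity kernel. -/
def Constants.shift (c : Constants) : ℝ := Real.pi * c.hbar / c.mass

/-- The amplitude of the velocity kernel. -/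
def Constants.ampl (c : Constants) : ℝ := 2 / c.hbar

theorem Constants.Pos.shift_ne {c : Constants} (hc : c.Pos) : c.shift ≠ 0 :=
  (div_pos (mul_pos Real.pi_pos hc.1) hc.2.2.1).ne'

theorem Constants.Pos.shift_mul_ampl {c : Constants} (hc : c.Pos) :
    c.shift * c.ampl / (2 * Real.pi) = 1 / c.mass := by
  obtain ⟨h1, -, h3, -⟩ := hc
  have := Real.pi_pos
  simp only [Constants.shift, Constants.ampl]
  field_simp

/-- The convolution theorem on almost every fibre: `Θ` is the multiplier `iδV(x,·)`. This links the
shift operator both with `opA` and with the formula for `M`. -/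
theorem fourier_fiber_opK {c : Constants} (hc : c.Pos) {k : ℕ} {W : Space d → ℂ}
    (h : Admissible k W) {u : Phase d → ℝ} (hu : MemY k u) :
    ∀ᵐ x : Space d, ∀ η, 𝓕 (fun v => (opK c.shift c.ampl W u (x, v) : ℂ)) η
      = Complex.I * deltaV c (pot W) x ((2 * Real.pi) • η) * 𝓕 (fun v => (u (x, v) : ℂ)) η := by
  obtain ⟨u', hu', huu⟩ := hu.aestronglyMeasurable
  have hY := hu.congr huu
  have hm := h.measurable
  filter_upwards [ae_fiber (opK_congr hc.shift_ne c.ampl W huu), hY.ae_fiber_integrable h.dim,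
    ae_fiber huu] with x h1 h2 h3 η
  have e1 : 𝓕 (fun v => (opK c.shift c.ampl W u (x, v) : ℂ)) η
      = 𝓕 (fun v => (opK c.shift c.ampl W u' (x, v) : ℂ)) η := by
    rw [Real.fourier_eq, Real.fourier_eq]
    exact integral_congr_ae (h1.mono fun v hv => by simp only [hv])
  have e2 : 𝓕 (fun v => (u (x, v) : ℂ)) η = 𝓕 (fun v => (u' (x, v) : ℂ)) η := by
    rw [Real.fourier_eq, Real.fourier_eq]
    exact integral_congr_ae (h3.mono fun v hv => by simp only [hv])
  rw [e1, e2, deltaV_pot hc h.integrable hm]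
  have := fourier_fiber_conv (integrable_ker c.ampl h.integrable hm x)
    (hu'.measurable.comp measurable_prodMk_left) h2 c.shift η
  rw [h.herm.integral_ker_mul_char h.integrable hm] at this
  exact this

/-! ### Rapidly decreasing functions and the Maxwellian -/

/-- Continuous functions that decrease faster than any power. -/
def Rapid (f : Space d → ℝ) : Prop :=
  Continuous f ∧ ∀ N : ℕ, ∃ C : ℝ, ∀ v, (1 + ‖v‖) ^ N * |f v| ≤ C

theorem Rapid.add {f g : Space d → ℝ} (hf : Rapid f) (hg : Rapid g) :
    Rapid (fun v => f v + g v) := by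
  refine ⟨hf.1.add hg.1, fun N => ?_⟩
  obtain ⟨C, hC⟩ := hf.2 N
  obtain ⟨D, hD⟩ := hg.2 N
  refine ⟨C + D, fun v => ?_⟩
  calc (1 + ‖v‖) ^ N * |f v + g v| ≤ (1 + ‖v‖) ^ N * (|f v| + |g v|) := by
        gcongr
        exact abs_add_le _ _
    _ ≤ C + D := by rw [mul_add]; exact add_le_add (hC v) (hD v)

theorem Rapid.const_mul {f : Space d → ℝ} (hf : Rapid f) (c : ℝ) : Rapid (fun v => c * f v) := by
  refine ⟨continuous_const.mul hf.1, fun N => ?_⟩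
  obtain ⟨C, hC⟩ := hf.2 N
  refine ⟨|c| * C, fun v => ?_⟩
  rw [abs_mul, mul_left_comm]
  gcongr
  exact hC v

theorem Rapid.coord_mul {f : Space d → ℝ} (hf : Rapid f) (i : Fin d) :
    Rapid (fun v => v i * f v) := by
  refine ⟨(by fun_prop : Continuous fun v : Space d => v i).mul hf.1, fun N => ?_⟩
  obtain ⟨C, hC⟩ := hf.2 (N + 1)
  refine ⟨C, fun v => (hC v).trans' ?_⟩
  rw [abs_mul, pow_succ, mul_assoc]
  gcongr
  exact (abs_coord_le v i).trans (by linarith)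

theorem Rapid.integrable_pow {f : Space d → ℝ} (hf : Rapid f) (N : ℕ) :
    Integrable (fun v => (1 + ‖v‖) ^ N * f v) := by
  obtain ⟨C, hC⟩ := hf.2 (N + (d + 1))
  have h := integrable_one_add_norm (E := Space d) (μ := volume) (r := d + 1) (by simp)
  have hf1 := hf.1
  refine (h.const_mul C).mono' (Continuous.aestronglyMeasurable (by fun_prop))
    (Eventually.of_forall fun v => ?_)
  rw [Real.rpow_neg (by positivity), ← Nat.cast_succ, Real.rpow_natCast, ← div_eq_mul_inv,
    le_div_iff₀ (by positivity), norm_mul, Real.norm_of_nonneg (by positivity)]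
  calc (1 + ‖v‖) ^ N * ‖f v‖ * (1 + ‖v‖) ^ (d + 1) = (1 + ‖v‖) ^ (N + (d + 1)) * |f v| := by
        rw [pow_add, Real.norm_eq_abs]; ring
    _ ≤ C := hC v

theorem Rapid.integrable {f : Space d → ℝ} (hf : Rapid f) : Integrable f := by
  simpa using hf.integrable_pow 0

theorem Rapid.memLp_pow {f : Space d → ℝ} (hf : Rapid f) (N : ℕ) :
    MemLp (fun v => (1 + ‖v‖) ^ N * f v) 2 := by
  have hf1 := hf.1
  rw [memLp_two_iff_integrable_sq (Continuous.aestronglyMeasurable (by fun_prop))]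
  obtain ⟨C, hC⟩ := hf.2 N
  refine ((hf.integrable_pow N).norm.const_mul C).mono'
    (Continuous.aestronglyMeasurable (by fun_prop)) (Eventually.of_forall fun v => ?_)
  rw [norm_pow, sq]
  gcongr
  rw [norm_mul, Real.norm_of_nonneg (by positivity)]
  exact hC v

theorem Rapid.memLp {f : Space d → ℝ} (hf : Rapid f) : MemLp f 2 := by
  simpa using hf.memLp_pow 0

theorem rapid_gaussian {b : ℝ} (hb : 0 < b) : Rapid (fun v : Space d => Real.exp (-(b * ‖v‖ ^ 2))) := by
  refine ⟨by fun_prop, fun N => ⟨N.factorial * Real.exp (1 + 1 / (4 * b)), fun v => ?_⟩⟩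
  have h := Real.pow_div_factorial_le_exp (1 + ‖v‖) (by positivity) N
  rw [div_le_iff₀' (by positivity)] at h
  rw [abs_of_pos (Real.exp_pos _)]
  calc (1 + ‖v‖) ^ N * Real.exp (-(b * ‖v‖ ^ 2))
      ≤ N.factorial * Real.exp (1 + ‖v‖) * Real.exp (-(b * ‖v‖ ^ 2)) := by gcongr
    _ = N.factorial * Real.exp (1 + ‖v‖ + -(b * ‖v‖ ^ 2)) := by rw [mul_assoc, ← Real.exp_add]
    _ ≤ _ := by
        gcongr N.factorial * Real.exp ?_
        -- Completing the square: `t - bt²` is at most `1/(4b)`.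
        have : 1 / (4 * b) - ‖v‖ + b * ‖v‖ ^ 2 = b * (‖v‖ - 1 / (2 * b)) ^ 2 := by
          field_simp
          ring
        have h2 : 0 ≤ b * (‖v‖ - 1 / (2 * b)) ^ 2 := by positivity
        linarith

/-- Integration by parts against functions of polynomial growth. -/
theorem Rapid.integral_smul_fderiv {f f' : Space d → ℝ} (hf : Rapid f) (hf' : Rapid f')
    {r : Fin d} (hd : Differentiable ℝ f)
    (hff' : ∀ v, fderiv ℝ f v (EuclideanSpace.single r 1) = f' v)
    {E : Type*} [NormedAddCommGroup E] [NormedSpace ℝ E] {g g' : Space d → E}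
    (hg : Continuous g) (hg' : Continuous g') (hgd : Differentiable ℝ g)
    (hgg' : ∀ v, fderiv ℝ g v (EuclideanSpace.single r 1) = g' v) {C : ℝ} {N : ℕ}
    (hgb : ∀ v, ‖g v‖ ≤ C * (1 + ‖v‖) ^ N) (hgb' : ∀ v, ‖g' v‖ ≤ C * (1 + ‖v‖) ^ N) :
    ∫ v, f' v • g v = -∫ v, f v • g' v := by
  have key : ∀ (φ : Space d → ℝ) (ψ : Space d → E), Rapid φ → Continuous ψ →
      (∀ v, ‖ψ v‖ ≤ C * (1 + ‖v‖) ^ N) → Integrable (fun v => φ v • ψ v) := by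
    intro φ ψ hφ hψ hb
    refine ((hφ.integrable_pow N).norm.const_mul C).mono'
      (hφ.1.smul hψ).aestronglyMeasurable (Eventually.of_forall fun v => ?_)
    rw [norm_smul, norm_mul, Real.norm_of_nonneg (by positivity : 0 ≤ (1 + ‖v‖) ^ N)]
    calc ‖φ v‖ * ‖ψ v‖ ≤ ‖φ v‖ * (C * (1 + ‖v‖) ^ N) := by gcongr; exact hb v
      _ = _ := by ring
  have h := integral_smul_fderiv_eq_neg_fderiv_smul_of_integrable (𝕜 := ℝ) (f := f) (g := g)
    (v := EuclideanSpace.single r 1) (μ := volume) (by simp only [hff']; exact key _ _ hf' hg hgb)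
    (by simp only [hgg']; exact key _ _ hf hg' hgb') (key _ _ hf hg hgb)
    (fun v _ => hd v) (fun v _ => hgd v)
  simp only [hff', hgg'] at h
  rw [h, neg_neg]

/-- `∂_r∂_s F`. -/
def maxwellianHess (c : Constants) (r s : Fin d) (v : Space d) : ℝ :=
  ((c.beta * c.mass) ^ 2 * v r * v s - if r = s then c.beta * c.mass else 0) * maxwellian c v

theorem Constants.Pos.rapid_maxwellian {c : Constants} (hc : c.Pos) :
    Rapid (maxwellian c : Space d → ℝ) := by
  have hb : 0 < c.beta * c.mass / 2 := by have := mul_pos hc.2.1 hc.2.2.1; positivity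
  have h := (rapid_gaussian (d := d) hb).const_mul
    ((c.beta * c.mass / (2 * Real.pi)) ^ ((d : ℝ) / 2))
  convert h using 2 with v
  rw [maxwellian]
  congr 2
  ring

theorem Constants.Pos.rapid_maxwellianHess {c : Constants} (hc : c.Pos) (r s : Fin d) :
    Rapid (maxwellianHess c r s) := by
  have h := hc.rapid_maxwellian (d := d)
  convert (((h.coord_mul s).coord_mul r).const_mul ((c.beta * c.mass) ^ 2)).add
    (h.const_mul (-if r = s then c.beta * c.mass else 0)) using 2 with v
  rw [maxwellianHess]
  ring

theorem hasFDerivAt_maxwellian (c : Constants) (v : Space d) :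
    HasFDerivAt (maxwellian c) ((-(c.beta * c.mass) * maxwellian c v) • innerSL ℝ v) v := by
  have h1 : HasFDerivAt (fun v : Space d => ‖v‖ ^ 2) (2 • innerSL ℝ v) v :=
    (hasStrictFDerivAt_norm_sq v).hasFDerivAt
  have h2 := (((h1.const_mul (c.beta * c.mass)).mul_const (2⁻¹ : ℝ)).neg.exp).const_mul
    ((c.beta * c.mass / (2 * Real.pi)) ^ ((d : ℝ) / 2))
  refine h2.congr_fderiv ?_
  ext w
  simp only [maxwellian, smul_apply, neg_apply, Pi.neg_apply,
    smul_eq_mul, nsmul_eq_mul, Nat.cast_ofNat, div_eq_mul_inv]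
  ring

theorem fderiv_maxwellian (c : Constants) (v : Space d) (r : Fin d) :
    fderiv ℝ (maxwellian c) v (EuclideanSpace.single r 1)
      = -(c.beta * c.mass) * (v r * maxwellian c v) := by
  rw [(hasFDerivAt_maxwellian c v).fderiv]
  simp [EuclideanSpace.inner_single_right]
  ring

theorem fderiv_coord (v : Space d) (r s : Fin d) :
    fderiv ℝ (fun v : Space d => v s) v (EuclideanSpace.single r 1) = if r = s then 1 else 0 := by
  have : HasFDerivAt (fun v : Space d => v s) (EuclideanSpace.proj (𝕜 := ℝ) s) v :=
    (EuclideanSpace.proj (𝕜 := ℝ) s).hasFDerivAt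
  rw [this.fderiv]
  simp [eq_comm]

theorem differentiable_coord (s : Fin d) : Differentiable ℝ (fun v : Space d => v s) := by
  fun_prop

theorem differentiable_maxwellian (c : Constants) : Differentiable ℝ (maxwellian c : Space d → ℝ) :=
  fun v => (hasFDerivAt_maxwellian c v).differentiableAt

theorem fderiv_coord_mul_maxwellian (c : Constants) (v : Space d) (r s : Fin d) :
    fderiv ℝ (fun v : Space d => -(c.beta * c.mass) * (v s * maxwellian c v)) v
      (EuclideanSpace.single r 1) = maxwellianHess c r s v := by
  have hd : DifferentiableAt ℝ (fun v : Space d => v s * maxwellian c v) v :=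
    (differentiable_coord s v).mul (differentiable_maxwellian c v)
  rw [fderiv_const_mul hd, fderiv_fun_mul (differentiable_coord s v) (differentiable_maxwellian c v)]
  simp only [smul_apply, add_apply, smul_eq_mul,
    fderiv_maxwellian, fderiv_coord, maxwellianHess]
  split_ifs <;> ring

theorem integral_maxwellian {c : Constants} (hc : c.Pos) :
    ∫ v : Space d, maxwellian c v = 1 := by
  have hb : 0 < c.beta * c.mass / 2 := by have := mul_pos hc.2.1 hc.2.2.1; positivity
  have h := GaussianFourier.integral_rexp_neg_mul_sq_norm (V := Space d) hb
  have hb2 : 0 < c.beta * c.mass := mul_pos hc.2.1 hc.2.2.1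
  simp only [maxwellian, integral_const_mul]
  have e : ∀ v : Space d, -(c.beta * c.mass * ‖v‖ ^ 2 / 2) = -(c.beta * c.mass / 2) * ‖v‖ ^ 2 :=
    fun v => by ring
  simp only [e, h, finrank_euclideanSpace_fin]
  rw [← Real.mul_rpow (by positivity) (by positivity)]
  have : c.beta * c.mass / (2 * Real.pi) * (Real.pi / (c.beta * c.mass / 2)) = 1 := by
    have := Real.pi_pos
    have h1 := hc.2.1.ne'
    have h2 := hc.2.2.1.ne'
    field_simp
  rw [this, Real.one_rpow]

/-! ### Velocity moments of the Maxwellian and of its Hessian. -/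

section Moments

variable {E : Type*} [NormedAddCommGroup E] [NormedSpace ℝ E]

/-- First integration by parts for the Maxwellian. -/
theorem integral_coord_maxwellian_smul {c : Constants} (hc : c.Pos) (r : Fin d)
    {g g' : Space d → E} (hg : Continuous g) (hg' : Continuous g') (hgd : Differentiable ℝ g)
    (hgg' : ∀ v, fderiv ℝ g v (EuclideanSpace.single r 1) = g' v) {C : ℝ} {N : ℕ}
    (hgb : ∀ v, ‖g v‖ ≤ C * (1 + ‖v‖) ^ N) (hgb' : ∀ v, ‖g' v‖ ≤ C * (1 + ‖v‖) ^ N) :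
    ∫ v, (-(c.beta * c.mass) * (v r * maxwellian c v)) • g v = -∫ v, maxwellian c v • g' v :=
  Rapid.integral_smul_fderiv hc.rapid_maxwellian
    ((hc.rapid_maxwellian.coord_mul r).const_mul _) (differentiable_maxwellian c)
    (fun v => fderiv_maxwellian c v r) hg hg' hgd hgg' hgb hgb'

/-- Double integration by parts for the Maxwellian. -/
theorem integral_maxwellianHess_smul {c : Constants} (hc : c.Pos) (r s : Fin d)
    {g g' g'' : Space d → E} (hg : Continuous g) (hg' : Continuous g') (hg'' : Continuous g'')
    (hgd : Differentiable ℝ g) (hgd' : Differentiable ℝ g')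
    (hgg' : ∀ v, fderiv ℝ g v (EuclideanSpace.single r 1) = g' v)
    (hgg'' : ∀ v, fderiv ℝ g' v (EuclideanSpace.single s 1) = g'' v) {C : ℝ} {N : ℕ}
    (hgb : ∀ v, ‖g v‖ ≤ C * (1 + ‖v‖) ^ N) (hgb' : ∀ v, ‖g' v‖ ≤ C * (1 + ‖v‖) ^ N)
    (hgb'' : ∀ v, ‖g'' v‖ ≤ C * (1 + ‖v‖) ^ N) :
    ∫ v, maxwellianHess c r s v • g v = ∫ v, maxwellian c v • g'' v := by
  rw [Rapid.integral_smul_fderiv ((hc.rapid_maxwellian.coord_mul s).const_mul _)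
    (hc.rapid_maxwellianHess r s)
    (((differentiable_coord s).mul (differentiable_maxwellian c)).const_mul _)
    (fun v => fderiv_coord_mul_maxwellian c v r s) hg hg' hgd hgg' hgb hgb',
    integral_coord_maxwellian_smul hc s hg' hg'' hgd' hgg'' hgb' hgb'', neg_neg]

end Moments

/-- One growth bound, `2(1 + |v|)²`, covers the monomials of degree at most two and all their
derivatives; hence the choice `C = 2`, `N = 2` in the integrations by parts that follow. -/
theorem norm_coord_le_growth (v : Space d) (i : Fin d) : ‖v i‖ ≤ 2 * (1 + ‖v‖) ^ 2 := by
  have := abs_coord_le v i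
  have h0 := norm_nonneg v
  rw [Real.norm_eq_abs]
  nlinarith

theorem norm_const_le_growth (v : Space d) {x : ℝ} (hx : |x| ≤ 2) : ‖x‖ ≤ 2 * (1 + ‖v‖) ^ 2 := by
  have h0 := norm_nonneg v
  rw [Real.norm_eq_abs]
  nlinarith

theorem norm_coord_mul_le_growth (v : Space d) (i j : Fin d) :
    ‖v i * v j‖ ≤ 2 * (1 + ‖v‖) ^ 2 := by
  have hi := abs_coord_le v i
  have hj := abs_coord_le v j
  have h0 := norm_nonneg v
  rw [Real.norm_eq_abs, abs_mul]
  nlinarith [mul_le_mul hi hj (abs_nonneg _) h0]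

theorem abs_ite_le (p : Prop) [Decidable p] : |if p then (1 : ℝ) else 0| ≤ 1 := by
  split_ifs <;> simp

theorem integral_coord_maxwellian {c : Constants} (hc : c.Pos) (i : Fin d) :
    ∫ v : Space d, v i * maxwellian c v = 0 := by
  have h := integral_coord_maxwellian_smul hc i (g := fun _ : Space d => (1 : ℝ))
    (g' := fun _ => 0) continuous_const continuous_const (differentiable_const _)
    (fun v => by simp) (C := 2) (N := 2) (fun v => norm_const_le_growth v (by norm_num))
    (fun v => norm_const_le_growth v (by norm_num))
  simp only [smul_eq_mul, mul_one, mul_zero, integral_zero, neg_zero, integral_const_mul,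
    mul_eq_zero, neg_eq_zero] at h
  have := hc.2.1.ne'
  have := hc.2.2.1.ne'
  tauto

theorem integral_coord_coord_maxwellian {c : Constants} (hc : c.Pos) (i j : Fin d) :
    ∫ v : Space d, v i * (v j * maxwellian c v)
      = if i = j then 1 / (c.beta * c.mass) else 0 := by
  have h := integral_coord_maxwellian_smul hc j (g := fun v : Space d => v i)
    (g' := fun _ => if j = i then (1 : ℝ) else 0) (by fun_prop) continuous_const
    (differentiable_coord i) (fun v => fderiv_coord v j i) (C := 2) (N := 2)
    (fun v => norm_coord_le_growth v i)
    (fun v => norm_const_le_growth v ((abs_ite_le _).trans (by norm_num)))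
  have hb2 : 0 < c.beta * c.mass := mul_pos hc.2.1 hc.2.2.1
  have e : ∀ v : Space d, (-(c.beta * c.mass) * (v j * maxwellian c v)) • v i
      = -(c.beta * c.mass) * (v i * (v j * maxwellian c v)) := fun v => by
    rw [smul_eq_mul]; ring
  simp only [e, smul_eq_mul, integral_mul_const, integral_const_mul, integral_maxwellian hc,
    one_mul] at h
  simp only [eq_comm (a := j)] at h
  split_ifs at h ⊢ with hij
  · rw [eq_div_iff hb2.ne']
    linarith
  · simpa [hb2.ne', hc.2.1.ne', hc.2.2.1.ne'] using h

theorem integral_maxwellianHess {c : Constants} (hc : c.Pos) (r s : Fin d) :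
    ∫ v : Space d, maxwellianHess c r s v = 0 := by
  have h := integral_maxwellianHess_smul hc r s (g := fun _ : Space d => (1 : ℝ))
    (g' := fun _ => 0) (g'' := fun _ => 0) continuous_const continuous_const continuous_const
    (differentiable_const _) (differentiable_const _)
    (fun v => by simp) (fun v => by simp) (C := 2) (N := 2)
    (fun v => norm_const_le_growth v (by norm_num))
    (fun v => norm_const_le_growth v (by norm_num))
    (fun v => norm_const_le_growth v (by norm_num))
  simpa using h

theorem integral_coord_maxwellianHess {c : Constants} (hc : c.Pos) (i r s : Fin d) :
    ∫ v : Space d, v i * maxwellianHess c r s v = 0 := by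
  have h := integral_maxwellianHess_smul hc r s (g := fun v : Space d => v i)
    (g' := fun _ => if r = i then (1 : ℝ) else 0) (g'' := fun _ => 0) (by fun_prop)
    continuous_const continuous_const (differentiable_coord i) (differentiable_const _)
    (fun v => fderiv_coord v r i) (fun v => by simp) (C := 2) (N := 2)
    (fun v => norm_coord_le_growth v i)
    (fun v => norm_const_le_growth v ((abs_ite_le _).trans (by norm_num)))
    (fun v => norm_const_le_growth v (by norm_num))
  simpa [mul_comm] using h

theorem integral_coord_coord_maxwellianHess {c : Constants} (hc : c.Pos) (i j r s : Fin d) :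
    ∫ v : Space d, v i * (v j * maxwellianHess c r s v)
      = (if r = i then 1 else 0) * (if s = j then 1 else 0)
        + (if s = i then 1 else 0) * (if r = j then 1 else 0) := by
  set δ : Fin d → Fin d → ℝ := fun a b => if a = b then 1 else 0 with hδ
  have hδ1 : ∀ a b, |δ a b| ≤ 1 := fun a b => abs_ite_le _
  have hD : ∀ (e : Fin d) (v : Space d), fderiv ℝ (fun v : Space d => v i * v j) v
      (EuclideanSpace.single e 1) = δ e i * v j + v i * δ e j := fun e v => by
    rw [fderiv_fun_mul (differentiable_coord i v) (differentiable_coord j v)]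
    simp only [smul_apply, add_apply, smul_eq_mul,
      fderiv_coord, hδ]
    ring
  have hD2 : ∀ v : Space d, fderiv ℝ (fun v : Space d => δ r i * v j + v i * δ r j) v
      (EuclideanSpace.single s 1) = δ r i * δ s j + δ s i * δ r j := fun v => by
    rw [fderiv_fun_add ((differentiable_coord j v).const_mul _)
      ((differentiable_coord i v).mul_const _), fderiv_const_mul (differentiable_coord j v),
      fderiv_mul_const (differentiable_coord i v)]
    simp only [smul_apply, add_apply, smul_eq_mul,
      fderiv_coord, hδ]
    ring
  have h := integral_maxwellianHess_smul hc r s (g := fun v : Space d => v i * v j)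
    (g' := fun v => δ r i * v j + v i * δ r j)
    (g'' := fun _ => δ r i * δ s j + δ s i * δ r j) (by fun_prop) (by fun_prop)
    continuous_const ((differentiable_coord i).mul (differentiable_coord j))
    (((differentiable_coord j).const_mul _).add ((differentiable_coord i).mul_const _))
    (hD r) hD2 (C := 2) (N := 2) (fun v => norm_coord_mul_le_growth v i j)
    (fun v => ?_) (fun v => norm_const_le_growth v ?_)
  · have e : ∀ v : Space d, maxwellianHess c r s v • (v i * v j)
        = v i * (v j * maxwellianHess c r s v) := fun v => by rw [smul_eq_mul]; ring
    simp only [e] at h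
    rw [h]
    simp only [smul_eq_mul, integral_mul_const, integral_maxwellian hc, one_mul, hδ]
  · have h0 := norm_nonneg v
    have hi := abs_coord_le v i
    have hj := abs_coord_le v j
    calc ‖δ r i * v j + v i * δ r j‖ ≤ |δ r i| * |v j| + |v i| * |δ r j| := by
          rw [← abs_mul, ← abs_mul]
          exact abs_add_le _ _
      _ ≤ 1 * ‖v‖ + ‖v‖ * 1 := by
          gcongr
          · exact hδ1 r i
          · exact hδ1 r j
      _ ≤ _ := by nlinarith
  · calc |δ r i * δ s j + δ s i * δ r j| ≤ |δ r i| * |δ s j| + |δ s i| * |δ r j| := by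
          rw [← abs_mul, ← abs_mul]
          exact abs_add_le _ _
      _ ≤ 1 * 1 + 1 * 1 := by
          gcongr
          · exact hδ1 r i
          · exact hδ1 s j
          · exact hδ1 s i
          · exact hδ1 r j
      _ = 2 := by norm_num

theorem fourier_maxwellianHess {c : Constants} (hc : c.Pos) (r s : Fin d) (η : Space d) :
    𝓕 (fun v => (maxwellianHess c r s v : ℂ)) η
      = -((2 * Real.pi) ^ 2 * (η r * η s) : ℝ) * 𝓕 (fun v => (maxwellian c v : ℂ)) η := by
  set L : Space d →L[ℝ] ℂ := ((-(2 * Real.pi)) • innerSL ℝ η).smulRight (Complex.I : ℂ) with hL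
  have hLv : ∀ v, L v = (-(2 * Real.pi) * inner ℝ v η : ℝ) * Complex.I := fun v => by
    simp [hL, real_inner_comm]
  set e : Space d → ℂ := fun v => Complex.exp (L v) with he
  have hder : ∀ v, HasFDerivAt e (e v • L) v := fun v => L.hasFDerivAt.cexp
  have hcont : Continuous e := continuous_iff_continuousAt.2 fun v => (hder v).continuousAt
  have hdiff : Differentiable ℝ e := fun v => (hder v).differentiableAt
  have hn : ∀ v, ‖e v‖ = 1 := fun v => by
    rw [he]; simp only [hLv, Complex.norm_exp_ofReal_mul_I]
  have hfd : ∀ (l : Fin d) v, fderiv ℝ e v (EuclideanSpace.single l 1)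
      = (-(2 * Real.pi) * η l : ℝ) * Complex.I * e v := fun l v => by
    rw [(hder v).fderiv]
    simp only [smul_apply, hLv, EuclideanSpace.inner_single_left, smul_eq_mul]
    simp
    ring
  -- A single constant dominating the plane wave, which has modulus 1, and the first and second
  -- derivatives that occur.
  set C : ℝ := 1 + ‖(-(2 * Real.pi) * η r : ℝ) * Complex.I‖
    + ‖(-(2 * Real.pi) * η r : ℝ) * Complex.I * ((-(2 * Real.pi) * η s : ℝ) * Complex.I)‖ with hC
  have h := integral_maxwellianHess_smul hc r s (g := e)
    (g' := fun v => (-(2 * Real.pi) * η r : ℝ) * Complex.I * e v)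
    (g'' := fun v => (-(2 * Real.pi) * η r : ℝ) * Complex.I *
      ((-(2 * Real.pi) * η s : ℝ) * Complex.I * e v))
    hcont (continuous_const.mul hcont) (continuous_const.mul (continuous_const.mul hcont)) hdiff
    (hdiff.const_mul _) (hfd r)
    (fun v => by rw [fderiv_const_mul (hdiff v), smul_apply, hfd, smul_eq_mul])
    (C := C) (N := 0)
    (fun v => by rw [hn, pow_zero, mul_one, hC]; linarith [norm_nonneg ((-(2 * Real.pi) * η r : ℝ) * Complex.I), norm_nonneg ((-(2 * Real.pi) * η r : ℝ) * Complex.I * ((-(2 * Real.pi) * η s : ℝ) * Complex.I))])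
    (fun v => by rw [norm_mul, hn, pow_zero, mul_one, mul_one, hC]; linarith [norm_nonneg ((-(2 * Real.pi) * η r : ℝ) * Complex.I * ((-(2 * Real.pi) * η s : ℝ) * Complex.I))])
    (fun v => by rw [← mul_assoc, norm_mul, hn, pow_zero, mul_one, mul_one, hC]; linarith [norm_nonneg ((-(2 * Real.pi) * η r : ℝ) * Complex.I)])
  rw [Real.fourier_eq, Real.fourier_eq]
  have e1 : ∀ v : Space d, Real.fourierChar (-inner ℝ v η) • (maxwellianHess c r s v : ℂ)
      = maxwellianHess c r s v • e v := fun v => by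
    rw [Circle.smul_def, Complex.real_smul, smul_eq_mul, mul_comm, Real.fourierChar_apply, he]
    simp only [hLv]
    congr 3
    push_cast
    ring
  simp only [e1, h]
  rw [← integral_const_mul]
  refine integral_congr_ae (Eventually.of_forall fun v => ?_)
  have e2 : (Real.fourierChar (-inner ℝ v η) : Circle) • (maxwellian c v : ℂ)
      = maxwellian c v • e v := by
    rw [Circle.smul_def, Complex.real_smul, smul_eq_mul, mul_comm, Real.fourierChar_apply, he]
    simp only [hLv]
    congr 3
    push_cast
    ring
  simp only [e2, Complex.real_smul]
  push_cast
  linear_combination (4 * Real.pi ^ 2 * η r * η s * maxwellian c v * e v) * Complex.I_sq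

/-! ### The phase-space formulas in terms of the normalized Fourier transform -/

theorem integral_eq_two_pi_smul (f : Space d → ℂ) :
    ∫ η, f η = (2 * (Real.pi : ℂ)) ^ d * ∫ η, f ((2 * Real.pi) • η) := by
  have h := Measure.integral_comp_smul_of_nonneg (volume : Measure (Space d)) f (2 * Real.pi)
    (hR := by positivity)
  rw [finrank_euclideanSpace_fin] at h
  rw [h, Complex.real_smul]
  have : (2 * (Real.pi : ℂ)) ^ d ≠ 0 := by
    have := Real.pi_ne_zero
    exact pow_ne_zero _ (by exact_mod_cast mul_ne_zero two_ne_zero this)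
  push_cast
  field_simp

/-- The substitution `η ↦ 2πη` has Jacobian `(2π)^d`, which cancels the prefactor of `Θ`. -/
theorem thetaC_eq_fourierInv (c : Constants) (V : Space d → ℝ) (w : Phase d → ℝ) (p : Phase d) :
    thetaC c V w p = 𝓕⁻ (fun η => Complex.I * deltaV c V p.1 ((2 * Real.pi) • η)
      * 𝓕 (fun v => (w (p.1, v) : ℂ)) η) p.2 := by
  have hπ : (2 * (Real.pi : ℂ)) ^ d ≠ 0 := by
    have := Real.pi_ne_zero
    exact pow_ne_zero _ (by exact_mod_cast mul_ne_zero two_ne_zero this)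
  rw [thetaC, integral_eq_two_pi_smul, ← mul_assoc, div_mul_cancel₀ _ hπ, Real.fourierInv_eq',
    ← integral_const_mul]
  refine integral_congr_ae (Eventually.of_forall fun η => ?_)
  simp only [Real.fourier_eq', smul_eq_mul]
  rw [← integral_const_mul, ← integral_const_mul, ← integral_const_mul]
  refine integral_congr_ae (Eventually.of_forall fun v => ?_)
  have e : Complex.exp (Complex.I * ((inner ℝ (p.2 - v) ((2 * Real.pi) • η) : ℝ) : ℂ))
      = Complex.exp (((2 * Real.pi * inner ℝ η p.2 : ℝ) : ℂ) * Complex.I)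
        * Complex.exp (((-2 * Real.pi * inner ℝ v η : ℝ) : ℂ) * Complex.I) := by
    rw [← Complex.exp_add, real_inner_smul_right, inner_sub_left, real_inner_comm η p.2]
    congr 1
    push_cast
    ring
  simp only [e]
  ring

/-- The coefficient `βħ²/(24m²)` of the quantum correction. -/
def Constants.coef (c : Constants) : ℝ := c.beta * c.hbar ^ 2 / (24 * c.mass ^ 2)

/-- The multiplier in the formula for the profile, for a matrix `H`. -/
def profMult (c : Constants) (V : Space d → ℝ) (H : Fin d → Fin d → ℝ) (x η : Space d) : ℂ :=
  𝓕 (fun v => (maxwellian c v : ℂ)) η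
    / (c.nu - Complex.I * deltaV c V x ((2 * Real.pi) • η))
    * ((1 - c.coef * ∑ r, ∑ s, (2 * Real.pi) ^ 2 * (η r * η s) * H r s : ℝ) : ℂ)

/-- The factors `(2π)^(-d/2)` of the two unitary transforms together cancel the Jacobian `(2π)^d` of
`η ↦ 2πη`. -/
theorem profileC_eq_fourierInv (c : Constants) (V : Space d → ℝ) (p : Phase d) :
    profileC c V p = c.nu * 𝓕⁻ (profMult c V (fun r s => hess V r s p.1) p.1) p.2 := by
  have hp : ((2 * Real.pi) ^ (-(d : ℝ) / 2) : ℝ) * ((2 * Real.pi) ^ d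
      * ((2 * Real.pi) ^ (-(d : ℝ) / 2) : ℝ)) = 1 := by
    have h2 : 0 < 2 * Real.pi := by positivity
    rw [← Real.rpow_natCast, ← Real.rpow_add h2, ← Real.rpow_add h2]
    convert Real.rpow_zero _ using 2
    ring
  have hpC : (((2 * Real.pi) ^ (-(d : ℝ) / 2) : ℝ) : ℂ) * ((2 * (Real.pi : ℂ)) ^ d
      * (((2 * Real.pi) ^ (-(d : ℝ) / 2) : ℝ) : ℂ)) = 1 := by
    exact_mod_cast hp
  rw [profileC, fourierVInv, integral_eq_two_pi_smul, Real.fourierInv_eq']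
  congr 1
  rw [← mul_assoc, ← integral_const_mul]
  refine integral_congr_ae (Eventually.of_forall fun η => ?_)
  have e1 : fourierV (fun v => (maxwellian c v : ℂ)) ((2 * Real.pi) • η)
      = (((2 * Real.pi) ^ (-(d : ℝ) / 2) : ℝ) : ℂ) * 𝓕 (fun v => (maxwellian c v : ℂ)) η := by
    rw [fourierV, Real.fourier_eq']
    congr 1
    refine integral_congr_ae (Eventually.of_forall fun v => ?_)
    simp only [smul_eq_mul]
    rw [mul_comm, real_inner_smul_right]
    congr 2
    push_cast
    ring
  have e2 : Complex.exp (Complex.I * ((inner ℝ p.2 ((2 * Real.pi) • η) : ℝ) : ℂ))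
      = Complex.exp (((2 * Real.pi * inner ℝ η p.2 : ℝ) : ℂ) * Complex.I) := by
    rw [real_inner_smul_right, real_inner_comm η p.2, mul_comm]
  have e3 : c.beta * c.hbar ^ 2 / (24 * c.mass ^ 2) *
      ∑ r, ∑ s, ((2 * Real.pi) • η) r * ((2 * Real.pi) • η) s * hess V r s p.1
      = c.coef * ∑ r, ∑ s, (2 * Real.pi) ^ 2 * (η r * η s) * hess V r s p.1 := by
    rw [Constants.coef]
    congr 1
    refine Finset.sum_congr rfl fun r _ => Finset.sum_congr rfl fun s _ => ?_
    simp only [PiLp.smul_apply, smul_eq_mul]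
    ring
  simp only [e1, e2, e3, profMult, smul_eq_mul]
  linear_combination (𝓕 (fun v => (maxwellian c v : ℂ)) η
    / (c.nu - Complex.I * deltaV c V p.1 ((2 * Real.pi) • η))
    * ((1 - c.coef * ∑ r, ∑ s, (2 * Real.pi) ^ 2 * (η r * η s) * hess V r s p.1 : ℝ) : ℂ)
    * Complex.exp (((2 * Real.pi * inner ℝ η p.2 : ℝ) : ℂ) * Complex.I)) * hpC

theorem fourierInv_congr_ae {f g : Space d → ℂ} (h : f =ᵐ[volume] g) (v : Space d) :
    𝓕⁻ f v = 𝓕⁻ g v := by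
  rw [Real.fourierInv_eq, Real.fourierInv_eq]
  exact integral_congr_ae (h.mono fun v hv => by simp only [hv])

theorem fourier_congr_ae {f g : Space d → ℂ} (h : f =ᵐ[volume] g) (v : Space d) :
    𝓕 f v = 𝓕 g v := by
  rw [Real.fourier_eq, Real.fourier_eq]
  exact integral_congr_ae (h.mono fun v hv => by simp only [hv])

theorem Constants.Pos.ratio_ne {c : Constants} (hc : c.Pos) : c.hbar / (2 * c.mass) ≠ 0 := by
  obtain ⟨h1, -, h3, -⟩ := hc
  positivity

/-- `V` is an arbitrary representative, yet the identity holds for every `x`: the maps `η ↦ x ±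
(ħ/2m)(2πη)` pull null sets back to null sets. -/
theorem deltaV_congr_ae {c : Constants} (hc : c.Pos) {V V' : Space d → ℝ} (h : V =ᵐ[volume] V')
    (x : Space d) : ∀ᵐ η : Space d,
      deltaV c V x ((2 * Real.pi) • η) = deltaV c V' x ((2 * Real.pi) • η) := by
  have hb := hc.ratio_ne
  have h2 : (c.hbar / (2 * c.mass)) * (2 * Real.pi) ≠ 0 := by
    have := Real.pi_ne_zero
    positivity
  filter_upwards [ae_comp_add_smul h2 h x, ae_comp_add_smul (neg_ne_zero.2 h2) h x] with η h3 h4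
  rw [neg_smul, ← sub_eq_add_neg] at h4
  rw [deltaV, deltaV, smul_smul, h3, h4]

theorem memLp_comp_add_smul {a : ℝ} (ha : a ≠ 0) {f : Space d → ℝ} (hf : MemLp f 2) (x : Space d) :
    MemLp (fun η => f (x + a • η)) 2 := by
  have h1 : MemLp (fun η => f (x + η)) 2 :=
    hf.comp_measurePreserving (measurePreserving_add_left volume x)
  have hq : Measure.QuasiMeasurePreserving (fun η : Space d => a • η) volume volume := by
    refine ⟨by fun_prop, ?_⟩
    rw [Measure.map_addHaar_smul _ ha]
    exact Measure.smul_absolutelyContinuous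
  have hm : AEStronglyMeasurable (fun η => f (x + a • η)) volume := h1.1.comp_quasiMeasurePreserving hq
  rw [memLp_two_iff_integrable_sq hm]
  exact ((memLp_two_iff_integrable_sq h1.1).1 h1).comp_smul ha

theorem memLp_deltaV {c : Constants} (hc : c.Pos) {V : Space d → ℝ} (hV : MemLp V 2)
    (x : Space d) : MemLp (fun η => deltaV c V x ((2 * Real.pi) • η)) 2 := by
  have hb := hc.ratio_ne
  have h2 : (c.hbar / (2 * c.mass)) * (2 * Real.pi) ≠ 0 := by
    have := Real.pi_ne_zero
    positivity
  have := ((memLp_comp_add_smul h2 hV x).sub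
    (memLp_comp_add_smul (neg_ne_zero.2 h2) hV x)).const_mul (1 / c.hbar)
  convert this using 2 with η
  simp only [deltaV, smul_smul, Pi.sub_apply, neg_smul, ← sub_eq_add_neg]

theorem measurable_fourier_fiber {w : Phase d → ℂ} (hw : Measurable w) :
    Measurable (fun p : Phase d => 𝓕 (fun v => w (p.1, v)) p.2) := by
  have a1 : Measurable (fun q : Phase d × Space d =>
      Complex.exp (((-2 * Real.pi * inner ℝ q.2 q.1.2 : ℝ) : ℂ) * Complex.I)) := by fun_prop
  have a2 : Measurable (fun q : Phase d × Space d => (q.1.1, q.2)) := by fun_prop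
  have a3 : Measurable (fun q : Phase d × Space d => w (q.1.1, q.2)) := hw.comp a2
  simp only [Real.fourier_eq', smul_eq_mul]
  exact (a1.mul a3).stronglyMeasurable.integral_prod_right'.measurable

theorem measurable_fourierInv_fiber {w : Phase d → ℂ} (hw : Measurable w) :
    Measurable (fun p : Phase d => 𝓕⁻ (fun v => w (p.1, v)) p.2) := by
  have h : Measurable fun p : Phase d => (p.1, -p.2) := by fun_prop
  have h2 := (measurable_fourier_fiber hw).comp h
  simp only [Real.fourierInv_eq_fourier_neg]
  exact h2

/-- Equality on almost every fibre gives equality almost everywhere only for measurable sets. The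
measurable `f'` replaces `f`, which is not known to be measurable. -/
theorem ae_eq_of_ae_fiber {f f' g : Phase d → ℝ} (hf' : Measurable f') (hg : AEMeasurable g)
    (h1 : ∀ᵐ x : Space d, ∀ v, f (x, v) = f' (x, v))
    (h2 : ∀ᵐ x : Space d, ∀ᵐ v : Space d, f (x, v) = g (x, v)) : f =ᵐ[volume] g := by
  obtain ⟨g', hg', hgg⟩ := hg
  have h3 : f' =ᵐ[volume] g' := by
    refine ae_of_ae_fiber (measurableSet_eq_fun hf' hg') ?_
    filter_upwards [h1, h2, ae_fiber hgg] with x a1 a2 a3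
    filter_upwards [a2, a3] with v b2 b3
    rw [← a1, b2, b3]
  filter_upwards [ae_of_ae_fst h1, h3, hgg] with p a1 a2 a3
  rw [a3, ← a2]
  exact a1 p.2

theorem continuous_deltaV {c : Constants} {V : Space d → ℝ} (hV : Continuous V) :
    Continuous (fun p : Phase d => deltaV c V p.1 ((2 * Real.pi) • p.2)) := by
  unfold deltaV
  fun_prop

/-- The integrand defining `Θ[V]w` agrees for almost every `η` with the velocity transform of `opK
w`, so inversion on almost every fibre gives the equality. -/
theorem opA_ae_eq_opK {c : Constants} (hc : c.Pos) {k : ℕ} {W : Space d → ℂ} (h : Admissible k W)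
    {V : Space d → ℝ} (hV : MemLp V 2) (hVW : V =ᵐ[volume] pot W) {w : Phase d → ℝ}
    (hw : MemY k w) : opA c V w =ᵐ[volume] opK c.shift c.ampl W w := by
  obtain ⟨w', hw', hww⟩ := hw.aestronglyMeasurable
  have hcont := continuous_pot h.integrable h.measurable
  have hK : AEMeasurable (opK c.shift c.ampl W w) :=
    (opK_memY hc.shift_ne h.integrable h.integrable_norm_mul h.dim h.decK hw
      ).aestronglyMeasurable.aemeasurable
  refine ae_eq_of_ae_fiber (f' := fun p => (𝓕⁻ (fun η => Complex.I *
    deltaV c (pot W) p.1 ((2 * Real.pi) • η) * 𝓕 (fun v => (w' (p.1, v) : ℂ)) η) p.2).re)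
    ?_ hK ?_ ?_
  · refine Complex.measurable_re.comp (measurable_fourierInv_fiber (w := fun p => Complex.I *
      deltaV c (pot W) p.1 ((2 * Real.pi) • p.2) * 𝓕 (fun v => (w' (p.1, v) : ℂ)) p.2) ?_)
    exact ((Complex.measurable_ofReal.comp (continuous_deltaV hcont).measurable).const_mul _).mul
      (measurable_fourier_fiber (Complex.measurable_ofReal.comp hw'.measurable))
  · filter_upwards [ae_fiber hww] with x hx v
    rw [opA, thetaC_eq_fourierInv]
    congr 1
    refine fourierInv_congr_ae ?_ v
    filter_upwards [deltaV_congr_ae hc hVW x] with η hη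
    simp only [hη]
    congr 1
    exact fourier_congr_ae (hx.mono fun v hv => by simp only [hv]) η
  · filter_upwards [fourier_fiber_opK hc h hw,
      ae_fiber_integrable_opK hc.shift_ne c.ampl h.dim h.integrable h.measurable hw,
      hw.ae_fiber_integrable h.dim, ae_fiber_memLp hw.memLp] with x h1 h2 h3 h4
    have e : (fun η => Complex.I * deltaV c V x ((2 * Real.pi) • η)
        * 𝓕 (fun v => (w (x, v) : ℂ)) η)
        =ᵐ[volume] 𝓕 (fun v => (opK c.shift c.ampl W w (x, v) : ℂ)) := by
      filter_upwards [deltaV_congr_ae hc hVW x] with η hη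
      rw [h1, hη]
    -- `δV(x,·)` and the transform of `w(x,·)` are both in L², so their product is integrable and
    -- Fourier inversion applies.
    have hi : Integrable (𝓕 (fun v => (opK c.shift c.ampl W w (x, v) : ℂ))) := by
      refine Integrable.congr ?_ e
      have := (memLp_deltaV hc hV x).ofReal (K := ℂ)
      refine ((this.integrable_mul (memLp_fourier h3.ofReal h4.ofReal)).const_mul Complex.I).congr
        (Eventually.of_forall fun η => ?_)
      simp only [Pi.mul_apply, mul_assoc]
      rfl
    have h2' : Integrable (fun v => (opK c.shift c.ampl W w (x, v) : ℂ)) := h2.ofReal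
    filter_upwards [fourierInv_fourier_ae h2' hi] with v hv
    rw [opA, thetaC_eq_fourierInv]
    simp only
    rw [fourierInv_congr_ae e, hv, Complex.ofReal_re]

/-! ### The local equilibrium -/

/-- The equilibrium `F + (βħ²/24m²) ∑ H_rs ∂_r∂_s F` for a matrix `H`. -/
def eqFib (c : Constants) (H : Fin d → Fin d → ℝ) (v : Space d) : ℝ :=
  maxwellian c v + c.coef * ∑ r, ∑ s, H r s * maxwellianHess c r s v

/-- The Hessian of `pot W`. -/
def hessW (W : Space d → ℂ) (x : Space d) (r s : Fin d) : ℝ := pot (dW r (dW s W)) x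

/-- The equilibrium with density `q`. -/
def eqSrc (c : Constants) (W : Space d → ℂ) (q : Space d → ℝ) (p : Phase d) : ℝ :=
  q p.1 * eqFib c (hessW W p.1) p.2

theorem hessW_symm (W : Space d → ℂ) (x : Space d) (r s : Fin d) :
    hessW W x r s = hessW W x s r := by
  have : dW r (dW s W) = dW s (dW r W) := by
    ext ξ
    simp only [dW]
    ring
  rw [hessW, hessW, this]

theorem Rapid.sum {ι : Type*} (s : Finset ι) {f : ι → Space d → ℝ} (h : ∀ i ∈ s, Rapid (f i)) :
    Rapid (fun v => ∑ i ∈ s, f i v) := by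
  classical
  induction s using Finset.induction_on with
  | empty =>
    simp only [Finset.sum_empty]
    exact ⟨continuous_const, fun N => ⟨0, fun v => by simp⟩⟩
  | insert a s ha ih =>
    simp only [Finset.sum_insert ha]
    exact (h a (Finset.mem_insert_self a s)).add (ih fun i hi => h i (Finset.mem_insert_of_mem hi))

theorem Rapid.abs {f : Space d → ℝ} (hf : Rapid f) : Rapid (fun v => |f v|) :=
  ⟨hf.1.abs, fun N => by simpa using hf.2 N⟩

theorem integral_mul_eqFib (c : Constants) (H : Fin d → Fin d → ℝ)
    {g : Space d → ℝ} (h0 : Integrable (fun v => g v * maxwellian c v))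
    (h1 : ∀ r s, Integrable (fun v => g v * maxwellianHess c r s v)) :
    ∫ v, g v * eqFib c H v = (∫ v, g v * maxwellian c v)
      + c.coef * ∑ r, ∑ s, H r s * ∫ v, g v * maxwellianHess c r s v := by
  have e : ∀ v, g v * eqFib c H v = g v * maxwellian c v
      + c.coef * ∑ r, ∑ s, H r s * (g v * maxwellianHess c r s v) := fun v => by
    simp only [eqFib, mul_add, Finset.mul_sum]
    congr 1
    refine Finset.sum_congr rfl fun r _ => Finset.sum_congr rfl fun s _ => ?_
    ring
  simp only [e]
  rw [integral_add h0 (Integrable.const_mul (integrable_finsetSum _ fun r _ =>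
    integrable_finsetSum _ fun s _ => (h1 r s).const_mul _) _), integral_const_mul,
    integral_finsetSum _ fun r _ => integrable_finsetSum _ fun s _ => (h1 r s).const_mul _]
  congr 2
  refine Finset.sum_congr rfl fun r _ => ?_
  rw [integral_finsetSum _ fun s _ => (h1 r s).const_mul _]
  simp only [integral_const_mul]

theorem integral_eqFib {c : Constants} (hc : c.Pos) (H : Fin d → Fin d → ℝ) :
    ∫ v, eqFib c H v = 1 := by
  have h := integral_mul_eqFib c H (g := fun _ => 1)
    (by simpa using hc.rapid_maxwellian.integrable)
    (fun r s => by simpa using (hc.rapid_maxwellianHess r s).integrable)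
  simpa [integral_maxwellian hc, integral_maxwellianHess hc] using h

theorem integral_coord_eqFib {c : Constants} (hc : c.Pos) (H : Fin d → Fin d → ℝ) (i : Fin d) :
    ∫ v : Space d, v i * eqFib c H v = 0 := by
  rw [integral_mul_eqFib c H (hc.rapid_maxwellian.coord_mul i).integrable
    (fun r s => ((hc.rapid_maxwellianHess r s).coord_mul i).integrable)]
  simp [integral_coord_maxwellian hc, integral_coord_maxwellianHess hc]

theorem integral_coord_coord_eqFib {c : Constants} (hc : c.Pos) (H : Fin d → Fin d → ℝ)
    (i j : Fin d) : ∫ v : Space d, v i * (v j * eqFib c H v)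
      = (if i = j then 1 / (c.beta * c.mass) else 0) + c.coef * (H i j + H j i) := by
  have h := integral_mul_eqFib c H (g := fun v => v i * v j)
    (by simpa only [mul_assoc] using ((hc.rapid_maxwellian.coord_mul j).coord_mul i).integrable)
    (fun r s => by
      simpa only [mul_assoc] using
        (((hc.rapid_maxwellianHess r s).coord_mul j).coord_mul i).integrable)
  simp only [mul_assoc] at h
  rw [h, integral_coord_coord_maxwellian hc]
  simp only [integral_coord_coord_maxwellianHess hc, mul_add, Finset.sum_add_distrib]
  simp

theorem fourier_eqFib {c : Constants} (hc : c.Pos) (H : Fin d → Fin d → ℝ) (η : Space d) :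
    𝓕 (fun v => (eqFib c H v : ℂ)) η = 𝓕 (fun v => (maxwellian c v : ℂ)) η
      * ((1 - c.coef * ∑ r, ∑ s, (2 * Real.pi) ^ 2 * (η r * η s) * H r s : ℝ) : ℂ) := by
  have i0 : ∀ f : Space d → ℝ, Rapid f →
      Integrable (fun v => (Real.fourierChar (-inner ℝ v η) : Circle) • ((f v : ℝ) : ℂ)) :=
    fun f hf => (Real.fourierIntegral_convergent_iff η).2 (hf.integrable.ofReal (𝕜 := ℂ))
  have e : ∀ v, (Real.fourierChar (-inner ℝ v η) : Circle) • ((eqFib c H v : ℝ) : ℂ)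
      = (Real.fourierChar (-inner ℝ v η) : Circle) • ((maxwellian c v : ℝ) : ℂ)
        + c.coef * ∑ r, ∑ s, (H r s : ℂ) *
          ((Real.fourierChar (-inner ℝ v η) : Circle) • ((maxwellianHess c r s v : ℝ) : ℂ)) :=
    fun v => by
      simp only [eqFib, Circle.smul_def, smul_eq_mul]
      push_cast
      simp only [mul_add, Finset.mul_sum]
      congr 1
      refine Finset.sum_congr rfl fun r _ => Finset.sum_congr rfl fun s _ => ?_
      ring
  have i1 : ∀ r s, Integrable (fun v => (H r s : ℂ) *
      ((Real.fourierChar (-inner ℝ v η) : Circle) • ((maxwellianHess c r s v : ℝ) : ℂ))) :=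
    fun r s => (i0 _ (hc.rapid_maxwellianHess r s)).const_mul _
  rw [Real.fourier_eq]
  simp only [e]
  rw [integral_add (i0 _ hc.rapid_maxwellian) (Integrable.const_mul (integrable_finsetSum _
    fun r _ => integrable_finsetSum _ fun s _ => i1 r s) _), integral_const_mul,
    integral_finsetSum _ fun r _ => integrable_finsetSum _ fun s _ => i1 r s]
  have e2 : ∀ r, ∫ v, ∑ s, (H r s : ℂ) *
      ((Real.fourierChar (-inner ℝ v η) : Circle) • ((maxwellianHess c r s v : ℝ) : ℂ))
      = ∑ s, (H r s : ℂ) * (-((2 * Real.pi) ^ 2 * (η r * η s) : ℝ)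
        * 𝓕 (fun v => (maxwellian c v : ℂ)) η) := fun r => by
    rw [integral_finsetSum _ fun s _ => i1 r s]
    refine Finset.sum_congr rfl fun s _ => ?_
    rw [integral_const_mul, ← fourier_maxwellianHess hc, Real.fourier_eq]
  simp only [e2, ← Real.fourier_eq]
  push_cast
  rw [mul_sub, mul_one, sub_eq_add_neg]
  congr 1
  simp only [Finset.mul_sum, ← Finset.sum_neg_distrib]
  refine Finset.sum_congr rfl fun r _ => Finset.sum_congr rfl fun s _ => ?_
  ring

theorem exists_rapid_fourier_maxwellian {c : Constants} (hc : c.Pos) :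
    ∃ Φ : Space d → ℝ, Rapid Φ ∧ ∀ η, 𝓕 (fun v : Space d => (maxwellian c v : ℂ)) η = Φ η := by
  have hb : 0 < c.beta * c.mass / 2 := by have := mul_pos hc.2.1 hc.2.2.1; positivity
  set b := c.beta * c.mass / 2 with hbdef
  set K : ℝ := (c.beta * c.mass / (2 * Real.pi)) ^ ((d : ℝ) / 2) with hK
  refine ⟨fun η => K * (Real.pi / b) ^ ((d : ℝ) / 2) * Real.exp (-(Real.pi ^ 2 / b * ‖η‖ ^ 2)),
    (rapid_gaussian (by positivity)).const_mul _, fun η => ?_⟩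
  have h := fourier_gaussian_innerProductSpace (V := Space d) (b := (b : ℂ)) (by simpa using hb) η
  have e : (fun v : Space d => (maxwellian c v : ℂ))
      = fun v => (K : ℂ) * Complex.exp (-(b : ℂ) * ‖v‖ ^ 2) := by
    ext v
    rw [maxwellian, ← hK]
    push_cast
    congr 2
    rw [hbdef]
    push_cast
    ring
  have e2 : 𝓕 (fun v : Space d => (K : ℂ) * Complex.exp (-(b : ℂ) * ‖v‖ ^ 2)) η
      = K * 𝓕 (fun v : Space d => Complex.exp (-(b : ℂ) * ‖v‖ ^ 2)) η := by
    rw [Real.fourier_eq, Real.fourier_eq, ← integral_const_mul]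
    refine integral_congr_ae (Eventually.of_forall fun v => ?_)
    simp only [Circle.smul_def, smul_eq_mul]
    ring
  rw [e, e2, h, finrank_euclideanSpace_fin]
  have e3 : (((Real.pi / b) ^ ((d : ℝ) / 2) : ℝ) : ℂ) = ((Real.pi : ℂ) / b) ^ ((d : ℂ) / 2) := by
    rw [Complex.ofReal_cpow (div_nonneg Real.pi_pos.le hb.le)]
    push_cast
    rfl
  rw [Complex.ofReal_mul, Complex.ofReal_mul, e3, Complex.ofReal_exp, mul_assoc]
  congr 3
  push_cast
  ring

theorem nu_sub_ne {c : Constants} (hc : c.Pos) (δ : ℝ) : (c.nu : ℂ) - Complex.I * δ ≠ 0 := by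
  intro h
  have := congrArg Complex.re h
  simp at this
  exact hc.2.2.2.ne' this

theorem nu_le_norm (c : Constants) (δ : ℝ) : c.nu ≤ ‖(c.nu : ℂ) - Complex.I * δ‖ := by
  refine le_trans ?_ (Complex.abs_re_le_norm _)
  simp [le_abs_self]

theorem profMult_eq {c : Constants} (hc : c.Pos) (V : Space d → ℝ) (H : Fin d → Fin d → ℝ)
    (x η : Space d) : (c.nu - Complex.I * deltaV c V x ((2 * Real.pi) • η)) * profMult c V H x η
      = 𝓕 (fun v => (eqFib c H v : ℂ)) η := by
  rw [fourier_eqFib hc, profMult, ← mul_assoc, mul_div_cancel₀ _ (nu_sub_ne hc _)]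

theorem integrable_profMult {c : Constants} (hc : c.Pos) {V : Space d → ℝ} (hV : Continuous V)
    (H : Fin d → Fin d → ℝ) (x : Space d) : Integrable (profMult c V H x) := by
  obtain ⟨Φ, hΦ, hF⟩ := exists_rapid_fourier_maxwellian (d := d) hc
  have hR : Rapid (fun η => Φ η + (-c.coef) * ∑ r, ∑ s, ((2 * Real.pi) ^ 2 * H r s) *
      (η r * (η s * Φ η))) :=
    hΦ.add ((Rapid.sum _ fun r _ => Rapid.sum _ fun s _ =>
      ((hΦ.coord_mul s).coord_mul r).const_mul _).const_mul _)
  have hcd : Continuous (fun η => deltaV c V x ((2 * Real.pi) • η)) :=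
    (continuous_deltaV (c := c) hV).comp (by fun_prop : Continuous fun η : Space d => (x, η))
  have e : profMult c V H x = fun η => ((c.nu : ℂ) - Complex.I * deltaV c V x ((2 * Real.pi) • η))⁻¹
      * ((Φ η + (-c.coef) * ∑ r, ∑ s, ((2 * Real.pi) ^ 2 * H r s) * (η r * (η s * Φ η)) : ℝ) : ℂ) := by
    ext η
    rw [profMult, hF, div_eq_mul_inv, mul_comm (Φ η : ℂ), mul_assoc, ← Complex.ofReal_mul]
    congr 2
    rw [mul_sub, mul_one, sub_eq_add_neg]
    congr 1
    simp only [Finset.mul_sum, ← Finset.sum_neg_distrib]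
    refine Finset.sum_congr rfl fun r _ => Finset.sum_congr rfl fun s _ => ?_
    ring
  rw [e]
  refine (hR.integrable.ofReal (𝕜 := ℂ)).bdd_mul (c := c.nu⁻¹) ?_ (Eventually.of_forall fun η => ?_)
  · refine Continuous.aestronglyMeasurable (Continuous.inv₀ (by fun_prop) fun η => nu_sub_ne hc _)
  · rw [norm_inv]
    exact inv_anti₀ hc.2.2.2 (nu_le_norm c _)

theorem grad_ae_eq {k : ℕ} {W : Space d → ℂ} (h : Admissible k W) {V : Space d → ℝ}
    (hVW : V =ᵐ[volume] pot W) (i : Fin d) : grad V i =ᵐ[volume] pot (dW i W) :=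
  weakDeriv_ae_eq ((isWeakDeriv_pot h.integrable h.measurable h.integrable_dW i).congr_left hVW.symm)

theorem hess_ae_eq {k : ℕ} {W : Space d → ℂ} (h : Admissible k W) {V : Space d → ℝ}
    (hVW : V =ᵐ[volume] pot W) (r s : Fin d) :
    hess V r s =ᵐ[volume] fun x => hessW W x r s :=
  weakDeriv_ae_eq ((isWeakDeriv_pot (h.integrable_dW s) (measurable_dW h.measurable s)
    (fun l => h.integrable_dW_dW l s) r).congr_left (grad_ae_eq h hVW s).symm)

theorem measurable_profMult {c : Constants} {W : Space d → ℂ} (hc : c.Pos) {k : ℕ}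
    (h : Admissible k W) :
    Measurable (fun p : Phase d => profMult c (pot W) (hessW W p.1) p.1 p.2) := by
  obtain ⟨Φ, hΦ, hF⟩ := exists_rapid_fourier_maxwellian (d := d) hc
  have h1 := (continuous_deltaV (c := c) (continuous_pot h.integrable h.measurable)).measurable
  have h2 : ∀ r s, Measurable (fun p : Phase d => hessW W p.1 r s) := fun r s =>
    (continuous_pot (h.integrable_dW_dW r s)
      (measurable_dW (measurable_dW h.measurable s) r)).measurable.comp measurable_fst
  have h3 := hΦ.1.measurable
  simp only [profMult, hF]
  have h4 : Measurable (fun p : Phase d => Φ p.2) := h3.comp measurable_snd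
  fun_prop

/-- On almost every fibre the stationary equation becomes, in Fourier variables, multiplication by
`ν - iδV`. This never vanishes, its real part being `ν`. Dividing by it gives the formula that
defines `M`, so `qM` is the resolvent of `ν - Θ` applied to `ν` times the equilibrium of density
`q`. -/
theorem mul_profile_ae_eq {c : Constants} (hc : c.Pos) {k : ℕ} {W : Space d → ℂ}
    (h : Admissible k W) {V : Space d → ℝ} (hVW : V =ᵐ[volume] pot W)
    {q : Space d → ℝ} (hq : AEMeasurable q) {w : Phase d → ℝ} (hw : MemY k w)
    (hs : SolvesK c.shift c.ampl c.nu W w (fun p => c.nu * eqSrc c W q p)) :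
    (fun p => q p.1 * profile c V p) =ᵐ[volume] w := by
  obtain ⟨q', hq', hqq⟩ := hq
  have hcont := continuous_pot h.integrable h.measurable
  have hH : ∀ᵐ x, ∀ r s, hess V r s x = hessW W x r s := by
    rw [ae_all_iff]; intro r
    rw [ae_all_iff]; intro s
    exact hess_ae_eq h hVW r s
  have hprof : ∀ᵐ x, ∀ v, profileC c V (x, v)
      = c.nu * 𝓕⁻ (profMult c (pot W) (hessW W x) x) v := by
    filter_upwards [hH] with x hx v
    rw [profileC_eq_fourierInv]
    congr 1
    refine fourierInv_congr_ae ?_ v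
    filter_upwards [deltaV_congr_ae hc hVW x] with η hη
    simp only [profMult, hη, hx]
  refine ae_eq_of_ae_fiber (f' := fun p => q' p.1 *
    (c.nu * 𝓕⁻ (profMult c (pot W) (hessW W p.1) p.1) p.2).re) ?_
    hw.aestronglyMeasurable.aemeasurable ?_ ?_
  · refine (hq'.comp measurable_fst).mul (Complex.measurable_re.comp (Measurable.const_mul ?_ _))
    exact measurable_fourierInv_fiber (measurable_profMult hc h)
  · filter_upwards [hprof, hqq] with x h1 h2 v
    simp only [profile, h1, h2]
  · filter_upwards [hprof, fourier_fiber_opK hc h hw,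
      ae_fiber_integrable_opK hc.shift_ne c.ampl h.dim h.integrable h.measurable hw,
      hw.ae_fiber_integrable h.dim, ae_fiber hs] with x h1 h2 h3 h4 h5
    have h4' : Integrable (fun v => (w (x, v) : ℂ)) := h4.ofReal
    have hF : 𝓕 (fun v => (w (x, v) : ℂ))
        = fun η => ((q x * c.nu : ℝ) : ℂ) * profMult c (pot W) (hessW W x) x η := by
      ext η
      have e1 : 𝓕 (fun v => ((c.nu * w (x, v) - opK c.shift c.ampl W w (x, v) : ℝ) : ℂ)) η
          = 𝓕 (fun v => ((c.nu * (q x * eqFib c (hessW W x) v) : ℝ) : ℂ)) η :=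
        fourier_congr_ae (h5.mono fun v hv => congrArg Complex.ofReal hv) η
      have e2 : 𝓕 (fun v => ((c.nu * w (x, v) - opK c.shift c.ampl W w (x, v) : ℝ) : ℂ)) η
          = c.nu * 𝓕 (fun v => (w (x, v) : ℂ)) η
            - 𝓕 (fun v => (opK c.shift c.ampl W w (x, v) : ℂ)) η := by
        have i1 := (Real.fourierIntegral_convergent_iff η).2 h4'
        have i2 := (Real.fourierIntegral_convergent_iff η).2
          (h3.ofReal : Integrable (fun v => (opK c.shift c.ampl W w (x, v) : ℂ)))
        rw [Real.fourier_eq, Real.fourier_eq, Real.fourier_eq, ← integral_const_mul,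
          ← integral_sub (i1.const_mul _) i2]
        refine integral_congr_ae (Eventually.of_forall fun v => ?_)
        simp only [Circle.smul_def, smul_eq_mul]
        push_cast
        ring
      have e3 : 𝓕 (fun v => ((c.nu * (q x * eqFib c (hessW W x) v) : ℝ) : ℂ)) η
          = ((q x * c.nu : ℝ) : ℂ) * 𝓕 (fun v => (eqFib c (hessW W x) v : ℂ)) η := by
        rw [Real.fourier_eq, Real.fourier_eq, ← integral_const_mul]
        refine integral_congr_ae (Eventually.of_forall fun v => ?_)
        simp only [Circle.smul_def, smul_eq_mul]
        push_cast
        ring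
      rw [e2, e3, h2, ← profMult_eq hc (pot W)] at e1
      refine mul_left_cancel₀ (nu_sub_ne hc (deltaV c (pot W) x ((2 * Real.pi) • η))) ?_
      linear_combination e1
    have hi : Integrable (𝓕 (fun v => (w (x, v) : ℂ))) := by
      rw [hF]
      exact (integrable_profMult hc hcont _ x).const_mul _
    filter_upwards [fourierInv_fourier_ae h4' hi] with v hv
    have e4 : 𝓕⁻ (𝓕 (fun v => (w (x, v) : ℂ))) v
        = ((q x : ℝ) : ℂ) * (c.nu * 𝓕⁻ (profMult c (pot W) (hessW W x) x) v) := by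
      rw [hF, Real.fourierInv_eq, Real.fourierInv_eq, ← mul_assoc, ← Complex.ofReal_mul,
        ← integral_const_mul]
      refine integral_congr_ae (Eventually.of_forall fun η => ?_)
      simp only [Circle.smul_def, smul_eq_mul]
      ring
    rw [e4] at hv
    have h6 := congrArg Complex.re hv
    rw [Complex.re_ofReal_mul, Complex.ofReal_re] at h6
    simp only [profile, h1]
    exact h6

/-! ### Weighted norms -/

theorem le_of_sq_le_mul_sq {a b C : ℝ≥0∞} (h : a ^ 2 ≤ C * b ^ 2) : a ≤ C ^ (2⁻¹ : ℝ) * b := by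
  have h1 : (a ^ 2) ^ (2⁻¹ : ℝ) ≤ (C * b ^ 2) ^ (2⁻¹ : ℝ) := ENNReal.rpow_le_rpow h (by norm_num)
  have h2 : ∀ x : ℝ≥0∞, (x ^ 2) ^ (2⁻¹ : ℝ) = x := fun x => by
    rw [← ENNReal.rpow_natCast, ← ENNReal.rpow_mul]
    norm_num
  rwa [ENNReal.mul_rpow_of_nonneg _ _ (by norm_num), h2, h2] at h1

theorem eLpNorm_prod_mul_sq {f g : Space d → ℝ} (hf : AEStronglyMeasurable f volume)
    (hg : AEStronglyMeasurable g volume) :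
    eLpNorm (fun p : Phase d => f p.1 * g p.2) 2 volume ^ 2
      = eLpNorm f 2 volume ^ 2 * eLpNorm g 2 volume ^ 2 := by
  simp only [eLpNorm_two_sq, enorm_mul, mul_pow]
  rw [Measure.volume_eq_prod]
  exact lintegral_prod_mul (hf.enorm.pow_const 2) (hg.enorm.pow_const 2)

theorem one_add_pow_le (t : ℝ) (ht : 0 ≤ t) (k : ℕ) :
    1 + t ^ (2 * k) ≤ 2 * ((1 + t) ^ k) ^ 2 ∧
    ((1 + t) ^ k) ^ 2 ≤ 2 ^ (2 * k) * (1 + t ^ (2 * k)) := by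
  rw [← pow_mul, mul_comm k 2]
  constructor
  · have h1 : (1 : ℝ) ≤ (1 + t) ^ (2 * k) := one_le_pow₀ (by linarith)
    have h2 : t ^ (2 * k) ≤ (1 + t) ^ (2 * k) := pow_le_pow_left₀ ht (by linarith) _
    linarith
  · rcases le_total t 1 with h | h
    · calc (1 + t) ^ (2 * k) ≤ 2 ^ (2 * k) := pow_le_pow_left₀ (by linarith) (by linarith) _
        _ ≤ _ := le_mul_of_one_le_right (by positivity) (by simp; positivity)
    · calc (1 + t) ^ (2 * k) ≤ (2 * t) ^ (2 * k) := pow_le_pow_left₀ (by linarith) (by linarith) _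
        _ = 2 ^ (2 * k) * t ^ (2 * k) := mul_pow _ _ _
        _ ≤ _ := by gcongr; linarith

theorem measurable_weight (d k : ℕ) :
    Measurable (fun p : Phase d => ENNReal.ofReal (1 + ‖p.2‖ ^ (2 * k))) := by fun_prop

theorem eLpNorm_weight_sq (k : ℕ) (w : Phase d → ℝ) :
    eLpNorm w 2 (weight d k) ^ 2
      = ∫⁻ p : Phase d, ENNReal.ofReal (1 + ‖p.2‖ ^ (2 * k)) * ‖w p‖ₑ ^ 2 := by
  rw [eLpNorm_two_sq, weight, lintegral_withDensity_eq_lintegral_mul_non_measurable _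
    (measurable_weight d k) (Eventually.of_forall fun p => ENNReal.ofReal_lt_top)]
  rfl

theorem enorm_pow_mul_sq (k : ℕ) (w : Phase d → ℝ) (p : Phase d) :
    ‖(1 + ‖p.2‖) ^ k * w p‖ₑ ^ 2 = ENNReal.ofReal (((1 + ‖p.2‖) ^ k) ^ 2) * ‖w p‖ₑ ^ 2 := by
  rw [enorm_mul, mul_pow, Real.enorm_of_nonneg (by positivity),
    ENNReal.ofReal_pow (p := (1 + ‖p.2‖) ^ k) (by positivity)]

theorem eLpNorm_weight_sq_le (k : ℕ) (w : Phase d → ℝ) :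
    eLpNorm w 2 (weight d k) ^ 2 ≤ ENNReal.ofReal 2 *
      eLpNorm (fun p => (1 + ‖p.2‖) ^ k * w p) 2 volume ^ 2 := by
  rw [eLpNorm_weight_sq, eLpNorm_two_sq, ← lintegral_const_mul' _ _ ENNReal.ofReal_ne_top]
  refine lintegral_mono fun p => ?_
  rw [enorm_pow_mul_sq, ← mul_assoc, ← ENNReal.ofReal_mul (by norm_num)]
  gcongr
  exact (one_add_pow_le _ (norm_nonneg _) k).1

theorem eLpNorm_pow_mul_sq_le (k : ℕ) (w : Phase d → ℝ) :
    eLpNorm (fun p => (1 + ‖p.2‖) ^ k * w p) 2 volume ^ 2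
      ≤ ENNReal.ofReal (2 ^ (2 * k)) * eLpNorm w 2 (weight d k) ^ 2 := by
  rw [eLpNorm_weight_sq, eLpNorm_two_sq, ← lintegral_const_mul' _ _ ENNReal.ofReal_ne_top]
  refine lintegral_mono fun p => ?_
  rw [enorm_pow_mul_sq, ← mul_assoc, ← ENNReal.ofReal_mul (by positivity)]
  gcongr
  exact (one_add_pow_le _ (norm_nonneg _) k).2

theorem weight_ac (d k : ℕ) : weight d k ≪ volume := withDensity_absolutelyContinuous _ _

theorem ac_weight (d k : ℕ) : (volume : Measure (Phase d)) ≪ weight d k :=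
  withDensity_absolutelyContinuous' (measurable_weight d k).aemeasurable
    (Eventually.of_forall fun p => by
      rw [ENNReal.ofReal_ne_zero_iff]
      positivity)

theorem lt_top_of_sq_le {a b C : ℝ≥0∞} (h : a ^ 2 ≤ C * b ^ 2) (hC : C ≠ ⊤) (hb : b < ⊤) :
    a < ⊤ :=
  (le_of_sq_le_mul_sq h).trans_lt (ENNReal.mul_lt_top
    (ENNReal.rpow_lt_top_of_nonneg (by norm_num) hC) hb)

/-- The weights `1 + |v|^(2k)` and `(1 + |v|)^(2k)` are comparable, and the two measures have the
same null sets. -/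
theorem memX_iff_memY {k : ℕ} {w : Phase d → ℝ} : MemX k w ↔ MemY k w := by
  constructor
  · intro h
    have h1 : AEStronglyMeasurable w volume := h.1.mono_ac (ac_weight d k)
    exact ⟨(Measurable.aestronglyMeasurable (by fun_prop)).mul h1,
      lt_top_of_sq_le (eLpNorm_pow_mul_sq_le k w) ENNReal.ofReal_ne_top h.2⟩
  · intro h
    exact ⟨h.aestronglyMeasurable.mono_ac (weight_ac d k),
      lt_top_of_sq_le (eLpNorm_weight_sq_le k w) ENNReal.ofReal_ne_top h.2⟩

/-! ### The bulk functions -/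

theorem aestronglyMeasurable_eqSrc {c : Constants} (hc : c.Pos) {k : ℕ} {W : Space d → ℂ}
    (h : Admissible k W) {q : Space d → ℝ} (hq : AEStronglyMeasurable q volume) :
    AEStronglyMeasurable (eqSrc c W q) volume := by
  have h2 : ∀ r s, Measurable (fun p : Phase d => hessW W p.1 r s) := fun r s =>
    (continuous_pot (h.integrable_dW_dW r s)
      (measurable_dW (measurable_dW h.measurable s) r)).measurable.comp measurable_fst
  have h3 : ∀ r s, Measurable (fun p : Phase d => maxwellianHess c r s p.2) := fun r s =>
    (hc.rapid_maxwellianHess r s).1.measurable.comp measurable_snd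
  have h4 : Measurable (fun p : Phase d => maxwellian c p.2) :=
    hc.rapid_maxwellian.1.measurable.comp measurable_snd
  have h5 : Measurable (fun p : Phase d => eqFib c (hessW W p.1) p.2) := by
    unfold eqFib
    fun_prop
  have h6 : AEStronglyMeasurable (fun p : Phase d => q p.1) volume := by
    rw [Measure.volume_eq_prod]
    exact hq.comp_fst
  exact h6.mul h5.aestronglyMeasurable

/-- A velocity profile dominating all local equilibria. -/
theorem exists_rapid_bound_eqFib {c : Constants} (hc : c.Pos) {k : ℕ} {W : Space d → ℂ}
    (h : Admissible k W) :
    ∃ Ψ : Space d → ℝ, Rapid Ψ ∧ ∀ x v, |eqFib c (hessW W x) v| ≤ Ψ v := by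
  refine ⟨fun v => |maxwellian c v| + |c.coef| * ∑ r, ∑ s,
    (∫ ξ, ‖dW r (dW s W) ξ‖) * |maxwellianHess c r s v|,
    hc.rapid_maxwellian.abs.add ((Rapid.sum _ fun r _ => Rapid.sum _ fun s _ =>
      (hc.rapid_maxwellianHess r s).abs.const_mul _).const_mul _), fun x v => ?_⟩
  refine (abs_add_le _ _).trans ?_
  rw [abs_mul]
  refine add_le_add le_rfl (mul_le_mul_of_nonneg_left ?_ (abs_nonneg _))
  refine (Finset.abs_sum_le_sum_abs _ _).trans (Finset.sum_le_sum fun r _ => ?_)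
  refine (Finset.abs_sum_le_sum_abs _ _).trans (Finset.sum_le_sum fun s _ => ?_)
  rw [abs_mul]
  gcongr
  exact abs_pot_le (h.integrable_dW_dW r s) x

/-- The Hessian of the potential is bounded and the Maxwellian factors decay rapidly, so every order
of velocity weight is allowed. -/
theorem exists_eqSrc_bound {c : Constants} (hc : c.Pos) {k : ℕ} {W : Space d → ℂ}
    (h : Admissible k W) (j : ℕ) : ∃ C : ℝ≥0∞, C ≠ ⊤ ∧ ∀ q : Space d → ℝ, MemLp q 2 →
      MemY j (eqSrc c W q) ∧ eLpNorm (fun p => (1 + ‖p.2‖) ^ j * eqSrc c W q p) 2 volume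
        ≤ C * eLpNorm q 2 volume := by
  obtain ⟨Ψ, hΨ, hb⟩ := exists_rapid_bound_eqFib hc h
  have hL := hΨ.memLp_pow j
  refine ⟨eLpNorm (fun v => (1 + ‖v‖) ^ j * Ψ v) 2 volume, hL.2.ne, fun q hq => ?_⟩
  have hle : eLpNorm (fun p => (1 + ‖p.2‖) ^ j * eqSrc c W q p) 2 volume
      ≤ eLpNorm (fun v => (1 + ‖v‖) ^ j * Ψ v) 2 volume * eLpNorm q 2 volume := by
    have h1 : eLpNorm (fun p => (1 + ‖p.2‖) ^ j * eqSrc c W q p) 2 volume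
        ≤ eLpNorm (fun p : Phase d => q p.1 * ((1 + ‖p.2‖) ^ j * Ψ p.2)) 2 volume := by
      refine eLpNorm_mono fun p => ?_
      rw [eqSrc, mul_left_comm, norm_mul, norm_mul, norm_mul, norm_mul]
      gcongr
      exact (hb p.1 p.2).trans (le_abs_self _)
    refine h1.trans ?_
    have h2 := eLpNorm_prod_mul_sq hq.1 hL.1
    have h3 := le_of_sq_le_mul_sq (h2.le.trans (le_of_eq (mul_comm _ _)))
    refine h3.trans (le_of_eq ?_)
    congr 1
    rw [← ENNReal.rpow_natCast, ← ENNReal.rpow_mul]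
    norm_num
  exact ⟨⟨(Measurable.aestronglyMeasurable (by fun_prop)).mul
    (aestronglyMeasurable_eqSrc hc h hq.1), hle.trans_lt (ENNReal.mul_lt_top hL.2 hq.2)⟩, hle⟩

/-- The weight order `j` is limited by the decay of `W`, which reaches `k + 2`. The two weights
beyond `k` are what the second velocity moments of `qM` require. The bound is uniform in `q`, as
needed for time derivatives. -/
theorem exists_profile_bound {c : Constants} (hc : c.Pos) {k : ℕ} {W : Space d → ℂ}
    (h : Admissible k W) {V : Space d → ℝ} (hVW : V =ᵐ[volume] pot W) {j : ℕ} (hkj : k ≤ j)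
    (hj : j ≤ k + 2) : ∃ C : ℝ≥0∞, C ≠ ⊤ ∧ ∀ q : Space d → ℝ, MemLp q 2 →
      MemY j (fun p => q p.1 * profile c V p) ∧
      SolvesK c.shift c.ampl c.nu W (fun p => q p.1 * profile c V p)
        (fun p => c.nu * eqSrc c W q p) ∧
      eLpNorm (fun p => (1 + ‖p.2‖) ^ j * (q p.1 * profile c V p)) 2 volume
        ≤ C * eLpNorm q 2 volume := by
  obtain ⟨C1, hC1, H1⟩ := exists_eqSrc_bound hc h j
  obtain ⟨C2, hC2, H2⟩ := exists_resolvent (β := c.ampl) hc.shift_ne hc.2.2.2 h.integrable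
    h.integrable_norm_mul h.herm (j := j) (by have := h.dim; omega) (h.dec.mono hj)
  refine ⟨C2 * (ENNReal.ofReal c.nu * C1), ENNReal.mul_ne_top hC2
    (ENNReal.mul_ne_top ENNReal.ofReal_ne_top hC1), fun q hq => ?_⟩
  obtain ⟨hY, hb⟩ := H1 q hq
  obtain ⟨w, -, hwY, hwS, hwb⟩ := H2 _ (hY.const_mul c.nu)
  have e := mul_profile_ae_eq hc h hVW hq.1.aemeasurable (hwY.mono hkj) hwS
  refine ⟨hwY.congr e.symm, hwS.congr hc.shift_ne e.symm EventuallyEq.rfl, ?_⟩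
  have e1 : eLpNorm (fun p => (1 + ‖p.2‖) ^ j * (q p.1 * profile c V p)) 2 volume
      = eLpNorm (fun p => (1 + ‖p.2‖) ^ j * w p) 2 volume :=
    eLpNorm_congr_ae (e.mono fun p hp => by simp only [hp])
  have e2 : eLpNorm (fun p => (1 + ‖p.2‖) ^ j * (c.nu * eqSrc c W q p)) 2 volume
      = ENNReal.ofReal c.nu * eLpNorm (fun p => (1 + ‖p.2‖) ^ j * eqSrc c W q p) 2 volume := by
    rw [← Real.enorm_of_nonneg hc.2.2.2.le, ← eLpNorm_const_smul]
    congr 1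
    ext p
    simp only [Pi.smul_apply, smul_eq_mul]
    ring
  rw [e1]
  refine hwb.trans ?_
  rw [e2, mul_assoc, mul_assoc]
  gcongr

theorem density_eqSrc {c : Constants} (hc : c.Pos) (W : Space d → ℂ) (q : Space d → ℝ)
    (x : Space d) : density (eqSrc c W q) x = q x := by
  have h := density_fst_mul q (fun p => eqFib c (hessW W p.1) p.2) x
  refine h.trans ?_
  simp only [density]
  rw [integral_eqFib hc, mul_one]

theorem density_coord_eqSrc {c : Constants} (hc : c.Pos) (W : Space d → ℂ) (q : Space d → ℝ)
    (i : Fin d) (x : Space d) : density (fun p => p.2 i * eqSrc c W q p) x = 0 := by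
  have h := density_fst_mul q (fun p => p.2 i * eqFib c (hessW W p.1) p.2) x
  have e : (fun p : Phase d => p.2 i * eqSrc c W q p)
      = fun p => q p.1 * (p.2 i * eqFib c (hessW W p.1) p.2) := by
    ext p
    rw [eqSrc]
    ring
  rw [e, h]
  simp only [density]
  rw [integral_coord_eqFib hc, mul_zero]

theorem density_coord_coord_eqSrc {c : Constants} (hc : c.Pos) (W : Space d → ℂ)
    (q : Space d → ℝ) (i j : Fin d) (x : Space d) :
    density (fun p => p.2 i * (p.2 j * eqSrc c W q p)) x
      = q x * ((if i = j then 1 / (c.beta * c.mass) else 0) + 2 * c.coef * hessW W x i j) := by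
  have h := density_fst_mul q (fun p => p.2 i * (p.2 j * eqFib c (hessW W p.1) p.2)) x
  have e : (fun p : Phase d => p.2 i * (p.2 j * eqSrc c W q p))
      = fun p => q p.1 * (p.2 i * (p.2 j * eqFib c (hessW W p.1) p.2)) := by
    ext p
    rw [eqSrc]
    ring
  rw [e, h]
  simp only [density]
  rw [integral_coord_coord_eqFib hc, hessW_symm W x j i]
  ring

/-! ### Moments of solutions of the stationary equation -/

section SolveMoments

variable {c : Constants} (hc : c.Pos) {k : ℕ} {W : Space d → ℂ} (h : Admissible k W)
  {w s : Phase d → ℝ}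
include hc h

theorem SolvesK.density (hs : SolvesK c.shift c.ampl c.nu W w s) (hw : MemY k w) :
    HighField.density s =ᵐ[volume] fun x => c.nu * HighField.density w x := by
  filter_upwards [density_congr hs, hw.ae_fiber_integrable h.dim,
    ae_fiber_integrable_opK hc.shift_ne c.ampl h.dim h.integrable h.measurable hw,
    density_opK hc.shift_ne c.ampl h.dim h.integrable h.measurable hw] with x h1 h2 h3 h4
  rw [← h1]
  simp only [HighField.density] at h4 ⊢
  rw [integral_sub (h2.const_mul _) h3, h4, h.herm.integral_ker, integral_const_mul]
  ring

/-- The moments of `(ν - Θ)w = s` form a triangular system: each one involves moments of `w` of at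
most the same order, with `ν` in front of the top one, so they are solved for successively. -/
theorem SolvesK.density_coord (hs : SolvesK c.shift c.ampl c.nu W w s) (hw : MemY (k + 1) w)
    (i : Fin d) : HighField.density (fun p => p.2 i * s p) =ᵐ[volume] fun x =>
      c.nu * HighField.density (fun p => p.2 i * w p) x
        + 1 / c.mass * (pot (dW i W) x * HighField.density w x) := by
  have hY : MemY (k + 1) (opK c.shift c.ampl W w) := opK_memY hc.shift_ne h.integrable
    h.integrable_norm_mul (by have := h.dim; omega) (h.dec.mono (by omega)) hw
  have e : (fun p : Phase d => c.nu * (p.2 i * w p) - p.2 i * opK c.shift c.ampl W w p)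
      =ᵐ[volume] fun p => p.2 i * s p := hs.mono fun p hp => by
    simp only
    rw [← hp]
    ring
  filter_upwards [density_congr e, (hw.coord_mul i).ae_fiber_integrable h.dim,
    (hY.coord_mul i).ae_fiber_integrable h.dim,
    density_coord_opK hc.shift_ne c.ampl h.dim h.integrable h.measurable h.herm
      (h.integrable_cW i) hw] with x h1 h2 h3 h4
  rw [← h1]
  simp only [HighField.density] at h4 ⊢
  rw [integral_sub (h2.const_mul _) h3, h4, integral_const_mul, hc.shift_mul_ampl]
  ring

theorem SolvesK.density_coord_coord (hs : SolvesK c.shift c.ampl c.nu W w s)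
    (hw : MemY (k + 2) w) (i j : Fin d) :
    HighField.density (fun p => p.2 i * (p.2 j * s p)) =ᵐ[volume] fun x =>
      c.nu * HighField.density (fun p => p.2 i * (p.2 j * w p)) x
        + 1 / c.mass * (pot (dW i W) x * HighField.density (fun p => p.2 j * w p) x
          + pot (dW j W) x * HighField.density (fun p => p.2 i * w p) x) := by
  have hY : MemY (k + 2) (opK c.shift c.ampl W w) := opK_memY hc.shift_ne h.integrable
    h.integrable_norm_mul (by have := h.dim; omega) h.dec hw
  have e : (fun p : Phase d => c.nu * (p.2 i * (p.2 j * w p))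
      - p.2 i * (p.2 j * opK c.shift c.ampl W w p))
      =ᵐ[volume] fun p => p.2 i * (p.2 j * s p) := hs.mono fun p hp => by
    simp only
    rw [← hp]
    ring
  have hw2 : MemY k (fun p => p.2 i * (p.2 j * w p)) :=
    (MemY.coord_mul (j := k + 1) hw j).coord_mul i
  have hY2 : MemY k (fun p => p.2 i * (p.2 j * opK c.shift c.ampl W w p)) :=
    (MemY.coord_mul (j := k + 1) hY j).coord_mul i
  filter_upwards [density_congr e, hw2.ae_fiber_integrable h.dim,
    hY2.ae_fiber_integrable h.dim,
    density_coord_coord_opK hc.shift_ne c.ampl h i j hw] with x h1 h2 h3 h4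
  rw [← h1]
  simp only [HighField.density] at h4 ⊢
  rw [integral_sub (h2.const_mul _) h3, h4, integral_const_mul, hc.shift_mul_ampl]
  ring

end SolveMoments

/-! ### Time derivatives -/

theorem exists_density_bound {k : ℕ} (hk : d < 2 * k) : ∃ C : ℝ≥0∞, C ≠ ⊤ ∧
    ∀ w : Phase d → ℝ, AEStronglyMeasurable w volume →
      eLpNorm (density w) 2 volume ≤ C * eLpNorm w 2 (weight d k) := by
  refine ⟨(densConst d k * ENNReal.ofReal (2 ^ (2 * k))) ^ (2⁻¹ : ℝ),
    (ENNReal.rpow_lt_top_of_nonneg (by norm_num) (ENNReal.mul_ne_top (densConst_lt_top hk).ne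
      ENNReal.ofReal_ne_top)).ne, fun w hw => le_of_sq_le_mul_sq ?_⟩
  refine (eLpNorm_density_sq_le k hw).trans ?_
  rw [mul_assoc]
  gcongr
  exact eLpNorm_pow_mul_sq_le k w

theorem tendsto_zero_of_le_const_mul {α : Type*} {l : Filter α} {f g : α → ℝ≥0∞} {C : ℝ≥0∞}
    (hC : C ≠ ⊤) (hg : Tendsto g l (𝓝 0)) (h : ∀ᶠ x in l, f x ≤ C * g x) :
    Tendsto f l (𝓝 0) := by
  have h1 : Tendsto (fun x => C * g x) l (𝓝 0) := by
    have := ENNReal.Tendsto.const_mul hg (Or.inr hC)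
    rwa [mul_zero] at this
  exact tendsto_of_tendsto_of_tendsto_of_le_of_le' tendsto_const_nhds h1
    (Eventually.of_forall fun x => zero_le) h

/-- The density is a bounded linear map from `X_k` to L², so it commutes with strong time
derivatives. -/
theorem HasL2DerivAt.density {k : ℕ} (hk : d < 2 * k) {u : ℝ → Phase d → ℝ} {φ' : Phase d → ℝ}
    {t : ℝ} (h : HasL2DerivAt (weight d k) u φ' t) {n : ℝ → Space d → ℝ}
    (hn : ∀ᶠ s in 𝓝 t, HighField.density (u s) =ᵐ[volume] n s) :
    HasL2DerivAt volume n (HighField.density φ') t := by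
  obtain ⟨h1, h2, h3⟩ := h
  obtain ⟨C, hC, hCb⟩ := exists_density_bound (d := d) hk
  have y2 : MemY k φ' := memX_iff_memY.1 h2
  have hmem : ∀ᶠ s in 𝓝 t, MemLp (n s) 2 volume := by
    filter_upwards [h1, hn] with s a1 a2
    exact (memLp_congr_ae a2).1 ((memX_iff_memY.1 a1).memLp_density hk)
  refine ⟨hmem, y2.memLp_density hk, tendsto_zero_of_le_const_mul hC h3 ?_⟩
  have yt : MemY k (u t) := memX_iff_memY.1 h1.self_of_nhds
  filter_upwards [h1.filter_mono nhdsWithin_le_nhds, hn.filter_mono nhdsWithin_le_nhds] with s a1 a2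
  have ys : MemY k (u s) := memX_iff_memY.1 a1
  refine le_trans (le_of_eq (eLpNorm_congr_ae ?_)) (hCb _ ?_)
  · filter_upwards [a2, hn.self_of_nhds, ys.ae_fiber_integrable hk, yt.ae_fiber_integrable hk,
      y2.ae_fiber_integrable hk] with x b1 b2 b3 b4 b5
    rw [← b1, ← b2]
    simp only [HighField.density]
    have b6 : Integrable (fun v => (s - t)⁻¹ * (u s (x, v) - u t (x, v))) :=
      (b3.sub b4).const_mul _
    rw [integral_sub b6 b5, integral_const_mul, integral_sub b3 b4]
  · exact ((ys.aestronglyMeasurable.sub yt.aestronglyMeasurable).const_mul _).sub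
      y2.aestronglyMeasurable

/-- Multiplication by the time-independent `M` is a bounded linear map from L² to `X_k`. -/
theorem HasL2DerivAt.bulk {c : Constants} (hc : c.Pos) {k : ℕ} {W : Space d → ℂ}
    (h : Admissible k W) {V : Space d → ℝ} (hVW : V =ᵐ[volume] pot W) {n : ℝ → Space d → ℝ}
    {n' : Space d → ℝ} {t : ℝ} (hn : HasL2DerivAt volume n n' t) :
    HasL2DerivAt (weight d k) (fun s => HighField.bulk c V (n s))
      (fun p => n' p.1 * profile c V p) t := by
  obtain ⟨h1, h2, h3⟩ := hn
  obtain ⟨C, hC, hCb⟩ := exists_profile_bound hc h hVW le_rfl (by omega)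
  have hX : ∀ q : Space d → ℝ, MemLp q 2 → MemLp (fun p => q p.1 * profile c V p) 2 (weight d k) :=
    fun q hq => memX_iff_memY.2 (hCb q hq).1
  refine ⟨h1.mono fun s hs => hX _ hs, hX _ h2, ?_⟩
  refine tendsto_zero_of_le_const_mul (C := ENNReal.ofReal 2 ^ (2⁻¹ : ℝ) * C)
    (ENNReal.mul_ne_top (ENNReal.rpow_lt_top_of_nonneg (by norm_num) ENNReal.ofReal_ne_top).ne hC)
    h3 ?_
  filter_upwards [h1.filter_mono nhdsWithin_le_nhds] with s hs
  have hq : MemLp (fun x => (s - t)⁻¹ * (n s x - n t x) - n' x) 2 :=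
    ((hs.sub h1.self_of_nhds).const_mul _).sub h2
  have e : (fun y : Phase d => (s - t)⁻¹ * (HighField.bulk c V (n s) y - HighField.bulk c V (n t) y)
      - n' y.1 * profile c V y)
      = fun p => ((s - t)⁻¹ * (n s p.1 - n t p.1) - n' p.1) * profile c V p := by
    ext p
    simp only [HighField.bulk]
    ring
  rw [e, mul_assoc]
  refine (le_of_sq_le_mul_sq (eLpNorm_weight_sq_le k _)).trans ?_
  gcongr
  exact (hCb _ hq).2.2

/-! ### Products of `H¹` functions with potentials -/

/-- Convolution of spectral functions. -/
def specConv (W N : Space d → ℂ) (ζ : Space d) : ℂ := ∫ ξ, W ξ * N (ζ - ξ)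

theorem Herm.fourierInv_eq_pot {W : Space d → ℂ} (h : Herm W) (hW : Integrable W) (x : Space d) :
    𝓕⁻ W x = (pot W x : ℂ) := by
  rw [pot_eq_re hW]
  refine (Complex.conj_eq_iff_re.1 ?_).symm
  rw [Real.fourierInv_eq']
  refine conj_integral_eq_self fun η => ?_
  rw [h]
  simp only [smul_eq_mul, map_mul, ← Complex.exp_conj, map_neg, Complex.conj_ofReal,
    Complex.conj_I, Complex.conj_conj, inner_neg_left, mul_neg, Complex.ofReal_neg, neg_mul, neg_neg]

theorem fourierInv_char_mul (φ : Space d → ℂ) (ξ ζ : Space d) :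
    𝓕⁻ (fun x => (Real.fourierChar (inner ℝ ξ x) : ℂ) * φ x) ζ = 𝓕⁻ φ (ζ + ξ) := by
  rw [Real.fourierInv_eq, Real.fourierInv_eq]
  refine integral_congr_ae (Eventually.of_forall fun x => ?_)
  simp only [Circle.smul_def, smul_eq_mul, inner_add_right, AddChar.map_add_eq_mul,
    Circle.coe_mul, real_inner_comm x ξ]
  ring

theorem IsTestC.char_mul {φ : Space d → ℂ} (h : IsTestC φ) (ξ : Space d) :
    IsTestC (fun x => (Real.fourierChar (inner ℝ ξ x) : ℂ) * φ x) := by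
  refine ⟨ContDiff.mul ?_ h.1, h.2.mul_left⟩
  simp only [Real.fourierChar_apply]
  have h1 : ContDiff ℝ ∞ (fun x : Space d => 2 * Real.pi * inner ℝ ξ x) :=
    contDiff_const.mul (contDiff_const.inner ℝ contDiff_id)
  exact ((Complex.ofRealCLM.contDiff.comp h1).mul contDiff_const).cexp

/-- Expand `pot W` into characters. Each character times `φ` is again a test function, and its
inverse transform is a translate of that of `φ`. Fubini then assembles the convolution. -/
theorem isInvFT_mul_pot {n : Space d → ℝ} {N W : Space d → ℂ} (hn : MemLp n 2)
    (hN : IsInvFT (fun x => (n x : ℂ)) N) (hNm : Measurable N) (hN2 : MemLp N 2)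
    (hW : Integrable W) (hm : Measurable W) (hH : Herm W) :
    IsInvFT (fun x => ((n x * pot W x : ℝ) : ℂ)) (specConv W N) := by
  intro φ hφ
  have hφ2 : MemLp φ 2 := hφ.1.continuous.memLp_of_hasCompactSupport hφ.2
  have hnφ : Integrable (fun x => (n x : ℂ) * φ x) := (hn.ofReal (K := ℂ)).integrable_mul hφ2
  have hL := hφ.memLp_fourierInv
  have hLm : Continuous (𝓕⁻ φ) := by
    obtain ⟨Φ, rfl⟩ := hφ.exists_schwartz
    rw [← SchwartzMap.fourierInv_coe]
    exact (𝓕⁻ Φ).continuous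
  have i1 : Integrable (fun q : Space d × Space d =>
      (Real.fourierChar (inner ℝ q.2 q.1) : ℂ) * (((n q.1 : ℂ) * φ q.1) * W q.2))
      (volume.prod volume) := by
    refine (hnφ.mul_prod hW).bdd_mul (c := 1) (Continuous.aestronglyMeasurable (by fun_prop))
      (Eventually.of_forall fun q => (Circle.norm_coe _).le)
  have i2 : Integrable (fun q : Space d × Space d => W q.1 * (N (q.2 - q.1) * 𝓕⁻ φ q.2))
      (volume.prod volume) := by
    have hms : AEStronglyMeasurable
        (fun q : Space d × Space d => W q.1 * (N (q.2 - q.1) * 𝓕⁻ φ q.2))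
        (volume.prod volume) := by
      have a1 : Measurable (fun q : Space d × Space d => N (q.2 - q.1)) :=
        hNm.comp (measurable_snd.sub measurable_fst)
      have a2 : Measurable (fun q : Space d × Space d => 𝓕⁻ φ q.2) :=
        hLm.measurable.comp measurable_snd
      exact ((hm.comp measurable_fst).mul (a1.mul a2)).aestronglyMeasurable
    have hsh : ∀ ξ, MemLp (fun ζ => N (ζ - ξ)) 2 := fun ξ => by
      have := hN2.comp_measurePreserving (measurePreserving_sub_right volume ξ)
      exact this
    rw [integrable_prod_iff hms]
    refine ⟨Eventually.of_forall fun ξ => ((hsh ξ).integrable_mul hL).const_mul (W ξ), ?_⟩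
    have hB : ∀ ξ, ∫ ζ, ‖W ξ * (N (ζ - ξ) * 𝓕⁻ φ ζ)‖
        ≤ ‖W ξ‖ * ((∫ ζ, ‖N ζ‖ ^ 2) + ∫ ζ, ‖𝓕⁻ φ ζ‖ ^ 2) := fun ξ => by
      have c1 := (memLp_two_iff_integrable_sq_norm (hsh ξ).1).1 (hsh ξ)
      have c2 := (memLp_two_iff_integrable_sq_norm hL.1).1 hL
      have c3 : ∫ ζ, ‖N (ζ - ξ)‖ ^ 2 = ∫ ζ, ‖N ζ‖ ^ 2 :=
        integral_sub_right_eq_self (fun ζ => ‖N ζ‖ ^ 2) ξ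
      rw [← c3, ← integral_add c1 c2, ← integral_const_mul]
      refine integral_mono_of_nonneg (Eventually.of_forall fun ζ => norm_nonneg _)
        ((c1.add c2).const_mul _) (Eventually.of_forall fun ζ => ?_)
      simp only [norm_mul]
      gcongr
      nlinarith [sq_nonneg (‖N (ζ - ξ)‖ - ‖𝓕⁻ φ ζ‖), sq_nonneg ‖N (ζ - ξ)‖,
        sq_nonneg ‖𝓕⁻ φ ζ‖]
    refine (hW.norm.mul_const ((∫ ζ, ‖N ζ‖ ^ 2) + ∫ ζ, ‖𝓕⁻ φ ζ‖ ^ 2)).mono'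
      hms.norm.integral_prod_right' (Eventually.of_forall fun ξ => ?_)
    rw [Real.norm_of_nonneg (integral_nonneg fun ζ => norm_nonneg _)]
    exact hB ξ
  calc ∫ x, ((n x * pot W x : ℝ) : ℂ) * φ x
      = ∫ x, ∫ ξ, (Real.fourierChar (inner ℝ ξ x) : ℂ) * (((n x : ℂ) * φ x) * W ξ) := by
        refine integral_congr_ae (Eventually.of_forall fun x => ?_)
        simp only
        rw [Complex.ofReal_mul, ← hH.fourierInv_eq_pot hW, Real.fourierInv_eq, mul_right_comm,
          ← integral_const_mul]
        refine integral_congr_ae (Eventually.of_forall fun ξ => ?_)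
        simp only [Circle.smul_def, smul_eq_mul]
        ring
    _ = ∫ ξ, ∫ x, (Real.fourierChar (inner ℝ ξ x) : ℂ) * (((n x : ℂ) * φ x) * W ξ) :=
        integral_integral_swap i1
    _ = ∫ ξ, W ξ * ∫ x, (n x : ℂ) * ((Real.fourierChar (inner ℝ ξ x) : ℂ) * φ x) := by
        refine integral_congr_ae (Eventually.of_forall fun ξ => ?_)
        simp only
        rw [← integral_const_mul]
        refine integral_congr_ae (Eventually.of_forall fun x => ?_)
        ring
    _ = ∫ ξ, ∫ ζ, W ξ * (N (ζ - ξ) * 𝓕⁻ φ ζ) := by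
        refine integral_congr_ae (Eventually.of_forall fun ξ => ?_)
        simp only
        rw [hN _ (hφ.char_mul ξ), integral_const_mul,
          ← integral_add_right_eq_self (fun ζ => N (ζ - ξ) * 𝓕⁻ φ ζ) ξ]
        simp only [fourierInv_char_mul, add_sub_cancel_right]
    _ = ∫ ζ, ∫ ξ, W ξ * (N (ζ - ξ) * 𝓕⁻ φ ζ) := integral_integral_swap i2
    _ = _ := by
        refine integral_congr_ae (Eventually.of_forall fun ζ => ?_)
        simp only [specConv]
        rw [← integral_mul_const]
        refine integral_congr_ae (Eventually.of_forall fun ξ => ?_)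
        ring

/-- If `1 + |ξ| ≤ 1 + |ζ - ξ|`, the constant term suffices. Otherwise the ratio of the two exceeds 1
and is at most its `k`-th power. The two terms match the kernels `k1` and `k2 b` in `young`. -/
theorem one_add_norm_le_peetre {k : ℕ} (hk : k ≠ 0) (ζ ξ : Space d) :
    1 + ‖ζ‖ ≤ (2 + 2 * (1 + ‖ξ‖) ^ k * ((1 + ‖ζ - ξ‖) ^ k)⁻¹) * (1 + ‖ζ - ξ‖) := by
  have h0 : ‖ζ‖ ≤ ‖ξ‖ + ‖ζ - ξ‖ := by
    simpa using norm_add_le ξ (ζ - ξ)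
  set A := 1 + ‖ξ‖ with hA
  set B := 1 + ‖ζ - ξ‖ with hB
  have hA1 : 1 ≤ A := by simp [hA]
  have hB1 : 1 ≤ B := by simp [hB]
  have hs : 1 + ‖ζ‖ ≤ A + B := by rw [hA, hB]; linarith
  have hpos : 0 ≤ 2 * A ^ k * (B ^ k)⁻¹ := by positivity
  rcases le_total A B with h | h
  · nlinarith
  · have h1 : A / B ≤ (A / B) ^ k :=
      le_self_pow₀ ((one_le_div (by linarith)).2 h) hk
    have h2 : A ≤ A ^ k * (B ^ k)⁻¹ * B := by
      rw [← div_eq_mul_inv, ← div_pow]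
      rwa [div_le_iff₀ (by linarith)] at h1
    nlinarith

/-- The weight `1 + |ζ|` is distributed over the factors by the Peetre type inequality, and `young`
with shift `a = -1` bounds the weighted convolution. -/
theorem memLp_dW_specConv {k : ℕ} (hk : d < 2 * k) {N W : Space d → ℂ} (hN : Dec 1 N)
    (hW : Dec k W) (j : Fin d) : MemLp (dW j (specConv W N)) 2 := by
  have hWm := hW.1
  have hNm := hN.1
  have hWi := hW.integrable hk
  have hms : Measurable (specConv W N) := by
    have a1 : Measurable (fun q : Space d × Space d => N (q.1 - q.2)) :=
      hNm.comp (measurable_fst.sub measurable_snd)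
    have a2 : Measurable (fun q : Space d × Space d => W q.2 * N (q.1 - q.2)) :=
      (hWm.comp measurable_snd).mul a1
    exact a2.stronglyMeasurable.integral_prod_right'.measurable
  have hmd := measurable_dW hms j
  rw [← memLp_norm_iff hmd.aestronglyMeasurable]
  set k1 : Space d → ℝ≥0∞ := fun ξ => ENNReal.ofReal 2 * ‖W ξ‖ₑ with hk1
  set k2 : Space d → ℝ≥0∞ := fun ξ => ENNReal.ofReal 2 * ‖(1 + ‖ξ‖) ^ k * ‖W ξ‖‖ₑ with hk2
  set b : Space d → ℝ≥0∞ := fun η => ‖((1 + ‖η‖) ^ k)⁻¹‖ₑ with hb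
  set u : Space d → ℝ≥0∞ := fun η => ‖(1 + ‖η‖) ^ 1 * ‖N η‖‖ₑ with hu
  have hpt : ∀ ζ, ‖‖dW j (specConv W N) ζ‖‖ₑ ≤ ENNReal.ofReal (2 * Real.pi) *
      ∫⁻ ξ, (k1 ξ + k2 ξ * b (ζ + (-1 : ℝ) • ξ)) * u (ζ + (-1 : ℝ) • ξ) := fun ζ => by
    have h1 : ‖‖dW j (specConv W N) ζ‖‖ₑ
        ≤ ENNReal.ofReal (2 * Real.pi) * (ENNReal.ofReal (1 + ‖ζ‖) * ‖specConv W N ζ‖ₑ) := by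
      rw [Real.enorm_of_nonneg (norm_nonneg _), ← ofReal_norm,
        ← ENNReal.ofReal_mul (by positivity), ← ENNReal.ofReal_mul (by positivity)]
      refine ENNReal.ofReal_le_ofReal ((norm_dW_le _ j ζ).trans ?_)
      rw [mul_assoc]
      gcongr
      linarith
    refine h1.trans ?_
    gcongr
    refine (mul_le_mul_right (enorm_integral_le_lintegral_enorm _) _).trans ?_
    rw [← lintegral_const_mul' _ _ ENNReal.ofReal_ne_top]
    refine lintegral_mono fun ξ => ?_
    simp only [hk1, hk2, hb, hu, neg_smul, one_smul, ← sub_eq_add_neg, pow_one, enorm_mul,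
      enorm_norm]
    have e1 : ENNReal.ofReal (1 + ‖ζ‖) ≤ (ENNReal.ofReal 2 + ENNReal.ofReal 2 * ‖(1 + ‖ξ‖) ^ k‖ₑ * ‖((1 + ‖ζ - ξ‖) ^ k)⁻¹‖ₑ)
        * ‖1 + ‖ζ - ξ‖‖ₑ := by
      rw [Real.enorm_of_nonneg (by positivity), Real.enorm_of_nonneg (by positivity),
        Real.enorm_of_nonneg (by positivity),
        ← ENNReal.ofReal_mul (by positivity), ← ENNReal.ofReal_mul (by positivity),
        ← ENNReal.ofReal_add (by positivity) (by positivity), ← ENNReal.ofReal_mul (by positivity)]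
      exact ENNReal.ofReal_le_ofReal (one_add_norm_le_peetre (by omega) ζ ξ)
    calc ENNReal.ofReal (1 + ‖ζ‖) * (‖W ξ‖ₑ * ‖N (ζ - ξ)‖ₑ)
        ≤ ((ENNReal.ofReal 2 + ENNReal.ofReal 2 * ‖(1 + ‖ξ‖) ^ k‖ₑ * ‖((1 + ‖ζ - ξ‖) ^ k)⁻¹‖ₑ)
          * ‖1 + ‖ζ - ξ‖‖ₑ) * (‖W ξ‖ₑ * ‖N (ζ - ξ)‖ₑ) := by gcongr
      _ = _ := by ring
  refine memLp_two_of_lintegral hmd.norm.aestronglyMeasurable ?_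
  have hy := young (a := -1) (by norm_num) (k1 := k1) (k2 := k2) (b := b) (u := u)
    (by fun_prop) (by fun_prop) (by fun_prop) (by fun_prop)
  calc ∫⁻ ζ, ‖‖dW j (specConv W N) ζ‖‖ₑ ^ 2
      ≤ ∫⁻ ζ, ENNReal.ofReal (2 * Real.pi) ^ 2 *
        (∫⁻ ξ, (k1 ξ + k2 ξ * b (ζ + (-1 : ℝ) • ξ)) * u (ζ + (-1 : ℝ) • ξ)) ^ 2 := by
        refine lintegral_mono fun ζ => ?_
        rw [← mul_pow]
        gcongr
        exact hpt ζ
    _ = ENNReal.ofReal (2 * Real.pi) ^ 2 *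
        ∫⁻ ζ, (∫⁻ ξ, (k1 ξ + k2 ξ * b (ζ + (-1 : ℝ) • ξ)) * u (ζ + (-1 : ℝ) • ξ)) ^ 2 :=
        lintegral_const_mul' _ _ (ENNReal.pow_ne_top ENNReal.ofReal_ne_top)
    _ < ⊤ := by
        have l1 : ∫⁻ ξ, k1 ξ < ⊤ := by
          rw [hk1, lintegral_const_mul' _ _ (by simp)]
          exact ENNReal.mul_lt_top (by simp) hWi.2
        have l2 : ∫⁻ ξ, k2 ξ ^ 2 < ⊤ := by
          simp only [hk2, mul_pow]
          rw [lintegral_const_mul' _ _ (by simp)]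
          exact ENNReal.mul_lt_top (by simp) (lintegral_sq_lt_top hW.2)
        have l3 : ∫⁻ v, b v ^ 2 < ⊤ := lintegral_sq_lt_top (memLp_one_add_norm_pow_inv hk)
        have l4 : ∫⁻ v, u v ^ 2 < ⊤ := lintegral_sq_lt_top hN.2
        refine ENNReal.mul_lt_top (by finiteness) (hy.trans_lt ?_)
        refine (ENNReal.mul_lt_top (ENNReal.mul_lt_top (by finiteness)
          (ENNReal.add_lt_top.2 ⟨ENNReal.pow_lt_top l1, ENNReal.mul_lt_top ENNReal.ofReal_lt_top
            (ENNReal.mul_lt_top l2 l3)⟩)) l4)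

theorem memLp_mul_pot {n : Space d → ℝ} (hn : MemLp n 2) {W : Space d → ℂ} (hW : Integrable W)
    (hm : Measurable W) : MemLp (fun x => n x * pot W x) 2 := by
  refine (hn.const_mul (∫ ξ, ‖W ξ‖)).mono (hn.1.mul (continuous_pot hW hm).aestronglyMeasurable)
    (Eventually.of_forall fun x => ?_)
  rw [norm_mul, norm_mul, mul_comm, Real.norm_eq_abs (pot W x)]
  gcongr
  exact (abs_pot_le hW x).trans (le_abs_self _)

/-- For `2k > d` the product of a function in H¹ with one in H^k has L² weak derivatives. It is used
for `n ∂_r∂_sV`, where the Hessian itself has only `k` derivatives. -/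
theorem MemH.exists_weakDeriv_mul_pot {k : ℕ} (hk : d < 2 * k) {n : Space d → ℝ} (hn : MemH 1 n)
    {W : Space d → ℂ} (hW : Dec k W) (hH : Herm W) (j : Fin d) :
    ∃ g : Space d → ℝ, MemLp g 2 ∧ IsWeakDeriv j (fun x => n x * pot W x) g := by
  obtain ⟨h2, N, hN, -, hI⟩ := hn.exists_isInvFT
  have hWi := hW.integrable hk
  exact IsInvFT.exists_weakDeriv (memLp_mul_pot h2 hWi hW.1)
    (isInvFT_mul_pot h2 hI hN.1 hN.memLp hWi hW.1 hH) j (memLp_dW_specConv hk hN hW j)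

/-! ### Regularity of the bulk flow -/

theorem memY_prod {q f : Space d → ℝ} (hq : MemLp q 2) (hf : Rapid f) (j : ℕ) :
    MemY j (fun p => q p.1 * f p.2) := by
  refine (memLp_prod_mul hq (hf.memLp_pow j)).ae_eq (Eventually.of_forall fun p => ?_)
  simp only
  ring

section Resolvent

variable {c : Constants} (hc : c.Pos) {k : ℕ} {W : Space d → ℂ} (h : Admissible k W)
include hc h

theorem exists_solvesK {l : ℕ} (hkl : k ≤ l) (hl : l ≤ k + 2) {s : Phase d → ℝ} (hs : MemY l s) :
    ∃ w, MemY l w ∧ SolvesK c.shift c.ampl c.nu W w s := by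
  obtain ⟨C, -, H⟩ := exists_resolvent (β := c.ampl) hc.shift_ne hc.2.2.2 h.integrable
    h.integrable_norm_mul h.herm (j := l) (by have := h.dim; omega) (h.dec.mono hl)
  obtain ⟨w, -, hw, hS, -⟩ := H s hs
  exact ⟨w, hw, hS⟩

theorem solvesK_unique {w w' s : Phase d → ℝ} (hw : MemLp w 2) (hw' : MemLp w' 2)
    (hs : MemLp s 2) (h1 : SolvesK c.shift c.ampl c.nu W w s)
    (h2 : SolvesK c.shift c.ampl c.nu W w' s) : w =ᵐ[volume] w' :=
  SolvesK.unique hc.shift_ne hc.2.2.2 h.integrable h.measurable h.herm hw hw' hs h1 h2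
    EventuallyEq.rfl

theorem memY_opK_dW (j : Fin d) {l : ℕ} (hkl : k ≤ l) (hl : l ≤ k + 1) {w : Phase d → ℝ}
    (hw : MemY l w) : MemY l (opK c.shift c.ampl (dW j W) w) :=
  opK_memY hc.shift_ne (h.integrable_dW j) (h.integrable_norm_mul_dW j)
    (by have := h.dim; omega) ((h.dec_dW j).mono hl) hw

/-- Weak position derivatives of solutions of the stationary equation. -/
theorem SolvesK.exists_weakX {j : Fin d} {l : ℕ} (hkl : k ≤ l) (hl : l ≤ k + 1)
    {w s sj : Phase d → ℝ} (hw : MemY l w) (hs : MemLp s 2) (hsj : MemY l sj)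
    (hS : SolvesK c.shift c.ampl c.nu W w s) (hd : IsWeakX j s sj) :
    ∃ y, MemY l y ∧ IsWeakX j w y ∧
      SolvesK c.shift c.ampl c.nu W y (fun p => sj p + opK c.shift c.ampl (dW j W) w p) := by
  -- The graph argument gives a derivative in plain L². The weighted resolvent gives a weighted
  -- solution of the same equation, and uniqueness in L² identifies the two.
  obtain ⟨w', y', hw', hy', hX, h1, h2⟩ := exists_weakX_resolvent (β := c.ampl) hc.shift_ne
    hc.2.2.2 h.integrable h.measurable h.herm (h.integrable_dW j) hs hsj.memLp hd
  have e : w' =ᵐ[volume] w := solvesK_unique hc h hw' hw.memLp hs h1 hS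
  have hsrc : MemY l (fun p => sj p + opK c.shift c.ampl (dW j W) w p) :=
    hsj.add (memY_opK_dW hc h j hkl hl hw)
  obtain ⟨y, hy, hyS⟩ := exists_solvesK hc h hkl (by omega) hsrc
  have e2 : (fun p => sj p + opK c.shift c.ampl (dW j W) w' p)
      =ᵐ[volume] fun p => sj p + opK c.shift c.ampl (dW j W) w p := by
    filter_upwards [opK_congr hc.shift_ne c.ampl (dW j W) e] with p hp
    rw [hp]
  have e3 : y' =ᵐ[volume] y := solvesK_unique hc h hy' hy.memLp hsrc.memLp
    (h2.congr hc.shift_ne EventuallyEq.rfl e2) hyS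
  exact ⟨y, hy, hX.congr e e3, hyS⟩

theorem SolvesK.add {w w' s s' : Phase d → ℝ} (hw : MemLp w 2) (hw' : MemLp w' 2)
    (h1 : SolvesK c.shift c.ampl c.nu W w s) (h2 : SolvesK c.shift c.ampl c.nu W w' s') :
    SolvesK c.shift c.ampl c.nu W (fun p => w p + w' p) (fun p => s p + s' p) := by
  obtain ⟨v, hv, ev⟩ := hw.1
  obtain ⟨v', hv', ev'⟩ := hw'.1
  have e : (fun p => w p + w' p) =ᵐ[volume] fun p => v p + v' p := by
    filter_upwards [ev, ev'] with p a b
    rw [a, b]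
  have kb := kerBd_ker c.shift c.ampl h.measurable
  have kc := kerConst_ker_lt_top c.shift c.ampl h.integrable
  unfold SolvesK at *
  filter_upwards [h1, h2, opK_congr hc.shift_ne c.ampl W e, opK_congr hc.shift_ne c.ampl W ev,
    opK_congr hc.shift_ne c.ampl W ev',
    kb.integrable hc.shift_ne kc hv.measurable ((memLp_congr_ae ev).1 hw),
    kb.integrable hc.shift_ne kc hv'.measurable ((memLp_congr_ae ev').1 hw')]
    with p a1 a2 a3 a4 a5 i1 i2
  have e3 : opK c.shift c.ampl W (fun p => v p + v' p) p
      = opK c.shift c.ampl W v p + opK c.shift c.ampl W v' p := by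
    simp only [opK, kint, mul_add]
    exact integral_add i1 i2
  rw [a3, e3, ← a4, ← a5, ← a1, ← a2]
  ring

theorem SolvesK.sum {ι : Type*} (t : Finset ι) {w s : ι → Phase d → ℝ}
    (hw : ∀ i ∈ t, MemLp (w i) 2) (h1 : ∀ i ∈ t, SolvesK c.shift c.ampl c.nu W (w i) (s i)) :
    SolvesK c.shift c.ampl c.nu W (fun p => ∑ i ∈ t, w i p) (fun p => ∑ i ∈ t, s i p) := by
  classical
  induction t using Finset.induction_on with
  | empty =>
    refine Eventually.of_forall fun p => ?_
    simp [opK, kint]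
  | insert a t ha ih =>
    simp only [Finset.sum_insert ha]
    refine SolvesK.add hc h (hw a (Finset.mem_insert_self a t))
      (memLp_finsetSum t fun i hi => hw i (Finset.mem_insert_of_mem hi))
      (h1 a (Finset.mem_insert_self a t))
      (ih (fun i hi => hw i (Finset.mem_insert_of_mem hi))
        fun i hi => h1 i (Finset.mem_insert_of_mem hi))

/-- The local equilibrium of an `H¹` density is weakly differentiable in position. -/
theorem exists_weakX_eqSrc {n : Space d → ℝ} (hn : MemH 1 n) (j : Fin d) (l : ℕ) :
    ∃ sj, MemY l sj ∧ IsWeakX j (fun p => c.nu * eqSrc c W n p) sj := by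
  have hn2 : MemLp n 2 := hn.exists_isInvFT.1
  obtain ⟨nj, hnj, hnjw⟩ := hn.exists_weakDeriv j
  have hg : ∀ r s, ∃ g : Space d → ℝ, MemLp g 2 ∧
      IsWeakDeriv j (fun x => n x * pot (dW r (dW s W)) x) g := fun r s =>
    hn.exists_weakDeriv_mul_pot h.dim (h.dec_dW_dW r s) ((h.herm.dW s).dW r) j
  choose g hg2 hgw using hg
  have hnH : ∀ r s, MemLp (fun x => n x * pot (dW r (dW s W)) x) 2 := fun r s =>
    memLp_mul_pot hn2 (h.integrable_dW_dW r s) (measurable_dW (measurable_dW h.measurable s) r)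
  have hFr := hc.rapid_maxwellian (d := d)
  have hHr := fun r s => hc.rapid_maxwellianHess (d := d) r s
  have y1 : ∀ r s, MemY l (fun p : Phase d => g r s p.1 * maxwellianHess c r s p.2) :=
    fun r s => memY_prod (hg2 r s) (hHr r s) l
  have y0 : ∀ r s, MemY l (fun p : Phase d =>
      (n p.1 * pot (dW r (dW s W)) p.1) * maxwellianHess c r s p.2) :=
    fun r s => memY_prod (hnH r s) (hHr r s) l
  have d1 : ∀ r s, IsWeakX j (fun p : Phase d =>
      (n p.1 * pot (dW r (dW s W)) p.1) * maxwellianHess c r s p.2)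
      (fun p => g r s p.1 * maxwellianHess c r s p.2) := fun r s =>
    (hgw r s).isWeakX (hnH r s) (hg2 r s) (hHr r s).memLp
  have y1s : ∀ r, MemY l (fun p : Phase d => ∑ s, g r s p.1 * maxwellianHess c r s p.2) :=
    fun r => MemY.sum _ fun s _ => y1 r s
  have y0s : ∀ r, MemY l (fun p : Phase d => ∑ s,
      (n p.1 * pot (dW r (dW s W)) p.1) * maxwellianHess c r s p.2) :=
    fun r => MemY.sum _ fun s _ => y0 r s
  have d2 := IsWeakX.sum Finset.univ (fun r _ => IsWeakX.sum Finset.univ (fun s _ => d1 r s)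
    (fun s _ => (y0 r s).memLp) (fun s _ => (y1 r s).memLp))
    (fun r _ => (y0s r).memLp) (fun r _ => (y1s r).memLp)
  have Y1 : MemY l (fun p : Phase d => ∑ r, ∑ s, g r s p.1 * maxwellianHess c r s p.2) :=
    MemY.sum _ fun r _ => y1s r
  have Y0 : MemY l (fun p : Phase d => ∑ r, ∑ s,
      (n p.1 * pot (dW r (dW s W)) p.1) * maxwellianHess c r s p.2) :=
    MemY.sum _ fun r _ => y0s r
  have d3 := ((hnjw.isWeakX hn2 hnj hFr.memLp).add (d2.const_mul c.coef)
    (memLp_prod_mul hn2 hFr.memLp) (Y0.const_mul c.coef).memLp (memLp_prod_mul hnj hFr.memLp)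
    (Y1.const_mul c.coef).memLp).const_mul c.nu
  refine ⟨_, ((memY_prod hnj hFr l).add (Y1.const_mul c.coef)).const_mul c.nu, d3.congr
    (Eventually.of_forall fun p => ?_) EventuallyEq.rfl⟩
  simp only [eqSrc, eqFib, hessW, mul_add, Finset.mul_sum]
  congr 1
  refine Finset.sum_congr rfl fun r _ => Finset.sum_congr rfl fun s _ => ?_
  ring

end Resolvent

/-! ### The operators `P`, `Q`, `S` on weighted functions -/

theorem opP_ae {c : Constants} {V : Space d → ℝ} {f : Phase d → ℝ} {N : Space d → ℝ} (hf : density f =ᵐ[volume] N) :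
    opP c V f =ᵐ[volume] fun p => N p.1 * profile c V p := by
  filter_upwards [ae_of_ae_fst hf] with p hp
  rw [opP, hp, mul_comm]

theorem opQ_ae_self {c : Constants} {V : Space d → ℝ} {ψ : Phase d → ℝ} (hψ : density ψ =ᵐ[volume] 0) : opQ c V ψ =ᵐ[volume] ψ := by
  filter_upwards [opP_ae hψ] with p hp
  rw [opQ, hp]
  simp

section Operators

variable {c : Constants} (hc : c.Pos) {k : ℕ} {W : Space d → ℂ} (h : Admissible k W)
  {V : Space d → ℝ} (hVW : V =ᵐ[volume] pot W)
include hc h hVW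

theorem memY_mul_profile {q : Space d → ℝ} (hq : MemLp q 2) :
    MemY (k + 2) (fun p => q p.1 * profile c V p) ∧
      SolvesK c.shift c.ampl c.nu W (fun p => q p.1 * profile c V p)
        (fun p => c.nu * eqSrc c W q p) := by
  obtain ⟨C, -, H⟩ := exists_profile_bound hc h hVW (j := k + 2) (by omega) le_rfl
  exact ⟨(H q hq).1, (H q hq).2.1⟩

theorem density_mul_profile {q : Space d → ℝ} (hq : MemLp q 2) :
    density (fun p => q p.1 * profile c V p) =ᵐ[volume] q := by
  obtain ⟨hY, hS⟩ := memY_mul_profile hc h hVW hq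
  filter_upwards [hS.density hc h (hY.mono (by omega))] with x hx
  rw [density_const_mul, density_eqSrc hc] at hx
  exact (mul_left_cancel₀ hc.2.2.2.ne' hx).symm

theorem density_coord_mul_profile {q : Space d → ℝ} (hq : MemLp q 2) (i : Fin d) :
    density (fun p => p.2 i * (q p.1 * profile c V p)) =ᵐ[volume]
      fun x => -(1 / (c.nu * c.mass)) * (q x * pot (dW i W) x) := by
  obtain ⟨hY, hS⟩ := memY_mul_profile hc h hVW hq
  filter_upwards [hS.density_coord hc h (hY.mono (by omega)) i,
    density_mul_profile hc h hVW hq] with x h1 h2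
  have e : (fun p : Phase d => p.2 i * (c.nu * eqSrc c W q p))
      = fun p => c.nu * (p.2 i * eqSrc c W q p) := by
    ext p; ring
  rw [e, density_const_mul, density_coord_eqSrc hc, h2] at h1
  have h3 := hc.2.2.1.ne'
  have h4 := hc.2.2.2.ne'
  field_simp at h1 ⊢
  linear_combination -h1

/-- A function of zero density is fixed by `Q` and annihilated by `Ω`. Since `Θ` produces zero
density, the outer `Q` acts as the identity as well, and only `Θ - ν` is left. -/
theorem opQACQ_ae (hV : MemLp V 2) {ψ : Phase d → ℝ} (hψ : MemX0 k ψ) :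
    opQACQ c V ψ =ᵐ[volume] fun p => opK c.shift c.ampl W ψ p - c.nu * ψ p := by
  have hY : MemY k ψ := memX_iff_memY.1 hψ.1
  have e1 : opQ c V ψ =ᵐ[volume] ψ := opQ_ae_self hψ.2
  have hYQ : MemY k (opQ c V ψ) := hY.congr e1.symm
  have dQ : density (opQ c V ψ) =ᵐ[volume] 0 := (density_congr e1).trans hψ.2
  have e2 : opAC c V (opQ c V ψ) =ᵐ[volume]
      fun p => opK c.shift c.ampl W ψ p - c.nu * ψ p := by
    filter_upwards [opA_ae_eq_opK hc h hV hVW hYQ, opK_congr hc.shift_ne c.ampl W e1, e1,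
      ae_of_ae_fst dQ] with p a1 a2 a3 a4
    rw [opAC, opC, opOmega, a1, a2, a3, a4]
    simp only [Pi.zero_apply]
    ring
  have e3 : density (opAC c V (opQ c V ψ)) =ᵐ[volume] 0 := by
    filter_upwards [density_congr e2, hY.ae_fiber_integrable h.dim, hψ.2,
      ae_fiber_integrable_opK hc.shift_ne c.ampl h.dim h.integrable h.measurable hY,
      density_opK hc.shift_ne c.ampl h.dim h.integrable h.measurable hY] with x b1 b2 b3 b4 b5
    rw [b1]
    simp only [density] at b3 b5 ⊢
    rw [integral_sub b4 (b2.const_mul _), b5, h.herm.integral_ker, integral_const_mul, b3]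
    simp
  exact (opQ_ae_self e3).trans e2

theorem opQACQ_ae_iff (hV : MemLp V 2) {ψ r : Phase d → ℝ} (hψ : MemX0 k ψ) :
    opQACQ c V ψ =ᵐ[volume] r ↔ SolvesK c.shift c.ampl c.nu W ψ (fun p => -r p) := by
  have e := opQACQ_ae hc h hVW hV hψ
  constructor
  · intro h1
    filter_upwards [e, h1] with p a b
    rw [← b, a]
    ring
  · intro h1
    refine e.trans ?_
    filter_upwards [h1] with p a
    linarith

theorem isQACQInv_of_solvesK (hV : MemLp V 2) {ψ r : Phase d → ℝ} (hr : MemX0 k r)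
    (hψ : MemX0 k ψ) (hS : SolvesK c.shift c.ampl c.nu W ψ (fun p => -r p)) :
    IsQACQInv c V k r ψ := by
  refine ⟨hr, hψ, (opQACQ_ae_iff hc h hVW hV hψ).2 hS, fun ψ' hψ' e => ?_⟩
  refine solvesK_unique hc h (memX_iff_memY.1 hψ'.1).memLp (memX_iff_memY.1 hψ.1).memLp
    (memX_iff_memY.1 hr.1).memLp.neg ((opQACQ_ae_iff hc h hVW hV hψ').1 e) hS

end Operators

theorem IsS.unique {k : ℕ} {w w' f f' : Phase d → ℝ} (hS : IsS k w f) (hS' : IsS k w' f')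
    (hw : w =ᵐ[volume] w') : f =ᵐ[volume] f' := by
  have hf : MemLp f 2 := (memX_iff_memY.1 hS.2.1).memLp
  have hf' : MemLp f' 2 := (memX_iff_memY.1 hS'.2.1).memLp
  refine ae_eq_of_integral_contDiff_smul_eq (hf.locallyIntegrable (by norm_num))
    (hf'.locallyIntegrable (by norm_num)) fun Φ h1 h2 => ?_
  have e1 := hS.2.2 Φ ⟨h1, h2⟩
  have e2 := hS'.2.2 Φ ⟨h1, h2⟩
  have e3 : ∫ p, w p * ∑ i, p.2 i * fderiv ℝ Φ p (EuclideanSpace.single i 1, 0)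
      = ∫ p, w' p * ∑ i, p.2 i * fderiv ℝ Φ p (EuclideanSpace.single i 1, 0) :=
    integral_congr_ae (hw.mono fun p hp => by simp only [hp])
  simp only [smul_eq_mul, mul_comm (Φ _)]
  rw [e1, e2, e3]

theorem isS_of_isWeakX {k : ℕ} {w : Phase d → ℝ} {y : Fin d → Phase d → ℝ} (hw : MemY (k + 1) w)
    (hy : ∀ j, MemY (k + 1) (y j)) (hX : ∀ j, IsWeakX j w (y j)) :
    IsS k w (fun p => -∑ j, p.2 j * y j p) := by
  have hv : ∀ j, MemY k (fun p => p.2 j * y j p) := fun j => (hy j).coord_mul j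
  have hs : MemY k (fun p => ∑ j, p.2 j * y j p) := MemY.sum _ fun j _ => hv j
  refine ⟨memX_iff_memY.2 (hw.mono (by omega)), memX_iff_memY.2 ?_, fun Φ hΦ => ?_⟩
  · simpa using hs.const_mul (-1)
  · have hd : ∀ j, Integrable (fun p => p.2 j * w p * dX j Φ p) := fun j =>
      integrable_mul_test (MemY.memLp (hw.coord_mul j)) (hΦ.dX j)
    simp only [neg_mul, Finset.sum_mul, integral_neg]
    rw [integral_finsetSum _ fun j _ => integrable_mul_test (hv j).memLp hΦ]
    have e : ∀ j, ∫ p, p.2 j * y j p * Φ p = -∫ p, p.2 j * w p * dX j Φ p := fun j =>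
      (hX j).coord_mul j Φ hΦ
    simp only [e, Finset.sum_neg_distrib, neg_neg]
    rw [← integral_finsetSum _ fun j _ => hd j]
    refine integral_congr_ae (Eventually.of_forall fun p => ?_)
    simp only [Finset.mul_sum, dX]
    refine Finset.sum_congr rfl fun j _ => ?_
    ring

theorem IsWeakX.integral_density {k : ℕ} (hk : d < 2 * k) {j : Fin d} {w y : Phase d → ℝ}
    (hX : IsWeakX j w y) (hw : MemY k w) (hy : MemY k y) {χ : Space d → ℝ} (hχ : IsTest χ) :
    ∫ x, density y x * χ x = -∫ x, density w x * partialD j χ x := by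
  rw [← (hy.integral_mul_fst_symm hk hχ.memLp_space).2,
    ← (hw.integral_mul_fst_symm hk (hχ.partialD j).memLp_space).2, ← integral_neg]
  exact integral_congr_ae (hX.slice hk hw hy hχ)

/-- The stream functional of a sum of weak derivatives. -/
theorem stream_eq {k : ℕ} (hk : d < 2 * k) {u Y : Fin d → Phase d → ℝ} {z ψ : Phase d → ℝ}
    (hu : ∀ j, MemY (k + 1) (u j)) (hY : ∀ j, MemY k (Y j)) (hX : ∀ j, IsWeakX j (u j) (Y j))
    (hz : MemY (k + 1) z) (hψ : ψ =ᵐ[volume] fun p => (∑ j, Y j p) + z p)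
    {χ : Space d → ℝ} (hχ : IsTest χ) :
    Integrable (fun v : Space d => ∫ x, ψ (x, v) * ∑ i, v i * partialD i χ x) ∧
    ∫ v : Space d, ∫ x, ψ (x, v) * ∑ i, v i * partialD i χ x
      = ∑ i, (-(∑ j, ∫ x, density (fun p => p.2 i * u j p) x * partialD j (partialD i χ) x)
        + ∫ x, density (fun p => p.2 i * z p) x * partialD i χ x) := by
  have hd := fun i => hχ.partialD i
  -- `Y_j` carries only `k` velocity weights, which do not make `v_i Y_j` integrable. At fixed
  -- velocity the derivative is first moved onto the test function; `u_j`, with `k + 1` weights,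
  -- then allows the factor `v_i`.
  have s1 : ∀ i j, ∀ᵐ v : Space d, ∫ x, Y j (x, v) * partialD i χ x
      = -∫ x, u j (x, v) * partialD j (partialD i χ) x := fun i j =>
    (hX j).slice hk ((hu j).mono (by omega)) (hY j) (hd i)
  have s2 : ∀ i j, ∀ᵐ v : Space d, Integrable (fun x => Y j (x, v) * partialD i χ x) := fun i j => by
    have := (hY j).integrable_mul_fst hk (hd i).memLp_space
    rw [Measure.volume_eq_prod] at this
    exact this.prod_left_ae
  have s3 : ∀ i, ∀ᵐ v : Space d, Integrable (fun x => z (x, v) * partialD i χ x) := fun i => by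
    have := (hz.mono (by omega : k ≤ k + 1)).integrable_mul_fst hk (hd i).memLp_space
    rw [Measure.volume_eq_prod] at this
    exact this.prod_left_ae
  have s4 : ∀ᵐ v : Space d, ∀ᵐ x : Space d, ψ (x, v) = ∑ j, Y j (x, v) + z (x, v) := by
    have h1 : ∀ᵐ q : Space d × Space d, ψ q.swap = ∑ j, Y j q.swap + z q.swap := by
      rw [Measure.volume_eq_prod]
      exact (Measure.measurePreserving_swap (μ := (volume : Measure (Space d)))
        (ν := (volume : Measure (Space d)))).quasiMeasurePreserving.ae (by
        rw [← Measure.volume_eq_prod]; exact hψ)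
    rw [Measure.volume_eq_prod] at h1
    exact Measure.ae_ae_of_ae_prod h1
  have t1 := fun i j => (MemY.coord_mul (hu j) i).integral_mul_fst_symm hk
    ((hd i).partialD j).memLp_space
  have t2 := fun i => (MemY.coord_mul hz i).integral_mul_fst_symm hk (hd i).memLp_space
  have key : (fun v : Space d => ∫ x, ψ (x, v) * ∑ i, v i * partialD i χ x) =ᵐ[volume]
      fun v => ∑ i, (-(∑ j, ∫ x, (v i * u j (x, v)) * partialD j (partialD i χ) x)
        + ∫ x, (v i * z (x, v)) * partialD i χ x) := by
    have s1' : ∀ᵐ v : Space d, ∀ i j, ∫ x, Y j (x, v) * partialD i χ x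
        = -∫ x, u j (x, v) * partialD j (partialD i χ) x :=
      ae_all_iff.2 fun i => ae_all_iff.2 fun j => s1 i j
    have s2' := ae_all_iff.2 fun i => ae_all_iff.2 fun j => s2 i j
    filter_upwards [s1', s2', ae_all_iff.2 s3, s4] with v h1 h2 h3 h4
    have i1 : ∀ i, Integrable (fun x => v i * (∑ j, Y j (x, v) * partialD i χ x)) := fun i =>
      (integrable_finsetSum _ fun j _ => h2 i j).const_mul _
    have i2 : ∀ i, Integrable (fun x => v i * (z (x, v) * partialD i χ x)) := fun i =>
      (h3 i).const_mul _
    calc ∫ x, ψ (x, v) * ∑ i, v i * partialD i χ x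
        = ∫ x, ∑ i, (v i * (∑ j, Y j (x, v) * partialD i χ x)
            + v i * (z (x, v) * partialD i χ x)) := by
          refine integral_congr_ae (h4.mono fun x hx => ?_)
          simp only [hx]
          rw [Finset.mul_sum]
          refine Finset.sum_congr rfl fun i _ => ?_
          rw [← Finset.sum_mul]
          ring
      _ = ∑ i, (v i * (∑ j, ∫ x, Y j (x, v) * partialD i χ x)
            + v i * ∫ x, z (x, v) * partialD i χ x) := by
          have i3 : ∀ i, Integrable (fun x => v i * (∑ j, Y j (x, v) * partialD i χ x)
              + v i * (z (x, v) * partialD i χ x)) := fun i => (i1 i).add (i2 i)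
          rw [integral_finsetSum _ fun i _ => i3 i]
          refine Finset.sum_congr rfl fun i _ => ?_
          rw [integral_add (i1 i) (i2 i), integral_const_mul, integral_const_mul,
            integral_finsetSum _ fun j _ => h2 i j]
      _ = _ := by
          refine Finset.sum_congr rfl fun i _ => ?_
          simp only [h1, Finset.sum_neg_distrib, mul_assoc, integral_const_mul, Finset.mul_sum,
            mul_neg]
  have J1 : ∀ i, Integrable (fun v : Space d =>
      -(∑ j, ∫ x, (v i * u j (x, v)) * partialD j (partialD i χ) x)) := fun i =>
    (integrable_finsetSum _ fun j _ => (t1 i j).1).neg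
  have J2 : ∀ i, Integrable (fun v : Space d => ∫ x, (v i * z (x, v)) * partialD i χ x) :=
    fun i => (t2 i).1
  have J3 : ∀ i, Integrable (fun v : Space d =>
      -(∑ j, ∫ x, (v i * u j (x, v)) * partialD j (partialD i χ) x)
        + ∫ x, (v i * z (x, v)) * partialD i χ x) := fun i => (J1 i).add (J2 i)
  refine ⟨(integrable_finsetSum _ fun i _ => J3 i).congr key.symm, ?_⟩
  rw [integral_congr_ae key, integral_finsetSum _ fun i _ => J3 i]
  refine Finset.sum_congr rfl fun i _ => ?_
  rw [integral_add (J1 i) (J2 i), integral_neg, integral_finsetSum _ fun j _ => (t1 i j).1]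
  congr 1
  · congr 1
    exact Finset.sum_congr rfl fun j _ => (t1 i j).2
  · exact (t2 i).2

/-! ### The corrector of the bulk flow -/

/-- Data realizing `S P φ` and `(Q (A + C) Q)⁻¹ Q S P φ` for `φ = n M`: here `y` is the position
gradient of `n M`, `-∑ v_j y_j` is `S P φ`, and `∑ Y_j + z` is the corrector, where `Y_j` is the
`j`-th position derivative of `u_j`. -/
structure IsFlow (c : Constants) (V : Space d → ℝ) (W : Space d → ℂ) (k : ℕ) (n : Space d → ℝ)
    (y u Y : Fin d → Phase d → ℝ) (z : Phase d → ℝ) : Prop where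
  memY_y : ∀ j, MemY (k + 1) (y j)
  weakX_y : ∀ j, IsWeakX j (fun p => n p.1 * profile c V p) (y j)
  memY_u : ∀ j, MemY (k + 1) (u j)
  solves_u : ∀ j, SolvesK c.shift c.ampl c.nu W (u j) (fun p => p.2 j * (n p.1 * profile c V p))
  memY_Y : ∀ j, MemY k (Y j)
  weakX_Y : ∀ j, IsWeakX j (u j) (Y j)
  solves_Y : ∀ j, SolvesK c.shift c.ampl c.nu W (Y j)
    (fun p => p.2 j * y j p + opK c.shift c.ampl (dW j W) (u j) p)
  memY_z : MemY (k + 1) z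
  solves_z : SolvesK c.shift c.ampl c.nu W z
    (fun p => -(∑ j, opK c.shift c.ampl (dW j W) (u j) p)
      + density (fun p => -∑ j, p.2 j * y j p) p.1 * profile c V p)

section Flow

variable {c : Constants} (hc : c.Pos) {k : ℕ} {W : Space d → ℂ} (h : Admissible k W)
  {V : Space d → ℝ} (hVW : V =ᵐ[volume] pot W) {n : Space d → ℝ}

theorem memY_neg_sum_coord_mul {y : Fin d → Phase d → ℝ} (hy : ∀ j, MemY (k + 1) (y j)) :
    MemY k (fun p => -∑ j, p.2 j * y j p) := by
  have hs : MemY k (fun p => ∑ j, p.2 j * y j p) := MemY.sum _ fun j _ => (hy j).coord_mul j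
  simpa using hs.const_mul (-1)

include hc h hVW

/-- Bookkeeping of velocity weights: `nM` has `k + 2`. Its derivatives `y_j` have `k + 1`, since
differentiating `Θ[V]` uses `∂_jV`, whose spectral decay is one order lower. The functions `v_j nM`,
`u_j` and `z` also have `k + 1`. -/
theorem exists_isFlow (hn : MemH 1 n) : ∃ y u Y z, IsFlow c V W k n y u Y z := by
  have hn2 : MemLp n 2 := hn.exists_isInvFT.1
  obtain ⟨hw, hS⟩ := memY_mul_profile hc h hVW hn2
  obtain ⟨C, -, HS⟩ := exists_eqSrc_bound hc h k
  have hy : ∀ j, ∃ y, MemY (k + 1) y ∧ IsWeakX j (fun p => n p.1 * profile c V p) y := fun j => by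
    obtain ⟨sj, hsj, hd⟩ := exists_weakX_eqSrc hc h hn j (k + 1)
    obtain ⟨y, h1, h2, -⟩ := SolvesK.exists_weakX hc h (by omega) le_rfl (hw.mono (by omega))
      ((HS n hn2).1.const_mul c.nu).memLp hsj hS hd
    exact ⟨y, h1, h2⟩
  choose y hyY hyX using hy
  have hvw : ∀ j, MemY (k + 1) (fun p => p.2 j * (n p.1 * profile c V p)) := fun j =>
    MemY.coord_mul (j := k + 1) hw j
  choose u huY huS using fun j => exists_solvesK hc h (by omega) (by omega) (hvw j)
  -- The source `v_j y_j` retains only `k` weights, so no more are obtained for `Y_j`.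
  have hY : ∀ j, ∃ Y, MemY k Y ∧ IsWeakX j (u j) Y ∧ SolvesK c.shift c.ampl c.nu W Y
      (fun p => p.2 j * y j p + opK c.shift c.ampl (dW j W) (u j) p) := fun j =>
    SolvesK.exists_weakX hc h le_rfl (by omega) ((huY j).mono (by omega)) (hvw j).memLp
      ((hyY j).coord_mul j) (huS j) ((hyX j).coord_mul j)
  choose Y hYY hYX hYS using hY
  have hN : MemLp (density fun p => -∑ j, p.2 j * y j p) 2 :=
    (memY_neg_sum_coord_mul hyY).memLp_density h.dim
  have hsum : MemY (k + 1) (fun p => ∑ j, opK c.shift c.ampl (dW j W) (u j) p) :=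
    MemY.sum _ fun j _ => memY_opK_dW hc h j (by omega) le_rfl (huY j)
  have hsrc : MemY (k + 1) (fun p => -(∑ j, opK c.shift c.ampl (dW j W) (u j) p)
      + density (fun p => -∑ j, p.2 j * y j p) p.1 * profile c V p) := by
    refine MemY.add ?_ ((memY_mul_profile hc h hVW hN).1.mono (by omega))
    simpa using hsum.const_mul (-1)
  obtain ⟨z, hzY, hzS⟩ := exists_solvesK hc h (by omega) (by omega) hsrc
  exact ⟨y, u, Y, z, hyY, hyX, huY, huS, hYY, hYX, hYS, hzY, hzS⟩

/-- The stress is that of the equilibrium plus the force acting on the first moments. The two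
symmetric force terms coincide, which gives the factor 2. -/
theorem density_coord_coord_mul_profile (hn : MemLp n 2) (i j : Fin d) :
    density (fun p => p.2 i * (p.2 j * (n p.1 * profile c V p))) =ᵐ[volume] fun x =>
      n x * ((if i = j then 1 / (c.beta * c.mass) else 0) + 2 * c.coef * hessW W x i j)
        + 2 / (c.nu * c.mass) ^ 2 * (n x * (pot (dW i W) x * pot (dW j W) x)) := by
  obtain ⟨hw, hS⟩ := memY_mul_profile hc h hVW hn
  filter_upwards [hS.density_coord_coord hc h hw i j, density_coord_mul_profile hc h hVW hn i,
    density_coord_mul_profile hc h hVW hn j] with x h1 h2 h3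
  have e : (fun p : Phase d => p.2 i * (p.2 j * (c.nu * eqSrc c W n p)))
      = fun p => c.nu * (p.2 i * (p.2 j * eqSrc c W n p)) := by
    ext p; ring
  rw [e, density_const_mul, density_coord_coord_eqSrc hc, h2, h3] at h1
  have h4 := hc.2.2.1.ne'
  have h5 := hc.2.2.2.ne'
  generalize (if i = j then 1 / (c.beta * c.mass) else 0) = δ at h1 ⊢
  field_simp at h1 ⊢
  linear_combination -h1

variable {y u Y : Fin d → Phase d → ℝ} {z : Phase d → ℝ} (F : IsFlow c V W k n y u Y z)
  (hn : MemLp n 2)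
include F

omit hc hVW in
theorem IsFlow.memLp_density : MemLp (density fun p => -∑ j, p.2 j * y j p) 2 :=
  (memY_neg_sum_coord_mul F.memY_y).memLp_density h.dim

include hn

theorem IsFlow.isS : IsS k (opP c V (bulk c V n)) (fun p => -∑ j, p.2 j * y j p) := by
  have e : opP c V (bulk c V n) =ᵐ[volume] fun p => n p.1 * profile c V p :=
    opP_ae (density_mul_profile hc h hVW hn)
  have hY := (memY_mul_profile hc h hVW hn).1
  exact isS_of_isWeakX ((hY.mono (by omega)).congr e.symm) F.memY_y
    fun j => (F.weakX_y j).congr e.symm EventuallyEq.rfl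

omit hn in
theorem IsFlow.isQACQInv (hV : MemLp V 2) :
    IsQACQInv c V k (opQ c V fun p => -∑ j, p.2 j * y j p) (fun p => ∑ j, Y j p + z p) := by
  set f : Phase d → ℝ := fun p => -∑ j, p.2 j * y j p with hf
  have hfY : MemY k f := memY_neg_sum_coord_mul F.memY_y
  have hN : MemLp (density f) 2 := F.memLp_density h
  have hP : MemY k (fun p => density f p.1 * profile c V p) :=
    (memY_mul_profile hc h hVW hN).1.mono (by omega)
  have e : (fun p => f p + (-1) * (density f p.1 * profile c V p)) = opQ c V f := by
    ext p
    simp only [opQ, opP]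
    ring
  have hr : MemX0 k (opQ c V f) := by
    rw [← e]
    refine ⟨memX_iff_memY.2 (hfY.add (hP.const_mul (-1))), ?_⟩
    filter_upwards [density_add h.dim hfY (hP.const_mul (-1)),
      density_mul_profile hc h hVW hN] with x h1 h2
    rw [h1, density_const_mul, h2]
    simp
  have hYs : MemY k (fun p => ∑ j, Y j p) := MemY.sum _ fun j _ => F.memY_Y j
  have hψ : MemY k (fun p => ∑ j, Y j p + z p) := hYs.add (F.memY_z.mono (by omega))
  -- Adding the equations, the commutators `Θ[∂_jV]u_j` cancel between `Y_j` and `z`. What remains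
  -- is `∑ v_j y_j + n[f]M = -Qf`.
  have hS : SolvesK c.shift c.ampl c.nu W (fun p => ∑ j, Y j p + z p)
      (fun p => -opQ c V f p) := by
    refine (SolvesK.add hc h hYs.memLp F.memY_z.memLp
      (SolvesK.sum hc h Finset.univ (fun j _ => (F.memY_Y j).memLp) fun j _ => F.solves_Y j)
      F.solves_z).congr hc.shift_ne EventuallyEq.rfl (Eventually.of_forall fun p => ?_)
    simp only [opQ, opP, Finset.sum_add_distrib, ← hf]
    simp only [hf]
    ring
  refine isQACQInv_of_solvesK hc h hVW hV hr ⟨memX_iff_memY.2 hψ, ?_⟩ hS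
  have hrY : MemY k (opQ c V f) := memX_iff_memY.1 hr.1
  filter_upwards [hS.density hc h hψ, hr.2] with x h1 h2
  have h3 : density (fun p => -opQ c V f p) x = -density (opQ c V f) x := integral_neg _
  rw [h3, h2, Pi.zero_apply, neg_zero] at h1
  simpa [hc.2.2.2.ne'] using h1.symm

/-- The derivative is shifted to the test function, leaving the first moment of `nM`, which is the
drift flux. -/
theorem IsFlow.integral_density {χ : Space d → ℝ} (hχ : IsTest χ) :
    ∫ x, density (fun p => -∑ j, p.2 j * y j p) x * χ x
      = ∑ l, ∫ x, -(1 / (c.nu * c.mass)) * (n x * pot (dW l W) x) * partialD l χ x := by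
  have hw := (memY_mul_profile hc h hVW hn).1
  have e : ∀ j, ∫ x, density (fun p => p.2 j * y j p) x * χ x
      = -∫ x, -(1 / (c.nu * c.mass)) * (n x * pot (dW j W) x) * partialD j χ x := fun j => by
    rw [((F.weakX_y j).coord_mul j).integral_density h.dim
      ((MemY.coord_mul (j := k + 1) hw j).mono (by omega)) ((F.memY_y j).coord_mul j) hχ]
    congr 1
    refine integral_congr_ae ?_
    filter_upwards [density_coord_mul_profile hc h hVW hn j] with x hx
    rw [hx]
  have i1 : ∀ j, Integrable (fun x => density (fun p => p.2 j * y j p) x * χ x) := fun j =>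
    (((F.memY_y j).coord_mul j).memLp_density h.dim).integrable_mul hχ.memLp_space
  have e2 : ∫ x, density (fun p => -∑ j, p.2 j * y j p) x * χ x
      = ∫ x, -∑ j, density (fun p => p.2 j * y j p) x * χ x := by
    refine integral_congr_ae ?_
    filter_upwards [density_sum Finset.univ h.dim fun j _ => (F.memY_y j).coord_mul j] with x hx
    have h3 : density (fun p => -∑ j, p.2 j * y j p) x
        = -density (fun p => ∑ j, p.2 j * y j p) x := integral_neg _
    rw [h3, hx, neg_mul, Finset.sum_mul]
  rw [e2, integral_neg, integral_finsetSum _ fun j _ => i1 j]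
  simp only [e, Finset.sum_neg_distrib, neg_neg]

theorem IsFlow.density_u (j : Fin d) : density (u j) =ᵐ[volume] fun x =>
    -(1 / (c.nu ^ 2 * c.mass)) * (n x * pot (dW j W) x) := by
  filter_upwards [(F.solves_u j).density hc h ((F.memY_u j).mono (by omega)),
    density_coord_mul_profile hc h hVW hn j] with x h1 h2
  rw [h2] at h1
  have h4 := hc.2.2.1.ne'
  have h5 := hc.2.2.2.ne'
  field_simp at h1 ⊢
  linear_combination -h1

/-- The factor 3 is 2 from the stress of `nM` plus 1 from the force acting on the density of `u_j`.
-/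
theorem IsFlow.density_coord_u (i j : Fin d) :
    density (fun p => p.2 i * u j p) =ᵐ[volume] fun x => 1 / c.nu *
      (n x * ((if i = j then 1 / (c.beta * c.mass) else 0) + 2 * c.coef * hessW W x i j)
        + 3 / (c.nu * c.mass) ^ 2 * (n x * (pot (dW i W) x * pot (dW j W) x))) := by
  filter_upwards [(F.solves_u j).density_coord hc h (F.memY_u j) i,
    density_coord_coord_mul_profile hc h hVW hn i j, F.density_u hc h hVW hn j] with x h1 h2 h3
  rw [h2, h3] at h1
  have h4 := hc.2.2.1.ne'
  have h5 := hc.2.2.2.ne'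
  generalize (if i = j then 1 / (c.beta * c.mass) else 0) = δ at h1 ⊢
  field_simp at h1 ⊢
  linear_combination -h1

/-- With `N = n[S(nM)]`, the term in `N ∂_iV` appears twice with equal weight: from the first moment
of `NM` in the source, and from the force acting on `n[z] = N/ν`. The Hessian term comes from the
commutators. -/
theorem IsFlow.density_coord_z (i : Fin d) :
    density (fun p => p.2 i * z p) =ᵐ[volume] fun x =>
      -(1 / (c.nu ^ 3 * c.mass ^ 2)) * (n x * ∑ j, hessW W x i j * pot (dW j W) x)
        - 2 / (c.nu ^ 2 * c.mass) *
          (density (fun p => -∑ j, p.2 j * y j p) x * pot (dW i W) x) := by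
  set N := density (fun p => -∑ j, p.2 j * y j p) with hNdef
  have hN : MemLp N 2 := F.memLp_density h
  have hP := (memY_mul_profile hc h hVW hN).1
  have hK : ∀ j, MemY (k + 1) (opK c.shift c.ampl (dW j W) (u j)) := fun j =>
    memY_opK_dW hc h j (by omega) le_rfl (F.memY_u j)
  have hKs : MemY (k + 1) (fun p => (-1) * ∑ j, opK c.shift c.ampl (dW j W) (u j) p) :=
    (MemY.sum _ fun j _ => hK j).const_mul (-1)
  have hKi : ∀ j, MemY k (fun p => p.2 i * opK c.shift c.ampl (dW j W) (u j) p) := fun j =>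
    (hK j).coord_mul i
  have z0 := F.solves_z.density hc h (F.memY_z.mono (by omega))
  have z1 := F.solves_z.density_coord hc h F.memY_z i
  have o0 := fun j => density_opK hc.shift_ne c.ampl h.dim (h.integrable_dW j)
    (measurable_dW h.measurable j) ((F.memY_u j).mono (by omega : k ≤ k + 1))
  have o1 := fun j => density_coord_opK hc.shift_ne c.ampl h.dim (h.integrable_dW j)
    (measurable_dW h.measurable j) (h.herm.dW j) (h.integrable_cW_dW i j) (F.memY_u j)
  have e0 : density (fun p => (-1) * ∑ j, opK c.shift c.ampl (dW j W) (u j) p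
      + N p.1 * profile c V p) =ᵐ[volume] N := by
    filter_upwards [density_add h.dim (hKs.mono (by omega)) (hP.mono (by omega)),
      density_sum Finset.univ h.dim fun j _ => (hK j).mono (by omega : k ≤ k + 1),
      ae_all_iff.2 o0, density_mul_profile hc h hVW hN] with x a1 a2 a3 a4
    rw [a1, density_const_mul, a2, a4]
    simp [a3, (h.herm.dW _).integral_ker]
  have e1 : density (fun p => p.2 i * ((-1) * ∑ j, opK c.shift c.ampl (dW j W) (u j) p
      + N p.1 * profile c V p)) =ᵐ[volume] fun x =>
        ∑ j, 1 / c.mass * (hessW W x i j * density (u j) x)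
          + -(1 / (c.nu * c.mass)) * (N x * pot (dW i W) x) := by
    have e2 : (fun p : Phase d => p.2 i * ((-1) * ∑ j, opK c.shift c.ampl (dW j W) (u j) p
        + N p.1 * profile c V p)) = fun p =>
          (-1) * (∑ j, p.2 i * opK c.shift c.ampl (dW j W) (u j) p)
            + p.2 i * (N p.1 * profile c V p) := by
      ext p
      rw [← Finset.mul_sum]
      ring
    rw [e2]
    have hKis := (MemY.sum Finset.univ fun j _ => hKi j).const_mul (-1)
    filter_upwards [density_add h.dim hKis ((MemY.coord_mul (j := k + 1) hP i).mono (by omega)),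
      density_sum Finset.univ h.dim fun j _ => hKi j,
      ae_all_iff.2 o1, density_coord_mul_profile hc h hVW hN i] with x a1 a2 a3 a4
    rw [a1, density_const_mul, a2, a4]
    simp only [a3, hc.shift_mul_ampl, hessW, neg_mul, Finset.sum_neg_distrib, one_mul, neg_neg]
  simp only [neg_one_mul] at e0 e1
  filter_upwards [z0, z1, e0, e1, ae_all_iff.2 fun j => F.density_u hc h hVW hn j]
    with x b0 b1 b2 b3 b4
  rw [b2] at b0
  rw [b3] at b1
  have h4 := hc.2.2.1.ne'
  have h5 := hc.2.2.2.ne'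
  have e3 : ∑ j, 1 / c.mass * (hessW W x i j * density (u j) x)
      = -(1 / (c.nu ^ 2 * c.mass ^ 2)) * (n x * ∑ j, hessW W x i j * pot (dW j W) x) := by
    simp only [b4, Finset.mul_sum]
    refine Finset.sum_congr rfl fun j _ => ?_
    field_simp
  rw [e3] at b1
  generalize n x * ∑ j, hessW W x i j * pot (dW j W) x = G at b1 ⊢
  rw [b0] at b1 ⊢
  field_simp at b1 ⊢
  linear_combination -b1

/-- The stream functional of the corrector, in terms of integrals over position space. -/
theorem IsFlow.stream {χ : Space d → ℝ} (hχ : IsTest χ) {ψ : Phase d → ℝ}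
    (hψ : ψ =ᵐ[volume] fun p => ∑ j, Y j p + z p) :
    Integrable (fun v : Space d => ∫ x, ψ (x, v) * ∑ i, v i * partialD i χ x) ∧
    ∫ v : Space d, ∫ x, ψ (x, v) * ∑ i, v i * partialD i χ x
      = 1 / (c.nu ^ 3 * c.mass ^ 2) *
          ∑ i, ((∑ j, ∫ x, n x * (hessW W x i j * pot (dW j W) x) * partialD i χ x)
            - ∑ j, ∫ x, n x * (pot (dW i W) x * pot (dW j W) x) * partialD j (partialD i χ) x)
        - 1 / (c.nu * c.beta * c.mass) * (∑ i, ∫ x, n x * partialD i (partialD i χ) x)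
        - 2 * c.coef / c.nu *
          ∑ i, ∑ j, ∫ x, n x * hessW W x i j * partialD j (partialD i χ) x := by
  set N := density (fun p => -∑ j, p.2 j * y j p) with hNdef
  have hN : MemLp N 2 := F.memLp_density h
  have mV := fun j => measurable_dW h.measurable j
  have lV : ∀ i, MemLp (fun x => n x * pot (dW i W) x) 2 := fun i =>
    memLp_mul_pot hn (h.integrable_dW i) (mV i)
  have lVV : ∀ i j, MemLp (fun x => n x * (pot (dW i W) x * pot (dW j W) x)) 2 := fun i j => by
    simpa only [mul_assoc] using memLp_mul_pot (lV i) (h.integrable_dW j) (mV j)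
  have lH : ∀ i j, MemLp (fun x => n x * hessW W x i j) 2 := fun i j =>
    memLp_mul_pot hn (h.integrable_dW_dW i j) (measurable_dW (mV j) i)
  have lHV : ∀ i j, MemLp (fun x => n x * (hessW W x i j * pot (dW j W) x)) 2 := fun i j => by
    simpa only [mul_assoc] using memLp_mul_pot (lH i j) (h.integrable_dW j) (mV j)
  have h4 := hc.2.2.1.ne'
  have h5 := hc.2.2.2.ne'
  have h6 := hc.2.1.ne'
  have d1 := fun i => hχ.partialD i
  have d2 := fun i j => (d1 i).partialD j
  -- `N` is the weak divergence of `n∇V/(νm)`. It is tested with `∂_iχ ∂_iV`, which is admissible by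
  -- `weak_div_mul_pot`. The derivative of `∂_iV` yields the Hessian term.
  have iv : ∀ i, ∫ x, N x * pot (dW i W) x * partialD i χ x
      = -(1 / (c.nu * c.mass)) *
        ((∑ j, ∫ x, n x * (pot (dW i W) x * pot (dW j W) x) * partialD j (partialD i χ) x)
          + ∑ j, ∫ x, n x * (hessW W x i j * pot (dW j W) x) * partialD i χ x) := fun i => by
    have e := weak_div_mul_pot (b := fun l x => -(1 / (c.nu * c.mass)) * (n x * pot (dW l W) x))
      (memLp_two_locallyIntegrable hN)
      (fun l => memLp_two_locallyIntegrable ((lV l).const_mul _))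
      (fun χ hχ => F.integral_density hc h hVW hn hχ) (h.integrable_dW i) (mV i)
      (fun l => h.integrable_dW_dW l i) (d1 i)
    have e' : ∀ x, N x * pot (dW i W) x * partialD i χ x
        = N x * partialD i χ x * pot (dW i W) x := fun x => by ring
    simp only [e']
    rw [e, ← Finset.sum_add_distrib, Finset.mul_sum]
    refine Finset.sum_congr rfl fun j _ => ?_
    have i1 : Integrable (fun x => n x * (pot (dW i W) x * pot (dW j W) x)
        * partialD j (partialD i χ) x) := (lVV i j).integrable_mul (d2 i j).memLp_space
    have i2 : Integrable (fun x => n x * (hessW W x i j * pot (dW j W) x) * partialD i χ x) :=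
      (lHV i j).integrable_mul (d1 i).memLp_space
    rw [← integral_add i1 i2, ← integral_const_mul]
    refine integral_congr_ae (Eventually.of_forall fun x => ?_)
    simp only
    rw [hessW_symm W x i j, hessW]
    ring
  have mu : ∀ i j, ∫ x, density (fun p => p.2 i * u j p) x * partialD j (partialD i χ) x
      = 1 / c.nu * ((if i = j then 1 / (c.beta * c.mass) else 0)
            * (∫ x, n x * partialD j (partialD i χ) x)
          + 2 * c.coef * (∫ x, n x * hessW W x i j * partialD j (partialD i χ) x)
          + 3 / (c.nu * c.mass) ^ 2 *
            ∫ x, n x * (pot (dW i W) x * pot (dW j W) x) * partialD j (partialD i χ) x) :=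
    fun i j => by
    have i1 : Integrable (fun x => n x * partialD j (partialD i χ) x) :=
      hn.integrable_mul (d2 i j).memLp_space
    have i2 : Integrable (fun x => n x * hessW W x i j * partialD j (partialD i χ) x) :=
      (lH i j).integrable_mul (d2 i j).memLp_space
    have i3 : Integrable (fun x => n x * (pot (dW i W) x * pot (dW j W) x)
        * partialD j (partialD i χ) x) := (lVV i j).integrable_mul (d2 i j).memLp_space
    have i4 : Integrable (fun x => (if i = j then 1 / (c.beta * c.mass) else 0)
        * (n x * partialD j (partialD i χ) x)
        + 2 * c.coef * (n x * hessW W x i j * partialD j (partialD i χ) x)) :=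
      (i1.const_mul _).add (i2.const_mul _)
    simp only [← integral_const_mul]
    rw [← integral_add (i1.const_mul _) (i2.const_mul _), ← integral_add i4 (i3.const_mul _),
      ← integral_const_mul]
    refine integral_congr_ae ?_
    filter_upwards [F.density_coord_u hc h hVW hn i j] with x hx
    rw [hx]
    ring
  have mz : ∀ i, ∫ x, density (fun p => p.2 i * z p) x * partialD i χ x
      = -(1 / (c.nu ^ 3 * c.mass ^ 2)) *
          (∑ j, ∫ x, n x * (hessW W x i j * pot (dW j W) x) * partialD i χ x)
        - 2 / (c.nu ^ 2 * c.mass) * ∫ x, N x * pot (dW i W) x * partialD i χ x := fun i => by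
    have i1 : ∀ j, Integrable (fun x => n x * (hessW W x i j * pot (dW j W) x)
        * partialD i χ x) := fun j => (lHV i j).integrable_mul (d1 i).memLp_space
    have i2 : Integrable (fun x => N x * pot (dW i W) x * partialD i χ x) :=
      (memLp_mul_pot hN (h.integrable_dW i) (mV i)).integrable_mul (d1 i).memLp_space
    rw [← integral_finsetSum _ fun j _ => i1 j, ← integral_const_mul, ← integral_const_mul,
      ← integral_sub ((integrable_finsetSum _ fun j _ => i1 j).const_mul _) (i2.const_mul _)]
    refine integral_congr_ae ?_
    filter_upwards [F.density_coord_z hc h hVW hn i] with x hx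
    rw [hx, ← Finset.sum_mul, ← Finset.mul_sum]
    ring
  obtain ⟨s1, s2⟩ := stream_eq h.dim F.memY_u F.memY_Y F.weakX_Y F.memY_z hψ hχ
  refine ⟨s1, ?_⟩
  rw [s2, Finset.mul_sum, Finset.mul_sum, Finset.mul_sum, ← Finset.sum_sub_distrib,
    ← Finset.sum_sub_distrib]
  refine Finset.sum_congr rfl fun i _ => ?_
  -- In units of `1/(ν³m²)`, the terms in `∂_iV ∂_jV` add up to `-3 + 2 = -1` and those in `∂_i∂_jV
  -- ∂_jV` to `-1 + 2 = 1`.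
  rw [mz, iv]
  simp only [mu, ← Finset.mul_sum, Finset.sum_add_distrib, ite_mul, zero_mul,
    Finset.sum_ite_eq, Finset.mem_univ, if_true]
  field_simp
  ring

end Flow

/-! ### Distributional form of the equation -/

theorem distDiv_eq {G S : Fin d → Space d → ℝ} (hG : ∀ i, G i =ᵐ[volume] S i)
    (hS : ∀ i, MemLp (S i) 2) {χ : Space d → ℝ} (hχ : IsTest χ) :
    distDiv G χ = -∑ i, ∫ x, S i x * partialD i χ x := by
  have i1 : ∀ i, Integrable (fun x => S i x * partialD i χ x) := fun i =>
    (hS i).integrable_mul (hχ.partialD i).memLp_space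
  rw [distDiv, ← integral_finsetSum _ fun i _ => i1 i]
  congr 1
  refine integral_congr_ae ?_
  filter_upwards [ae_all_iff.2 hG] with x hx
  simp only [hx]

/-- Symmetry of the tensor absorbs the exchange of the order of differentiation on `χ`. -/
theorem distDivDiv_eq {T S : Fin d → Fin d → Space d → ℝ} (hT : ∀ i j, T i j =ᵐ[volume] S i j)
    (hS : ∀ i j, MemLp (S i j) 2) (hsymm : ∀ i j, S i j = S j i) {χ : Space d → ℝ}
    (hχ : IsTest χ) :
    distDivDiv T χ = ∑ i, ∑ j, ∫ x, S i j x * partialD j (partialD i χ) x := by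
  have i1 : ∀ i j, Integrable (fun x => S i j x * partialD j (partialD i χ) x) := fun i j =>
    (hS i j).integrable_mul ((hχ.partialD i).partialD j).memLp_space
  simp only [← integral_finsetSum _ fun j _ => i1 _ j]
  rw [distDivDiv, ← integral_finsetSum _ fun i _ => integrable_finsetSum _ fun j _ => i1 i j]
  refine integral_congr_ae ?_
  filter_upwards [ae_all_iff.2 fun i => ae_all_iff.2 (hT i)] with x hx
  rw [Finset.sum_comm]
  refine Finset.sum_congr rfl fun i _ => Finset.sum_congr rfl fun j _ => ?_
  rw [hx, hsymm]

theorem distLapl_eq {u : Space d → ℝ} (hu : MemLp u 2) {χ : Space d → ℝ} (hχ : IsTest χ) :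
    distLapl u χ = ∑ i, ∫ x, u x * partialD i (partialD i χ) x := by
  have i1 : ∀ i, Integrable (fun x => u x * partialD i (partialD i χ) x) := fun i =>
    hu.integrable_mul ((hχ.partialD i).partialD i).memLp_space
  rw [distLapl, ← integral_finsetSum _ fun i _ => i1 i]
  simp only [Finset.mul_sum]

section Flow

variable {c : Constants} (hc : c.Pos) {k : ℕ} {W : Space d → ℂ} (h : Admissible k W)
  {V : Space d → ℝ} (hVW : V =ᵐ[volume] pot W) {n : Space d → ℝ}
  {y u Y : Fin d → Phase d → ℝ} {z : Phase d → ℝ} (F : IsFlow c V W k n y u Y z)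
  (hn : MemLp n 2) {χ : Space d → ℝ} (hχ : IsTest χ)
include hc h hVW F hn hχ

theorem IsFlow.integral_density_eq_distDiv :
    ∫ x, density (fun p => -∑ j, p.2 j * y j p) x * χ x
      = 1 / (c.nu * c.mass) * distDiv (fun i x => n x * grad V i x) χ := by
  rw [F.integral_density hc h hVW hn hχ, distDiv_eq (S := fun i x => n x * pot (dW i W) x)
    (fun i => (grad_ae_eq h hVW i).mono fun x hx => by simp only [hx])
    (fun i => memLp_mul_pot hn (h.integrable_dW i) (measurable_dW h.measurable i)) hχ,
    mul_neg, Finset.mul_sum, ← Finset.sum_neg_distrib]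
  refine Finset.sum_congr rfl fun i _ => ?_
  rw [← integral_const_mul, ← integral_neg]
  refine integral_congr_ae (Eventually.of_forall fun x => ?_)
  simp only
  ring

theorem IsFlow.stream_eq_dist {ψ : Phase d → ℝ} (hψ : ψ =ᵐ[volume] fun p => ∑ j, Y j p + z p) :
    Integrable (fun v : Space d => ∫ x, ψ (x, v) * ∑ i, v i * partialD i χ x) ∧
    ∫ v : Space d, ∫ x, ψ (x, v) * ∑ i, v i * partialD i χ x
      = -(1 / (c.nu * c.beta * c.mass) * distLapl n χ
        + 1 / (c.nu ^ 3 * c.mass ^ 2) *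
          (distDiv (fun i x => n x * ∑ j, hess V i j x * grad V j x) χ
            + distDivDiv (fun i j x => n x * (grad V i x * grad V j x)) χ)
        + c.beta * c.hbar ^ 2 / (12 * c.nu * c.mass ^ 2) *
          distDivDiv (fun i j x => n x * hess V i j x) χ) := by
  have mV := fun j => measurable_dW h.measurable j
  have lVV : ∀ i j, MemLp (fun x => n x * (pot (dW i W) x * pot (dW j W) x)) 2 := fun i j => by
    simpa only [mul_assoc] using
      memLp_mul_pot (memLp_mul_pot hn (h.integrable_dW i) (mV i)) (h.integrable_dW j) (mV j)
  have lH : ∀ i j, MemLp (fun x => n x * hessW W x i j) 2 := fun i j =>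
    memLp_mul_pot hn (h.integrable_dW_dW i j) (measurable_dW (mV j) i)
  have lHV : ∀ i j, MemLp (fun x => n x * (hessW W x i j * pot (dW j W) x)) 2 := fun i j => by
    simpa only [mul_assoc] using memLp_mul_pot (lH i j) (h.integrable_dW j) (mV j)
  have gV := fun i => grad_ae_eq h hVW i
  have gH := fun i j => hess_ae_eq h hVW i j
  have e1 : distDiv (fun i x => n x * ∑ j, hess V i j x * grad V j x) χ
      = -∑ i, ∑ j, ∫ x, n x * (hessW W x i j * pot (dW j W) x) * partialD i χ x := by
    rw [distDiv_eq (S := fun i x => ∑ j, n x * (hessW W x i j * pot (dW j W) x)) (fun i => ?_)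
      (fun i => memLp_finsetSum _ fun j _ => lHV i j) hχ]
    · congr 1
      refine Finset.sum_congr rfl fun i _ => ?_
      have i1 : ∀ j, Integrable (fun x => n x * (hessW W x i j * pot (dW j W) x)
          * partialD i χ x) := fun j => (lHV i j).integrable_mul (hχ.partialD i).memLp_space
      rw [← integral_finsetSum _ fun j _ => i1 j]
      simp only [Finset.sum_mul]
    · filter_upwards [ae_all_iff.2 (gH i), ae_all_iff.2 gV] with x a1 a2
      simp only [a1, a2, Finset.mul_sum]
  have e2 : distDivDiv (fun i j x => n x * (grad V i x * grad V j x)) χ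
      = ∑ i, ∑ j, ∫ x, n x * (pot (dW i W) x * pot (dW j W) x) * partialD j (partialD i χ) x :=
    distDivDiv_eq (S := fun i j x => n x * (pot (dW i W) x * pot (dW j W) x)) (fun i j => by
      filter_upwards [gV i, gV j] with x a1 a2
      rw [a1, a2]) lVV (fun i j => by simp only [mul_comm]) hχ
  have e3 : distDivDiv (fun i j x => n x * hess V i j x) χ
      = ∑ i, ∑ j, ∫ x, n x * hessW W x i j * partialD j (partialD i χ) x :=
    distDivDiv_eq (S := fun i j x => n x * hessW W x i j) (fun i j => by
      filter_upwards [gH i j] with x a1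
      rw [a1]) lH (fun i j => by ext x; rw [hessW_symm]) hχ
  obtain ⟨s1, s2⟩ := F.stream hc h hVW hn hχ hψ
  refine ⟨s1, ?_⟩
  have h5 := hc.2.2.2.ne'
  have h4 := hc.2.2.1.ne'
  have e4 : 2 * c.coef / c.nu = c.beta * c.hbar ^ 2 / (12 * c.nu * c.mass ^ 2) := by
    rw [Constants.coef]
    field_simp
    ring
  rw [s2, e1, e2, e3, distLapl_eq hn hχ, e4, Finset.sum_sub_distrib]
  ring

end Flow

end HighField

end

/-! ### The equivalence of the bulk equation and the drift-diffusion equation. -/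

open HighField

theorem mainTheorem3 {d k : ℕ} (hk : d < 2 * k) (c : Constants) (hc : c.Pos)
    {ε : ℝ} (hε : 0 < ε) {V : Space d → ℝ} (hV : MemH (k + 2) V)
    {n : ℝ → Space d → ℝ} (hn : ∀ t : ℝ, 0 < t → MemH 1 (n t)) :
    ∀ t : ℝ, 0 < t → (SolvesBulkAt c V k ε n t ↔ SolvesQDDAt c V ε n t) := by
  intro t ht
  obtain ⟨hV2, W, hdec, hherm, hI⟩ := hV.exists_isInvFT
  have h : Admissible k W := ⟨hk, hdec, hherm⟩
  have hVW : V =ᵐ[volume] pot W := hI.ae_eq_pot (memLp_two_locallyIntegrable hV2) h.integrable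
  have hn2 : ∀ s, 0 < s → MemLp (n s) 2 := fun s hs => (hn s hs).exists_isInvFT.1
  have hnt := hn2 t ht
  obtain ⟨y, u, Y, z, F⟩ := exists_isFlow hc h hVW (hn t ht)
  set f : Phase d → ℝ := fun p => -∑ j, p.2 j * y j p with hf
  have hN : MemLp (density f) 2 := F.memLp_density h
  have hS := F.isS hc h hVW hnt
  have hInv := F.isQACQInv hc h hVW hV2
  have hL := fun (χ : Space d → ℝ) (hχ : IsTest χ) (ψ : Phase d → ℝ)
    (hψ : ψ =ᵐ[volume] fun p => ∑ j, Y j p + z p) => F.stream_eq_dist hc h hVW hnt hχ hψ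
  have hD := fun (χ : Space d → ℝ) (hχ : IsTest χ) =>
    F.integral_density_eq_distDiv hc h hVW hnt hχ
  constructor
  · rintro ⟨φ', f', ψ', g, hφ, hf', hψ', ⟨-, a, ha, hsa, rfl⟩, heq⟩
    have ef : f' =ᵐ[volume] f := hf'.unique hS EventuallyEq.rfl
    have edf : density f' =ᵐ[volume] density f := density_congr ef
    have eQ : opQ c V f' =ᵐ[volume] opQ c V f := by
      filter_upwards [ef, ae_of_ae_fst edf] with p a1 a2
      rw [opQ, opQ, opP, opP, a1, a2]
    have eψ : ψ' =ᵐ[volume] fun p => ∑ j, Y j p + z p :=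
      hInv.2.2.2 ψ' hψ'.2.1 (hψ'.2.2.1.trans eQ)
    have eQψ : opQ c V ψ' =ᵐ[volume] fun p => ∑ j, Y j p + z p :=
      (opQ_ae_self hψ'.2.1.2).trans eψ
    -- `n(s)` is known to lie in L² only for `s > 0`, which covers a neighbourhood of `t`.
    have hpos : ∀ᶠ s in 𝓝 t, density (bulk c V (n s)) =ᵐ[volume] n s :=
      (eventually_gt_nhds ht).mono fun s hs => density_mul_profile hc h hVW (hn2 s hs)
    have hd := hφ.density hk hpos
    have hNa : MemLp (fun x => density f x - ε * a x) 2 := hN.sub (ha.const_mul ε)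
    have e : density φ' =ᵐ[volume] fun x => density f x - ε * a x := by
      -- Every term of the equation is `M` times a function of `x` alone, so taking the density
      -- loses nothing.
      have e1 : φ' =ᵐ[volume] fun p => (density f p.1 - ε * a p.1) * profile c V p := by
        filter_upwards [heq, ae_of_ae_fst edf] with p a1 a2
        rw [a1, opP, a2]
        ring
      exact (density_congr e1).trans (density_mul_profile hc h hVW hNa)
    refine ⟨density φ', hd, fun χ hχ => ?_⟩
    have i1 : Integrable (fun x => density f x * χ x) := hN.integrable_mul hχ.memLp_space
    have i2 : Integrable (fun x => a x * χ x) := ha.integrable_mul hχ.memLp_space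
    have e2 : ∫ x, density φ' x * χ x = (∫ x, density f x * χ x) - ε * ∫ x, a x * χ x := by
      rw [← integral_const_mul, ← integral_sub i1 (i2.const_mul ε)]
      refine integral_congr_ae ?_
      filter_upwards [e] with x hx
      rw [hx]
      ring
    rw [e2, (hsa χ hχ).2, (hL χ hχ _ eQψ).2, hD χ hχ]
    ring
  · rintro ⟨n', hd, hpde⟩
    have hn' := hd.2.1
    -- The only possible value of `n[Sψ]`, obtained by solving the density equation for it. It is in
    -- L² because `n'` and `n[S(nM)]` are, and the drift-diffusion equation says that it represents
    -- the stream functional of `ψ`.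
    set a : Space d → ℝ := fun x => ε⁻¹ * (density f x - n' x) with hadef
    have ha : MemLp a 2 := (hN.sub hn').const_mul _
    set ψ : Phase d → ℝ := fun p => ∑ j, Y j p + z p with hψdef
    have eQψ : opQ c V ψ =ᵐ[volume] ψ := opQ_ae_self hInv.2.1.2
    refine ⟨fun p => n' p.1 * profile c V p, f, ψ, fun p => profile c V p * a p.1,
      hd.bulk hc h hVW, hS, hInv, ⟨?_, a, ha, fun χ hχ => ?_, rfl⟩,
      Eventually.of_forall fun p => ?_⟩
    · exact memX_iff_memY.2 ((memX_iff_memY.1 hInv.2.1.1).congr eQψ.symm)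
    · obtain ⟨s1, s2⟩ := hL χ hχ _ eQψ
      refine ⟨s1, ?_⟩
      have i1 : Integrable (fun x => density f x * χ x) := hN.integrable_mul hχ.memLp_space
      have i2 : Integrable (fun x => n' x * χ x) := hn'.integrable_mul hχ.memLp_space
      have e2 : ∫ x, a x * χ x = ε⁻¹ * ((∫ x, density f x * χ x) - ∫ x, n' x * χ x) := by
        rw [← integral_sub i1 i2, ← integral_const_mul]
        refine integral_congr_ae (Eventually.of_forall fun x => ?_)
        simp only [hadef]
        ring
      rw [e2, s2, hD χ hχ, inv_mul_eq_iff_eq_mul₀ hε.ne']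
      linear_combination -(hpde χ hχ)
    · simp only [opP, hadef]
      field_simp
      ring
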